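/- Let $r\ge 1$ and let $\lambda^1,\dots,\lambda^r$ be partitions (possibly empty), $\lambda^B:=\bigoplus_{b\in B}\lambda^b$ (coordinatewise sum of parts) for $B\subseteq[r]$, and $n:=|\lambda^1|+\dots+|\lambda^r|=|\lambda^{[r]}|$. *Fillings.* Young diagrams are drawn in French convention; a box has arm-length (number of boxes to its right in its row) and leg-length (number of boxes above it in its column). Letters are taken from a totally ordered alphabet whose letters are positive or negative; write $x\le_{\pm}y$ if $x<y$, or $x=y$ is a positive (respectively negative) letter. The alphabet $\mathbb N_+$ has only positive letters. For a filling $\sigma$ of $\mu$ let $\mathrm{Des}(\sigma)$ be the set of boxes $\square$ lying directly above a box $\square'$ with $\sigma(\square')\le_-\sigma(\square)$ and $\mathrm{maj}(\sigma)=\sum_{\square\in \mathrm{Des}(\sigma)}(\mathrm{leg}(\square)+1)$. The reading order goes row by row from top to bottom, and from left to right in each row. Two distinct boxes attack each other if they are in the same row, or in consecutive rows with the upper one strictly to the right of the lower one. Let $\mathrm{Inv}(\sigma)$ be the set of attacking pairs $(\square,\square')$, $\square$ preceding $\square'$ in the reading order, with $\sigma(\square')\le_-\sigma(\square)$, and $\mathrm{inv}(\sigma)=\#\mathrm{Inv}(\sigma)-\sum_{\square\in\mathrm{Des}(\sigma)}\mathrm{arm}(\square)$.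 An *inversion pair* is a pair $(\square_1,\square_2)$ in one row, $\square_1$ to the left of $\square_2$, such that with $\square_3$ the box directly below $\square_1$ one has $\sigma(\square_1)\le_+\sigma(\square_3)\le_-\sigma(\square_2)$, or $\sigma(\square_3)\le_-\sigma(\square_2)\le_-\sigma(\square_1)$, or $\sigma(\square_2)\le_-\sigma(\square_1)\le_+\sigma(\square_3)$ (in the bottom row $\sigma(\square_3)$ is taken smaller than all entries). *Cumulants.* Over $\mathbb Q(q,t)$ let $\tilde H_\mu(\boldsymbol x;q,t)=\sum_{\sigma:\mu\to\mathbb N_+}q^{\mathrm{inv}(\sigma)}t^{\mathrm{maj}(\sigma)}\boldsymbol x^\sigma$ (Macdonald polynomial) and $$\kappa(\lambda^1,\dots,\lambda^r)=(q-1)^{1-r}\sum_{\pi}(-1)^{\#\pi-1}(\#\pi-1)!\prod_{B\in\pi}\tilde H_{\lambda^B},$$ the sum being over all set partitions $\pi$ of $[r]$ (Macdonald cumulant). *The polynomials $\mathcal I_G$.* The diagram $\lambda^{[r]}$ is obtained by sorting the columns of $\lambda^1,\dots,\lambda^r$ by decreasing length, columns of equal length being put in the order of their indices $b$; a column coming from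 $\lambda^b$ and its boxes have color $b$. For a filling $\sigma$ of $\lambda^{[r]}$ let $G^\sigma=G^\sigma_{\lambda^1,\dots,\lambda^r}$ be the multigraph on $[r]$ in which the number $e_{i,j}$ of edges linking $i$ and $j$ ($i=j$ allowed) is the number of inversion pairs of $\sigma$ whose set of colors is $\{i,j\}$. For a multigraph $G$ on $[r]$, with root $1$, $$\mathcal I_G(q)=q^{\#\text{loops}}\sum_{T}q^{\kappa(T)}\prod_{\{i,j\}\in T}[e_{i,j}]_q,\qquad [m]_q=1+q+\dots+q^{m-1},$$ the sum being over the spanning trees $T$ of the simple graph underlying $G$ (so $\mathcal I_G=0$ if $G$ is disconnected), where $\kappa(T)$ is the sum of $e_{\mathrm{parent}(i),j}$ over all pairs of non-root vertices $i>j$ such that $i$ is an ancestor of $j$ in $T$ and $j$ is adjacent to $\mathrm{parent}(i)$ in $G$. *Quasisymmetric functions.* For $D\subseteq[n-1]$ let $F_{n,D}(\boldsymbol x)=\sum x_{i_1}\cdots x_{i_n}$ over $i_1\le\dots\le i_n$ in $\mathbb N_+$ with $i_j<i_{j+1}$ for $j\in D$. Let $\mathcal A=\{1,\bar1,2,\bar2,\dots\}$,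 with positive letters $i$ and negative letters $\bar i$, carry any total order that restricts to the usual order on $\{1,2,\dots\}$; put $z_i=x_i$, $z_{\bar i}=y_i$, and let $\tilde F_{n,D}(\boldsymbol x,\boldsymbol y)=\sum z_{i_1}\cdots z_{i_n}$ over $i_1\le\dots\le i_n$ in $\mathcal A$ such that, whenever $i_j=i_{j+1}$, one has $j\notin D$ if this letter is positive and $j\in D$ if it is negative. A permutation $\sigma\in\mathfrak S_n$ is identified with the filling of $\lambda^{[r]}$ by $1,\dots,n$ whose reading word is $\sigma$, and $\mathrm{iDes}(\sigma)$ is the set of $i<n$ such that $i+1$ stands to the left of $i$ in $\sigma$. The superization of a symmetric function $f$ is $\tilde f(\boldsymbol x,\boldsymbol y)=\omega_{\boldsymbol Y}f[\boldsymbol X+\boldsymbol Y]$: expand $f$ in power sums and replace every $p_k$ by $p_k(\boldsymbol x)+(-1)^{k-1}p_k(\boldsymbol y)$. **Theorem.** 1. $\displaystyle \kappa(\lambda^1,\dots,\lambda^r)(\boldsymbol x)=\sum_{\sigma\in\mathfrak S_n}\mathcal I_{G^\sigma}(q)\,t^{\mathrm{maj}(\sigma)}\,F_{n,\mathrm{iDes}(\sigma)}(\boldsymbol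 x).$ 2. Consequently $\kappa(\lambda^1,\dots,\lambda^r)$ is $q,t$-positive in the fundamental basis: it has a unique expansion $\sum_{D\subseteq[n-1]}c_D\,F_{n,D}$ with $c_D\in\mathbb Q(q,t)$, and every $c_D$ is a polynomial in $q,t$ with nonnegative integer coefficients. 3. $\kappa(\lambda^1,\dots,\lambda^r)$ is a symmetric function, and its superization is $$\tilde\kappa(\lambda^1,\dots,\lambda^r)(\boldsymbol x,\boldsymbol y)=\sum_{\sigma\in\mathfrak S_n}\mathcal I_{G^\sigma}(q)\,t^{\mathrm{maj}(\sigma)}\,\tilde F_{n,\mathrm{iDes}(\sigma)}(\boldsymbol x,\boldsymbol y)=\sum_{\sigma:\lambda^{[r]}\to\mathcal A}\mathcal I_{G^\sigma}(q)\,t^{\mathrm{maj}(\sigma)}\,\boldsymbol z^\sigma .$$ -/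

import Mathlib

open scoped Classical

noncomputable section

namespace MacdonaldCumulant

/-! ## Coefficients and formal sums of monomials -/

/-- The field `ℚ(q,t)`. -/
abbrev Kqt : Type := FractionRing (MvPolynomial (Fin 2) ℚ)

/-- The indeterminate `q` of `ℚ(q,t)`. -/
def q : Kqt := algebraMap (MvPolynomial (Fin 2) ℚ) Kqt (MvPolynomial.X 0)

/-- The indeterminate `t` of `ℚ(q,t)`. -/
def t : Kqt := algebraMap (MvPolynomial (Fin 2) ℚ) Kqt (MvPolynomial.X 1)

/-- The formal power series `∑_f w(f) ∏_b z_{f(b)}`, the sum being over all functions `f : B → A`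
from a finite set `B`; the coefficient of a monomial is the (finite) sum of the `w(f)` over those
`f` with that monomial. -/
def monomialSum {A B : Type} [Fintype B] (w : (B → A) → Kqt) : MvPowerSeries A Kqt :=
  fun m => ∑ᶠ f : B → A, if ∑ b, Finsupp.single (f b) 1 = m then w f else 0

/-! ## Joint cumulants -/

/-- The joint cumulant `∑_{π ∈ P(J)} (-1)^{#π-1} (#π-1)! ∏_{B ∈ π} u_B` of a family `(u_B)_{B ⊆ J}`. -/
def jointCumulant {R J : Type} [CommRing R] [Fintype J] [DecidableEq J] (u : Finset J → R) : R :=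
  ∑ π : Finpartition (Finset.univ : Finset J),
    (-1 : R) ^ (π.parts.card - 1) * ((π.parts.card - 1).factorial : R) * ∏ B ∈ π.parts, u B

/-! ## Partitions

A partition is identified with its Young diagram.  A box `(i, j)` lies in row `i` and
column `j` (both counted from `0`), row `0` is the bottom row (French convention), and
`μ.rowLen i` is the part number `i + 1` of the partition. -/

/-- The partition `λ^B = ⨁_{b ∈ B} λ^b`: parts are added coordinatewise. -/
def oplus {r : ℕ} (lam : Fin r → YoungDiagram) (B : Finset (Fin r)) : YoungDiagram where
  cells := (Finset.range (∑ b ∈ B, (lam b).colLen 0) ×ˢ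
    Finset.range (∑ b ∈ B, (lam b).rowLen 0)).filter
      (fun c => c.2 < ∑ b ∈ B, (lam b).rowLen c.1)
  isLowerSet := by
    rintro ⟨i, j⟩ ⟨i', j'⟩ h hc
    obtain ⟨hi, hj⟩ : i' ≤ i ∧ j' ≤ j := h
    simp only [Finset.coe_filter, Finset.mem_product, Finset.mem_range, Set.mem_ofPred_eq] at hc ⊢
    refine ⟨⟨lt_of_le_of_lt hi hc.1.1, lt_of_le_of_lt hj hc.1.2⟩, ?_⟩
    exact lt_of_le_of_lt hj (lt_of_lt_of_le hc.2
      (Finset.sum_le_sum fun b _ => (lam b).rowLen_anti _ _ hi))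

theorem mem_oplus {r : ℕ} (lam : Fin r → YoungDiagram) (B : Finset (Fin r)) (i j : ℕ) :
    (i, j) ∈ oplus lam B ↔ j < ∑ b ∈ B, (lam b).rowLen i := by
  rw [← YoungDiagram.mem_cells]
  simp only [oplus, Finset.mem_filter, Finset.mem_product, Finset.mem_range]
  refine ⟨fun h => h.2, fun h => ⟨⟨?_, ?_⟩, h⟩⟩
  · obtain ⟨b, hb, hpos⟩ : ∃ b ∈ B, 0 < (lam b).rowLen i := by
      by_contra hcon
      push Not at hcon
      have h0 : ∑ b ∈ B, (lam b).rowLen i = 0 :=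
        Finset.sum_eq_zero fun b hb => Nat.le_zero.mp (hcon b hb)
      omega
    have h1 : i < (lam b).colLen 0 :=
      YoungDiagram.mem_iff_lt_colLen.mp (YoungDiagram.mem_iff_lt_rowLen.mpr hpos)
    exact lt_of_lt_of_le h1
      (Finset.single_le_sum (f := fun b => (lam b).colLen 0) (fun _ _ => Nat.zero_le _) hb)
  · exact lt_of_lt_of_le h
      (Finset.sum_le_sum fun b _ => (lam b).rowLen_anti _ _ (Nat.zero_le i))

theorem rowLen_oplus {r : ℕ} (lam : Fin r → YoungDiagram) (B : Finset (Fin r)) (i : ℕ) :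
    (oplus lam B).rowLen i = ∑ b ∈ B, (lam b).rowLen i := by
  apply le_antisymm
  · by_contra h
    push Not at h
    exact absurd ((mem_oplus lam B i _).mp (YoungDiagram.mem_iff_lt_rowLen.mpr h)) (lt_irrefl _)
  · by_contra h
    push Not at h
    exact absurd (YoungDiagram.mem_iff_lt_rowLen.mp ((mem_oplus lam B i _).mpr h)) (lt_irrefl _)

/-- The partition `λ^{[r]} = λ^1 ⊕ ⋯ ⊕ λ^r`. -/
def total {r : ℕ} (lam : Fin r → YoungDiagram) : YoungDiagram := oplus lam Finset.univ

theorem card_eq_sum_rowLen (μ : YoungDiagram) (N : ℕ) (hN : μ.colLen 0 ≤ N) :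
    μ.card = ∑ i ∈ Finset.range N, μ.rowLen i := by
  have h : ∀ c ∈ μ.cells, c.1 ∈ Finset.range N := by
    intro c hc
    have h1 : (c.1, 0) ∈ μ := μ.up_left_mem le_rfl (Nat.zero_le c.2) hc
    exact Finset.mem_range.mpr (lt_of_lt_of_le (YoungDiagram.mem_iff_lt_colLen.mp h1) hN)
  rw [YoungDiagram.card, Finset.card_eq_sum_card_fiberwise h]
  exact Finset.sum_congr rfl fun i _ => (YoungDiagram.rowLen_eq_card μ).symm

/-- `|λ^{[r]}| = |λ^1| + ⋯ + |λ^r|`. -/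
theorem card_total {r : ℕ} (lam : Fin r → YoungDiagram) :
    (total lam).card = ∑ b, (lam b).card := by
  have hle : ∀ b, (lam b).colLen 0 ≤ (total lam).colLen 0 + ∑ b, (lam b).colLen 0 := fun b =>
    le_trans (Finset.single_le_sum (f := fun b => (lam b).colLen 0)
      (fun _ _ => Nat.zero_le _) (Finset.mem_univ b)) (Nat.le_add_left _ _)
  rw [card_eq_sum_rowLen (total lam) _ (Nat.le_add_right _ (∑ b, (lam b).colLen 0)),
    Finset.sum_congr rfl fun b _ => card_eq_sum_rowLen (lam b) _ (hle b), Finset.sum_comm]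
  exact Finset.sum_congr rfl fun i _ => rowLen_oplus lam Finset.univ i

/-! ## Fillings and their statistics

The alphabet is a totally ordered set `A` with a predicate `neg` singling out its negative letters;
all the other letters are positive.  Ordinary fillings are those with letters in `ℕ+`, all of
them positive. -/

/-- Fillings of the boxes of `μ` by letters of `A`. -/
abbrev Filling (μ : YoungDiagram) (A : Type) : Type := μ.cells → A

/-- `x ≤₋ y`: either `x < y`, or `x = y` is a negative letter. -/
def leNeg {A : Type} [LinearOrder A] (neg : A → Prop) (x y : A) : Prop :=
  x < y ∨ (x = y ∧ neg x)

/-- `x ≤₊ y`: either `x < y`, or `x = y` is a positive letter. -/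
def lePos {A : Type} [LinearOrder A] (neg : A → Prop) (x y : A) : Prop :=
  x < y ∨ (x = y ∧ ¬ neg x)

/-- All letters of the alphabet `ℕ+` are positive. -/
def noNeg : ℕ+ → Prop := fun _ => False

/-- The box `u` lies directly above the box `w`. -/
def DirectlyAbove {μ : YoungDiagram} (u w : μ.cells) : Prop :=
  u.1.1 = w.1.1 + 1 ∧ u.1.2 = w.1.2

/-- The box `u` precedes the box `v` in the reading order (rows from top to bottom, each row from
left to right). -/
def Precedes {μ : YoungDiagram} (u v : μ.cells) : Prop :=
  v.1.1 < u.1.1 ∨ (u.1.1 = v.1.1 ∧ u.1.2 < v.1.2)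

/-- Two boxes attack each other: they lie in the same row, or in consecutive rows with the
box in the upper row strictly to the right of the one in the lower row. -/
def Attack {μ : YoungDiagram} (u v : μ.cells) : Prop :=
  (u ≠ v ∧ u.1.1 = v.1.1) ∨ (u.1.1 = v.1.1 + 1 ∧ v.1.2 < u.1.2) ∨
    (v.1.1 = u.1.1 + 1 ∧ u.1.2 < v.1.2)

/-- The arm-length of a box. -/
def arm {μ : YoungDiagram} (u : μ.cells) : ℕ := μ.rowLen u.1.1 - (u.1.2 + 1)

/-- The leg-length of a box. -/
def leg {μ : YoungDiagram} (u : μ.cells) : ℕ := μ.colLen u.1.2 - (u.1.1 + 1)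

section Statistics

variable {μ : YoungDiagram} {A : Type} [LinearOrder A] (neg : A → Prop) (f : Filling μ A)

/-- The descent set: boxes `u` directly above some box `w` with `f u ≥₋ f w`. -/
def Des : Finset μ.cells :=
  Finset.univ.filter fun u => ∃ w, DirectlyAbove u w ∧ leNeg neg (f w) (f u)

/-- The major index. -/
def maj : ℕ := ∑ u ∈ Des neg f, (leg u + 1)

/-- Inversions: attacking pairs `(u, v)` with `u` preceding `v` and `f u ≥₋ f v`. -/
def Inv : Finset (μ.cells × μ.cells) :=
  Finset.univ.filter fun p =>
    Attack p.1 p.2 ∧ Precedes p.1 p.2 ∧ leNeg neg (f p.2) (f p.1)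

/-- `inv(f) = #Inv(f) - ∑_{u ∈ Des(f)} arm(u)`. -/
def inv : ℕ := (Inv neg f).card - ∑ u ∈ Des neg f, arm u

/-- The boxes `u, v, w`, with `w` directly below `u`, are counterclockwise increasing. -/
def Counterclockwise (u v w : μ.cells) : Prop :=
  (lePos neg (f u) (f w) ∧ leNeg neg (f w) (f v)) ∨
  (leNeg neg (f w) (f v) ∧ leNeg neg (f v) (f u)) ∨
  (leNeg neg (f v) (f u) ∧ lePos neg (f u) (f w))

/-- Inversion pairs `(u, v)`: `u` is to the left of `v` in the same row, and `u`, `v` and the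
box directly below `u` are counterclockwise increasing.  In the first row the missing entry below
`u` counts as smaller than all entries, so that only the second of the three alternatives can
hold, and it says `f v ≤₋ f u`. -/
def InvP : Finset (μ.cells × μ.cells) :=
  Finset.univ.filter fun p =>
    p.1.1.1 = p.2.1.1 ∧ p.1.1.2 < p.2.1.2 ∧
      ((p.1.1.1 = 0 ∧ leNeg neg (f p.2) (f p.1)) ∨
        ∃ w, DirectlyAbove p.1 w ∧ Counterclockwise neg f p.1 p.2 w)

end Statistics

/-! ## Macdonald polynomials and Macdonald cumulants -/

/-- The Macdonald polynomial `H̃_μ(x;q,t) = ∑_{f : μ → ℕ+} q^{inv f} t^{maj f} x^f`. -/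
def macdonaldH (μ : YoungDiagram) : MvPowerSeries ℕ+ Kqt :=
  monomialSum fun f : Filling μ ℕ+ => q ^ inv noNeg f * t ^ maj noNeg f

/-- The Macdonald cumulant `κ(λ^1,…,λ^r)`: the joint cumulant of the family `u_B = H̃_{λ^B}`,
divided by `(q-1)^{r-1}`. -/
def macdonaldCumulant {r : ℕ} (lam : Fin r → YoungDiagram) : MvPowerSeries ℕ+ Kqt :=
  ((q - 1) ^ (r - 1))⁻¹ • jointCumulant fun B : Finset (Fin r) => macdonaldH (oplus lam B)

/-! ## Multigraphs and the `G`-inversion polynomial -/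

/-- A multigraph on `V`, possibly with loops, given by the numbers `e i j` of edges linking
`i` with `j`; `e i i` is the number of loops at `i`. -/
structure Multigraph (V : Type) where
  e : V → V → ℕ
  symm : ∀ i j, e i j = e j i

/-- The simple graph obtained from `G` by replacing multiple edges by single ones (loops play no
role for spanning trees). -/
def Multigraph.simple {V : Type} (G : Multigraph V) : SimpleGraph V where
  Adj i j := i ≠ j ∧ 0 < G.e i j
  symm := ⟨fun i j h => ⟨h.1.symm, by rw [G.symm]; exact h.2⟩⟩
  loopless := ⟨fun _ h => h.1 rfl⟩

section InversionPolynomial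

variable {r : ℕ} [NeZero r]

/-- In the tree `T` with root `0`, the vertex `i` is an ancestor of `j` (and `j` a descendant of
`i`): `i ≠ j` lies on the path from `j` to the root. -/
def IsAncestor (T : SimpleGraph (Fin r)) (i j : Fin r) : Prop :=
  i ≠ j ∧ ∃ p : T.Walk j 0, p.IsPath ∧ i ∈ p.support

/-- `p` is the parent of `i`: an ancestor adjacent to it. -/
def IsParent (T : SimpleGraph (Fin r)) (p i : Fin r) : Prop :=
  IsAncestor T p i ∧ T.Adj p i

/-- `(i, j)` is a `κ`-inversion of `T`, where `p` is the parent of `i`. -/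
def IsKappaInversion (G : Multigraph (Fin r)) (T : SimpleGraph (Fin r)) (p i j : Fin r) : Prop :=
  i ≠ 0 ∧ j ≠ 0 ∧ IsAncestor T i j ∧ j < i ∧ IsParent T p i ∧ 0 < G.e p j

/-- `κ(T)`: the sum of `e_{parent(i), j}(G)` over the `κ`-inversions `(i, j)` of `T`. -/
def kappa (G : Multigraph (Fin r)) (T : SimpleGraph (Fin r)) : ℕ :=
  ∑ x ∈ (Finset.univ : Finset (Fin r × Fin r × Fin r)).filter
    (fun x => IsKappaInversion G T x.1 x.2.1 x.2.2), G.e x.1 x.2.2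

/-- The `q`-integer `[n]_q = 1 + q + ⋯ + q^{n-1}`. -/
def qInt (n : ℕ) : Polynomial ℕ := ∑ k ∈ Finset.range n, Polynomial.X ^ k

/-- The `G`-inversion polynomial: the sum over spanning trees `T` of the simple graph underlying `G`
of `q^{κ(T)} ∏_{{i,j} ∈ T} [e_{i,j}(G)]_q`, times `q` to the number of loops.  It is `0` if
`G` is not connected. -/
def inversionPolynomial (G : Multigraph (Fin r)) : Polynomial ℕ :=
  Polynomial.X ^ (∑ i, G.e i i) *
    ∑ T ∈ (Finset.univ : Finset (SimpleGraph (Fin r))).filter (fun T => T.IsTree ∧ T ≤ G.simple),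
      Polynomial.X ^ kappa G T *
        ∏ x ∈ (Finset.univ : Finset (Fin r × Fin r)).filter (fun x => x.1 < x.2 ∧ T.Adj x.1 x.2),
          qInt (G.e x.1 x.2)

end InversionPolynomial

/-! ## The coloring of `λ^{[r]}` and the multigraph of a filling -/

/-- All columns of `λ^1, …, λ^r`: the pair `(b, k)` is the column `k` of `λ^b`. -/
def columns {r : ℕ} (lam : Fin r → YoungDiagram) : Finset (Σ _ : Fin r, ℕ) :=
  Finset.univ.sigma fun b => Finset.range ((lam b).rowLen 0)

/-- Columns are sorted by decreasing length; columns of equal length are sorted by color `b`, and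
columns of equal length in the same `λ^b` keep their order. -/
def ColBefore {r : ℕ} (lam : Fin r → YoungDiagram) (x y : Σ _ : Fin r, ℕ) : Prop :=
  (lam y.1).colLen y.2 < (lam x.1).colLen x.2 ∨
    ((lam x.1).colLen x.2 = (lam y.1).colLen y.2 ∧ (x.1 < y.1 ∨ (x.1 = y.1 ∧ x.2 < y.2)))

/-- The position in `λ^{[r]}` (counted from `0`) of a column of one of the `λ^b`. -/
def colPosition {r : ℕ} (lam : Fin r → YoungDiagram) (x : Σ _ : Fin r, ℕ) : ℕ :=
  ((columns lam).filter fun y => ColBefore lam y x).card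

/-- The column `c` of `λ^{[r]}` is colored by `b`. -/
def HasColor {r : ℕ} (lam : Fin r → YoungDiagram) (c : ℕ) (b : Fin r) : Prop :=
  ∃ x ∈ columns lam, x.1 = b ∧ colPosition lam x = c

/-- The multigraph `G^f_{λ^1,…,λ^r}` of a filling `f` of `λ^{[r]}`: the number of edges linking `i`
with `j` is the number of inversion pairs of `f` colored by the set `{i, j}`. -/
def fillingGraph {r : ℕ} (lam : Fin r → YoungDiagram) {A : Type} [LinearOrder A] (neg : A → Prop)
    (f : Filling (total lam) A) : Multigraph (Fin r) where
  e i j := ((InvP neg f).filter fun p =>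
    (HasColor lam p.1.1.2 i ∧ HasColor lam p.2.1.2 j) ∨
      (HasColor lam p.1.1.2 j ∧ HasColor lam p.2.1.2 i)).card
  symm i j := by
    congr 1
    ext p
    simp only [Finset.mem_filter]
    tauto

/-- The weight `I_{G^f}(q) t^{maj(f)}` of a filling `f` of `λ^{[r]}`. -/
def cumulantWeight {r : ℕ} [NeZero r] (lam : Fin r → YoungDiagram) {A : Type} [LinearOrder A]
    (neg : A → Prop) (f : Filling (total lam) A) : Kqt :=
  Polynomial.aeval q (inversionPolynomial (fillingGraph lam neg f)) * t ^ maj neg f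

/-! ## Permutations as standard fillings -/

/-- The number of boxes of `μ` preceding `u` in the reading order. -/
def readingIndex {μ : YoungDiagram} (u : μ.cells) : Fin μ.card :=
  ⟨(Finset.univ.filter fun v : μ.cells => Precedes v u).card, by
    have h : (Finset.univ.filter fun v : μ.cells => Precedes v u) ⊂ Finset.univ := by
      rw [Finset.filter_ssubset]
      exact ⟨u, Finset.mem_univ _, by simp [Precedes]⟩
    have h2 := Finset.card_lt_card h
    rwa [Finset.card_univ, Fintype.card_coe] at h2⟩

/-- The standard filling of `μ` whose reading word is the permutation `τ` (in one-line notation,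
with letters `1, …, n`). -/
def standardFilling (μ : YoungDiagram) (τ : Equiv.Perm (Fin μ.card)) : Filling μ ℕ+ :=
  fun u => Nat.succPNat (τ (readingIndex u))

/-- The set of inverse descents `i ∈ {1, …, n-1}` of `τ`: `i + 1` lies to the left of `i` in the
word `τ` (whose letter at place `a` is `τ a + 1`). -/
def iDes {n : ℕ} (τ : Equiv.Perm (Fin n)) : Finset ℕ :=
  (Finset.Icc 1 (n - 1)).filter fun i =>
    ∃ a b : Fin n, (τ a : ℕ) + 1 = i ∧ (τ b : ℕ) + 1 = i + 1 ∧ b < a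

/-! ## Fundamental quasisymmetric functions -/

/-- The fundamental quasisymmetric function `F_{n,D}(x)`, `D ⊆ {1, …, n-1}`: the sum of
`x_{i_1} ⋯ x_{i_n}` over `i_1 ≤ ⋯ ≤ i_n` with `i_j < i_{j+1}` whenever `j ∈ D`. -/
def fundamentalF (n : ℕ) (D : Finset ℕ) : MvPowerSeries ℕ+ Kqt :=
  monomialSum fun i : Fin n → ℕ+ =>
    if Monotone i ∧ ∀ a b : Fin n, (b : ℕ) = a + 1 → (a : ℕ) + 1 ∈ D → i a < i b then 1 else 0

/-- The super alphabet: positive letters `1, 2, …` and negative letters `1̄, 2̄, …`. -/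
inductive SuperLetter : Type
  | pos (i : ℕ+) : SuperLetter
  | bar (i : ℕ+) : SuperLetter

/-- The negative letters. -/
def SuperLetter.IsNeg (a : SuperLetter) : Prop := ∃ i, a = SuperLetter.bar i

/-- The super quasisymmetric function `F̃_{n,D}(x,y)`; the variables are `x_i = z_{pos i}` and
`y_i = z_{bar i}`. -/
def superF [LinearOrder SuperLetter] (n : ℕ) (D : Finset ℕ) : MvPowerSeries SuperLetter Kqt :=
  monomialSum fun i : Fin n → SuperLetter =>
    if Monotone i ∧ ∀ a b : Fin n, (b : ℕ) = a + 1 → i a = i b →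
      ((¬ (i a).IsNeg → (a : ℕ) + 1 ∉ D) ∧ ((i a).IsNeg → (a : ℕ) + 1 ∈ D)) then 1 else 0

/-! ## Superization -/

/-- The power sum `p_k = ∑_{a ∈ S} z_a^k` in the variables indexed by `S ⊆ A`. -/
def powerSum {A : Type} (S : Set A) (k : ℕ+) : MvPowerSeries A Kqt :=
  fun m => if ∃ a ∈ S, m = Finsupp.single a (k : ℕ) then 1 else 0

/-- The symmetric function in `x` given by a polynomial in the power sums `p_k(x)`. -/
def ofPowerSums : MvPolynomial ℕ+ Kqt →ₐ[Kqt] MvPowerSeries ℕ+ Kqt :=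
  MvPolynomial.aeval (powerSum Set.univ)

/-- The function of `x, y` given by a polynomial in `p_k(x)` (indexed by `Sum.inl k`) and
`p_k(y)` (indexed by `Sum.inr k`). -/
def ofPowerSums₂ : MvPolynomial (ℕ+ ⊕ ℕ+) Kqt →ₐ[Kqt] MvPowerSeries SuperLetter Kqt :=
  MvPolynomial.aeval (Sum.elim (powerSum (Set.range SuperLetter.pos))
    (powerSum (Set.range SuperLetter.bar)))

/-- The plethystic substitution `f ↦ f[X + Y]`, that is `p_k ↦ p_k(x) + p_k(y)`. -/
def plethXY : MvPolynomial ℕ+ Kqt →ₐ[Kqt] MvPolynomial (ℕ+ ⊕ ℕ+) Kqt :=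
  MvPolynomial.aeval fun k => MvPolynomial.X (Sum.inl k) + MvPolynomial.X (Sum.inr k)

/-- The involution `ω_Y`: it fixes `p_k(x)` and sends `p_k(y)` to `(-1)^{k-1} p_k(y)`, hence
`p_λ(y)` to `(-1)^{|λ| + ℓ(λ)} p_λ(y)`. -/
def omegaY : MvPolynomial (ℕ+ ⊕ ℕ+) Kqt →ₐ[Kqt] MvPolynomial (ℕ+ ⊕ ℕ+) Kqt :=
  MvPolynomial.aeval (Sum.elim (fun k => MvPolynomial.X (Sum.inl k))
    (fun k => (-1) ^ ((k : ℕ) + 1) * MvPolynomial.X (Sum.inr k)))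

/-- `f` is a symmetric function (it has an expansion in the power sum basis) and
`g` is its superization `ω_Y f[X + Y]`. -/
def IsSuperization (f : MvPowerSeries ℕ+ Kqt) (g : MvPowerSeries SuperLetter Kqt) : Prop :=
  (∃ P, ofPowerSums P = f) ∧
    ∀ P, ofPowerSums P = f → ofPowerSums₂ (omegaY (plethXY P)) = g

end MacdonaldCumulant

end

open MacdonaldCumulant

/-! All series involved are generating functions of words or fillings, so most identities between
them reduce to identities between the weights of a single filling.

Expansion of κ. The statistic `inv` is the number of inversion pairs (`inv_eq_card_InvP`). Given a
set partition π of the colors, a filling of λ^{[r]} amounts to one filling of λ^B for each block B,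
and keeping only the columns with colors in B preserves descents, legs and inversion pairs. Hence
the product of the H̃_{λ^B} is the sum over fillings f of λ^{[r]} with weight t^{maj f} ∏_B
q^{e(B)}, where e(B) counts the edges and loops of G^f inside B (`prod_macdonaldH`). So κ reduces,
filling by filling, to the joint cumulant of B ↦ q^{e(B)}, and this cumulant is (q-1)^{r-1} I_G(q)
(`jointCumulant_pow_eq`). Indeed, apart from loops, adding a vertex p to B multiplies q^{e(B)} by a
factor multiplicative in B. This yields a quadratic recursion for the cumulants
(`cumulantOn_recursion`), and the weighted count of trees obeys the same one: cut the edge that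
leads from the root towards a marked vertex (`treeSum_recursion`).

Fundamental basis. The weight I_G t^{maj} depends only on which pairs of boxes, in reading order,
form inversions, hence only on the standardization of the filling. The words with a given
standardization τ have generating function F̃_{n,iDes τ} in any alphabet
(`monomialSum_eq_sum_genF`). Positivity is then visible, since I_G has coefficients in ℕ, and
uniqueness is the linear independence of the F_{n,D} (`linearIndependent_genF`).

Superization. The span of the pairs (F_{n,D}, F̃_{n,D}) is closed under products, because the
product rule comes from standardization and has the same structure constants in every alphabet. It
contains the pairs (p_k, p_k(x) + (-1)^{k-1} p_k(y)), and by linear independence it is the graph of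
a map. A symmetric function expanded in the F_{n,D} is therefore superized by replacing each F by F̃
(`isSuperization_of_mem_superSpan`).

Symmetry. It suffices to treat H̃_μ, which is a generating function of words with a weight c(u,v)
attached to each inversion (u,v). The weights are nested: if c(u,w) ≠ 1, then every z between u and
w has c(u,z) = c(z,w) = q. Exchanging the variables x_i and x_{i+1} only concerns two-letter words,
for which symmetry follows by removing nontrivial weights one at a time
(`sum_twoLetterWeight_symm`). In characteristic 0 a symmetric homogeneous series is a polynomial in
power sums (`exists_ofPowerSums_eq`). -/

noncomputable section

namespace MacdonaldCumulant

/-! ### Algebra of generating functions of words -/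

section MonomialSum

variable {A B B' : Type} [Fintype B] [Fintype B']

/-- The content of a word: the exponent of its monomial. -/
def content (f : B → A) : A →₀ ℕ := ∑ b, Finsupp.single (f b) 1

theorem content_apply [DecidableEq A] (f : B → A) (a : A) :
    content f a = (Finset.univ.filter fun b => f b = a).card := by
  simp [content, Finsupp.finsetSum_apply, Finsupp.single_apply]

theorem mem_support_content (f : B → A) (b : B) : f b ∈ (content f).support := by
  rw [Finsupp.mem_support_iff, content_apply]
  exact Finset.card_ne_zero.mpr ⟨b, by simp⟩

theorem finite_content (m : A →₀ ℕ) : {f : B → A | content f = m}.Finite := by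
  refine (Set.Finite.pi' (t := fun _ : B => (m.support : Set A))
    fun _ => m.support.finite_toSet).subset ?_
  rintro f rfl b
  exact mem_support_content f b

/-- The words of a given content. -/
def contentFiber (B : Type) [Fintype B] (m : A →₀ ℕ) : Finset (B → A) :=
  (finite_content (B := B) m).toFinset

@[simp] theorem mem_contentFiber {m : A →₀ ℕ} {f : B → A} :
    f ∈ contentFiber B m ↔ content f = m := by
  simp [contentFiber]

theorem coeff_monomialSum (w : (B → A) → Kqt) (m : A →₀ ℕ) :
    MvPowerSeries.coeff m (monomialSum w) = ∑ f ∈ contentFiber B m, w f := by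
  change (∑ᶠ f : B → A, if content f = m then w f else 0) = _
  rw [finsum_eq_sum_of_support_subset (s := contentFiber B m)]
  · exact Finset.sum_congr rfl fun f hf => if_pos (mem_contentFiber.mp hf)
  · intro f hf
    by_contra h
    exact hf (if_neg (by simpa using h))

theorem content_comp_equiv (e : B ≃ B') (f : B' → A) : content (f ∘ e) = content f :=
  Equiv.sum_comp e fun b => Finsupp.single (f b) 1

theorem monomialSum_equiv (e : B ≃ B') (w : (B → A) → Kqt) :
    monomialSum w = monomialSum fun f : B' → A => w (f ∘ e) := by
  ext m
  rw [coeff_monomialSum, coeff_monomialSum]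
  refine Finset.sum_nbij' (fun f => f ∘ e.symm) (fun f => f ∘ e) ?_ ?_ ?_ ?_ ?_
  · intro f hf
    simp only [mem_contentFiber] at hf ⊢
    rw [content_comp_equiv, hf]
  · intro f hf
    simp only [mem_contentFiber] at hf ⊢
    rw [content_comp_equiv, hf]
  · intro f _
    funext b
    simp
  · intro f _
    funext b
    simp
  · intro f _
    congr 1
    funext b
    simp

theorem monomialSum_smul (c : Kqt) (w : (B → A) → Kqt) :
    monomialSum (fun f => c * w f) = c • monomialSum w := by
  ext m
  rw [MvPowerSeries.coeff_smul, coeff_monomialSum, coeff_monomialSum, Finset.mul_sum]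

theorem monomialSum_sum {ι : Type*} (s : Finset ι) (w : ι → (B → A) → Kqt) :
    monomialSum (fun f => ∑ i ∈ s, w i f) = ∑ i ∈ s, monomialSum (w i) := by
  ext m
  rw [map_sum, coeff_monomialSum, Finset.sum_comm]
  simp only [coeff_monomialSum]

theorem content_sum (f : B ⊕ B' → A) :
    content f = content (f ∘ Sum.inl) + content (f ∘ Sum.inr) := by
  simp [content, Fintype.sum_sum_type]

theorem monomialSum_mul (w : (B → A) → Kqt) (w' : (B' → A) → Kqt) :
    monomialSum w * monomialSum w' =
      monomialSum fun f : B ⊕ B' → A => w (f ∘ Sum.inl) * w' (f ∘ Sum.inr) := by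
  ext m
  rw [MvPowerSeries.coeff_mul, coeff_monomialSum]
  simp only [coeff_monomialSum, Finset.sum_mul_sum]
  simp only [← Finset.sum_product']
  rw [Finset.sum_sigma']
  refine Finset.sum_nbij' (fun x => Sum.elim x.2.1 x.2.2)
    (fun f => ⟨(content (f ∘ Sum.inl), content (f ∘ Sum.inr)), (f ∘ Sum.inl, f ∘ Sum.inr)⟩)
    ?_ ?_ ?_ ?_ ?_
  · rintro ⟨⟨m₁, m₂⟩, f, g⟩ h
    simp only [Finset.mem_sigma, Finset.HasAntidiagonal.mem_antidiagonal, Finset.mem_product,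
      mem_contentFiber] at h ⊢
    rw [content_sum, Sum.elim_comp_inl, Sum.elim_comp_inr, h.2.1, h.2.2, h.1]
  · intro f hf
    simp only [Finset.mem_sigma, Finset.HasAntidiagonal.mem_antidiagonal, Finset.mem_product,
      mem_contentFiber, and_self, and_true] at hf ⊢
    rw [← content_sum, hf]
  · rintro ⟨⟨m₁, m₂⟩, f, g⟩ h
    simp only [Finset.mem_sigma, Finset.HasAntidiagonal.mem_antidiagonal, Finset.mem_product,
      mem_contentFiber] at h
    obtain ⟨_, rfl, rfl⟩ := h
    simp
  · intro f _
    funext b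
    cases b <;> rfl
  · rintro ⟨⟨m₁, m₂⟩, f, g⟩ _
    simp

theorem monomialSum_isEmpty [IsEmpty B] (w : (B → A) → Kqt) :
    monomialSum w = MvPowerSeries.C (w isEmptyElim) := by
  ext m
  rw [coeff_monomialSum, MvPowerSeries.coeff_C]
  have h : ∀ f : B → A, content f = 0 := fun f => by simp [content]
  split_ifs with hm
  · subst hm
    have : contentFiber B (0 : A →₀ ℕ) = {isEmptyElim} := by
      ext f
      simp [h, Subsingleton.elim f isEmptyElim]
    rw [this, Finset.sum_singleton]
  · refine Finset.sum_eq_zero fun f hf => absurd ?_ hm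
    rw [← mem_contentFiber.mp hf, h]

/-- Splitting off one index of a family of sets of boxes. -/
def sigmaInsertEquiv {ι : Type} {β : ι → Type} {a : ι} {s : Finset ι} (ha : a ∉ s) :
    (β a ⊕ Σ i : s, β i) ≃ Σ i : (insert a s : Finset ι), β i where
  toFun := Sum.elim (fun b => ⟨⟨a, Finset.mem_insert_self a s⟩, b⟩)
    (fun x => ⟨⟨x.1.1, Finset.mem_insert_of_mem x.1.2⟩, x.2⟩)
  invFun x := if h : x.1.1 = a then Sum.inl (h ▸ x.2)
    else Sum.inr ⟨⟨x.1.1, Finset.mem_of_mem_insert_of_ne x.1.2 h⟩, x.2⟩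
  left_inv := by
    rintro (b | ⟨⟨i, hi⟩, b⟩)
    · simp
    · have : i ≠ a := fun h => ha (h ▸ hi)
      simp [this]
  right_inv := by
    rintro ⟨⟨i, hi⟩, b⟩
    by_cases h : i = a
    · subst h
      simp
    · simp [h]

/-- Used with the diagrams of the λ^B as the sets β i, so that a product of Macdonald polynomials
becomes one sum over fillings of a disjoint union of diagrams. -/
theorem prod_monomialSum {ι : Type} {β : ι → Type} [∀ i, Fintype (β i)] (s : Finset ι)
    (w : ∀ i, (β i → A) → Kqt) :
    ∏ i ∈ s, monomialSum (w i) =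
      monomialSum fun f : (Σ i : s, β i) → A => ∏ i : s, w i fun b => f ⟨i, b⟩ := by
  induction s using Finset.induction_on with
  | empty =>
    rw [monomialSum_isEmpty]
    simp
  | insert a s ha ih =>
    rw [Finset.prod_insert ha, ih, monomialSum_mul, monomialSum_equiv (sigmaInsertEquiv ha)]
    congr 1
    funext f
    rw [Finset.univ_eq_attach, Finset.univ_eq_attach, Finset.attach_insert,
      Finset.prod_insert (by simpa using ha), Finset.prod_image]
    · rfl
    · exact fun x _ y _ h => Subtype.ext (congrArg Subtype.val h :)

end MonomialSum

/-! ### Standardization of words over a signed alphabet -/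

section Standardization

variable {A : Type} [LinearOrder A] (neg : A → Prop) {n : ℕ}

/-- The permutation `τ` has the same inversions as the word `f`. -/
def Standardizes (f : Fin n → A) (τ : Equiv.Perm (Fin n)) : Prop :=
  ∀ a b, a < b → (leNeg neg (f b) (f a) ↔ τ b < τ a)

theorem Standardizes.lt_iff {neg : A → Prop} {f : Fin n → A} {τ τ' : Equiv.Perm (Fin n)}
    (h : Standardizes neg f τ) (h' : Standardizes neg f τ') (a b : Fin n) :
    τ b < τ a ↔ τ' b < τ' a := by
  rcases lt_trichotomy a b with hab | rfl | hab
  · rw [← h a b hab, ← h' a b hab]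
  · simp
  · have := (h b a hab).symm.trans (h' b a hab)
    have h1 : τ a ≠ τ b := fun he => hab.ne' (τ.injective he)
    have h2 : τ' a ≠ τ' b := fun he => hab.ne' (τ'.injective he)
    constructor
    · intro h3
      by_contra h4
      exact absurd (this.mpr (lt_of_le_of_ne (not_lt.mp h4) h2)) h3.asymm
    · intro h3
      by_contra h4
      exact absurd (this.mp (lt_of_le_of_ne (not_lt.mp h4) h1)) h3.asymm

/-- Two permutations with the same inversions compare all places alike, so τ' ∘ τ⁻¹ is an order
automorphism of a finite chain, hence the identity. -/
theorem Standardizes.unique {neg : A → Prop} {f : Fin n → A} {τ τ' : Equiv.Perm (Fin n)}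
    (h : Standardizes neg f τ) (h' : Standardizes neg f τ') : τ = τ' := by
  have hmono : StrictMono fun x => τ' (τ.symm x) := by
    intro x y hxy
    rw [← h.lt_iff h']
    simpa using hxy
  have hid := Subsingleton.elim
    (StrictMono.orderIsoOfSurjective _ hmono (τ'.surjective.comp τ.symm.surjective))
    (OrderIso.refl (Fin n))
  ext a
  have h2 := congrArg (fun e : Fin n ≃o Fin n => e (τ a)) hid
  simp only [StrictMono.coe_orderIsoOfSurjective, Equiv.symm_apply_apply,
    OrderIso.refl_apply] at h2
  rw [h2]

theorem exists_standardizes (f : Fin n → A) : ∃ τ, Standardizes neg f τ := by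
  -- Places are sorted by letter; equal positive letters are read from left to right and equal
  -- negative letters from right to left. The sign in the second component encodes this
  -- tie-breaking.
  let k : Fin n → A ×ₗ ℤ := fun a => toLex (f a, if neg (f a) then -(a : ℤ) else (a : ℤ))
  have hk : Function.Injective k := by
    intro a b hab
    have h1 : f a = f b := congrArg (fun x => (ofLex x).1) hab
    have h2 : (if neg (f a) then -(a : ℤ) else (a : ℤ)) =
      if neg (f b) then -(b : ℤ) else (b : ℤ) := congrArg (fun x => (ofLex x).2) hab
    rw [h1] at h2
    split_ifs at h2 <;> exact Fin.ext (by omega)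
  have hs : StrictMono (k ∘ Tuple.sort k) :=
    (Tuple.monotone_sort k).strictMono_of_injective (hk.comp (Tuple.sort k).injective)
  refine ⟨(Tuple.sort k).symm, fun a b hab => ?_⟩
  have h1 : ((Tuple.sort k).symm b < (Tuple.sort k).symm a) ↔ k b < k a := by
    rw [← hs.lt_iff_lt]
    simp
  rw [h1, Prod.Lex.toLex_lt_toLex]
  simp only [leNeg]
  have hab' : (a : ℤ) < b := by exact_mod_cast hab
  refine or_congr Iff.rfl (and_congr_right fun he => ?_)
  rw [he]
  split_ifs with hn
  · simp [hn, hab]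
  · simp [hn, hab.le]

/-- The condition on a weakly increasing word in `F̃_{n,D}`. -/
def FWord (D : Finset ℕ) (i : Fin n → A) : Prop :=
  Monotone i ∧ ∀ a b : Fin n, (b : ℕ) = a + 1 → i a = i b →
    ((¬ neg (i a) → (a : ℕ) + 1 ∉ D) ∧ (neg (i a) → (a : ℕ) + 1 ∈ D))

/-- Letters and inverse descents are counted from 1, elements of `Fin n` from 0: the descent `a + 1`
compares the places of the values `a` and `a + 1`. -/
theorem mem_iDes {τ : Equiv.Perm (Fin n)} {a b : Fin n} (hab : (b : ℕ) = a + 1) :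
    (a : ℕ) + 1 ∈ iDes τ ↔ τ.symm b < τ.symm a := by
  simp only [iDes, Finset.mem_filter, Finset.mem_Icc]
  constructor
  · rintro ⟨_, x, y, hx, hy, hxy⟩
    have h1 : τ x = a := Fin.ext (by omega)
    have h2 : τ y = b := Fin.ext (by omega)
    rw [← h1, ← h2]
    simpa using hxy
  · intro h
    have := b.2
    exact ⟨by omega, τ.symm a, τ.symm b, by simp, by simp [hab], h⟩

theorem iDes_subset (τ : Equiv.Perm (Fin n)) : iDes τ ⊆ Finset.Icc 1 (n - 1) :=
  Finset.filter_subset _ _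

/-- A property holding for consecutive elements of an interval propagates to the interval. -/
theorem Fin.rel_of_consecutive {R : Fin n → Fin n → Prop} (htrans : ∀ x y z, R x y → R y z → R x z)
    {a b : Fin n} (hab : a < b)
    (h : ∀ x y : Fin n, a ≤ x → y ≤ b → (y : ℕ) = x + 1 → R x y) : R a b := by
  obtain ⟨a, ha⟩ := a
  obtain ⟨b, hb⟩ := b
  have hab' : a + 1 ≤ b := hab
  induction b, hab' using Nat.le_induction with
  | base => exact h _ _ le_rfl le_rfl rfl
  | succ m hm ih =>
    have hm' : m < n := by omega
    have hlt : a < m := hm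
    refine htrans _ ⟨m, hm'⟩ _ (ih hm' hlt fun x y hx hy hxy => h x y hx ?_ hxy) ?_
    · exact hy.trans (Nat.le_succ m)
    · exact h _ _ (Fin.mk_le_mk.mpr hlt.le) le_rfl rfl

/-- Reading the letters of f in the order of the values of τ should give a sorted word; the
condition on equal neighbours in F̃_{n,iDes τ} then says exactly that τ breaks ties in the
prescribed direction. -/
theorem fWord_iff_standardizes (f : Fin n → A) (τ : Equiv.Perm (Fin n)) :
    FWord neg (iDes τ) (f ∘ τ.symm) ↔ Standardizes neg f τ := by
  constructor
  · rintro ⟨hm, hc⟩ a b hab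
    -- Between the values τ x and τ y the sorted word is constant. The condition at each consecutive
    -- pair of values there propagates by transitivity: the places increase for a positive letter
    -- and decrease for a negative one.
    have key : ∀ x y, τ x < τ y → f x = f y →
        (¬ neg (f x) → x < y) ∧ (neg (f x) → y < x) := by
      intro x y hxy he
      have hconst : ∀ z, τ x ≤ z → z ≤ τ y → f (τ.symm z) = f x := by
        intro z h1 h2
        have h3 := hm h1
        have h4 := hm h2
        simp only [Function.comp_apply, Equiv.symm_apply_apply] at h3 h4
        exact le_antisymm (h4.trans he.ge) h3
      constructor
      · intro hn
        have := Fin.rel_of_consecutive (R := fun u v => τ.symm u < τ.symm v)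
          (fun _ _ _ => lt_trans) hxy fun u v hu hv huv => by
            have huv' : u ≤ v := Fin.le_def.mpr (by omega)
            have e1 := hconst u hu (huv'.trans hv)
            have e2 := hconst v (hu.trans huv') hv
            have h5 := (hc u v huv (e1.trans e2.symm)).1 (by simpa [e1] using hn)
            rw [mem_iDes huv, not_lt] at h5
            refine lt_of_le_of_ne h5 fun h6 => ?_
            have := τ.symm.injective h6
            subst this
            omega
        simpa using this
      · intro hn
        have := Fin.rel_of_consecutive (R := fun u v => τ.symm v < τ.symm u)
          (fun _ _ _ h h' => lt_trans h' h) hxy fun u v hu hv huv => by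
            have huv' : u ≤ v := Fin.le_def.mpr (by omega)
            have e1 := hconst u hu (huv'.trans hv)
            have e2 := hconst v (hu.trans huv') hv
            have h5 := (hc u v huv (e1.trans e2.symm)).2 (by simpa [e1] using hn)
            rwa [mem_iDes huv] at h5
        simpa using this
    have hne : τ a ≠ τ b := fun he => hab.ne (τ.injective he)
    have hmono : ∀ x y, τ x ≤ τ y → f x ≤ f y := fun x y h => by simpa using hm h
    constructor
    · rintro (h | ⟨h, hn⟩)
      · by_contra h2
        exact absurd (hmono _ _ (not_lt.mp h2)) (not_le.mpr h)
      · by_contra h2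
        exact absurd ((key a b (lt_of_le_of_ne (not_lt.mp h2) hne) h.symm).2 (h ▸ hn)) hab.asymm
    · intro h
      rcases (hmono _ _ h.le).lt_or_eq with h2 | h2
      · exact Or.inl h2
      · refine Or.inr ⟨h2, ?_⟩
        by_contra hn
        exact absurd ((key b a h h2).1 hn) hab.asymm
  · intro h
    have hle : ∀ x y, τ x < τ y → f x ≤ f y := by
      intro x y hxy
      rcases lt_trichotomy x y with hlt | rfl | hlt
      · by_contra h2
        exact absurd ((h x y hlt).mp (Or.inl (not_le.mp h2))) hxy.asymm
      · exact le_rfl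
      · rcases (h y x hlt).mpr hxy with h2 | h2
        · exact h2.le
        · exact h2.1.le
    refine ⟨fun x y hxy => ?_, fun a b hab he => ?_⟩
    · rcases hxy.lt_or_eq with hlt | rfl
      · exact hle _ _ (by simpa using hlt)
      · exact le_rfl
    · have hlt : τ (τ.symm a) < τ (τ.symm b) := by
        simp only [Equiv.apply_symm_apply]
        exact Fin.lt_def.mpr (by omega)
      rw [mem_iDes hab]
      simp only [Function.comp_apply] at he ⊢
      constructor
      · intro hn h2
        rcases (h _ _ h2).mpr hlt with h3 | h3
        · exact h3.ne he
        · exact hn h3.2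
      · intro hn
        by_contra h2
        have h3 : τ.symm a < τ.symm b := lt_of_le_of_ne (not_lt.mp h2) fun h4 => by
          rw [h4] at hlt
          exact lt_irrefl _ hlt
        exact absurd ((h _ _ h3).mp (Or.inr ⟨he.symm, he ▸ hn⟩)) hlt.asymm

/-- `F̃_{n,D}` over an arbitrary alphabet. -/
def genF (n : ℕ) (D : Finset ℕ) : MvPowerSeries A Kqt :=
  monomialSum fun i : Fin n → A => if FWord neg D i then 1 else 0

/-- A sum of monomials over all words, with weights depending only on the standardization, is the
corresponding combination of fundamental quasisymmetric functions. -/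
theorem monomialSum_eq_sum_genF (w : (Fin n → A) → Kqt) (c : Equiv.Perm (Fin n) → Kqt)
    (hw : ∀ f τ, Standardizes neg f τ → w f = c τ) :
    monomialSum w = ∑ τ, c τ • genF neg n (iDes τ) := by
  have h1 : ∀ τ : Equiv.Perm (Fin n), c τ • genF neg n (iDes τ) =
      monomialSum fun f : Fin n → A => if Standardizes neg f τ then w f else 0 := by
    intro τ
    -- Permuting the places by τ does not change contents and turns the words counted by F̃_{n,iDes
    -- τ} into the words that standardize to τ.
    rw [genF, ← monomialSum_smul, monomialSum_equiv τ.symm]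
    congr 1
    funext f
    by_cases h : Standardizes neg f τ
    · rw [if_pos ((fWord_iff_standardizes neg f τ).mpr h), if_pos h, mul_one, hw f τ h]
    · rw [if_neg (fun h' => h ((fWord_iff_standardizes neg f τ).mp h')), if_neg h, mul_zero]
  rw [Finset.sum_congr rfl fun τ _ => h1 τ, ← monomialSum_sum]
  congr 1
  funext f
  obtain ⟨τ, hτ⟩ := exists_standardizes neg f
  rw [Finset.sum_eq_single τ, if_pos hτ]
  · intro τ' _ hne
    exact if_neg fun h => hne (h.unique hτ)
  · simp

theorem fundamentalF_eq_genF (D : Finset ℕ) : fundamentalF n D = genF noNeg n D := by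
  unfold fundamentalF genF
  congr 1
  funext i
  refine if_congr (and_congr_right fun hm => ?_) rfl rfl
  refine forall₃_congr fun a b hab => ?_
  have hle : i a ≤ i b := hm (Fin.le_def.mpr (by omega))
  simp only [noNeg, not_false_eq_true, true_implies, false_implies, and_true]
  constructor
  · intro h he hD
    exact (h hD).ne he
  · intro h hD
    exact lt_of_le_of_ne hle fun he => h he hD

theorem superF_eq_genF [LinearOrder SuperLetter] (D : Finset ℕ) :
    superF n D = genF SuperLetter.IsNeg n D := rfl

end Standardization

/-! ### Linear independence of the fundamental quasisymmetric functions -/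

section Independence

variable {A : Type} [LinearOrder A] {n : ℕ}

theorem exists_iDes_eq {D : Finset ℕ} (hD : D ⊆ Finset.Icc 1 (n - 1)) :
    ∃ τ : Equiv.Perm (Fin n), iDes τ = D := by
  -- This word drops between the places a and a + 1 (counted from 0) exactly when a + 1 ∈ D, so its
  -- standardization has descents at D and the inverse permutation has inverse descents D.
  obtain ⟨σ, hσ⟩ := exists_standardizes (A := ℤ) (fun _ => False)
    fun a : Fin n => -((D.filter (· ≤ (a : ℕ))).card : ℤ)
  refine ⟨σ.symm, Finset.ext fun j => ?_⟩
  by_cases hj : j ∈ Finset.Icc 1 (n - 1)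
  · rw [Finset.mem_Icc] at hj
    obtain ⟨a, rfl⟩ : ∃ a, a + 1 = j := ⟨j - 1, by omega⟩
    have ha : a < n := by omega
    have hb : a + 1 < n := by omega
    have h1 := hσ ⟨a, ha⟩ ⟨a + 1, hb⟩ (by simp)
    rw [mem_iDes (a := ⟨a, ha⟩) (b := ⟨a + 1, hb⟩) rfl]
    simp only [Equiv.symm_symm]
    rw [← h1]
    simp only [leNeg, and_false, or_false, neg_lt_neg_iff, Nat.cast_lt]
    constructor
    · intro h
      by_contra hc
      refine absurd h (not_lt.mpr (Finset.card_le_card fun x hx => ?_))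
      simp only [Finset.mem_filter] at hx ⊢
      refine ⟨hx.1, ?_⟩
      have : x ≠ a + 1 := fun he => hc (he ▸ hx.1)
      omega
    · intro h
      refine Finset.card_lt_card (Finset.ssubset_iff_of_subset ?_ |>.mpr ⟨a + 1, ?_, ?_⟩)
      · intro x hx
        simp only [Finset.mem_filter] at hx ⊢
        exact ⟨hx.1, by omega⟩
      · simpa using h
      · simp
  · exact iff_of_false (fun h => hj (iDes_subset _ h)) fun h => hj (hD h)

theorem Monotone.eq_of_content_eq {f g : Fin n → A} (hf : Monotone f) (hg : Monotone g)
    (h : content f = content g) : f = g := by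
  refine List.ofFn_injective (List.Perm.eq_of_sortedLE hf.sortedLE_ofFn hg.sortedLE_ofFn ?_)
  rw [← Multiset.coe_eq_coe, ← Fin.univ_val_map, ← Fin.univ_val_map]
  ext a
  have := DFunLike.congr_fun h a
  rw [content_apply, content_apply] at this
  rw [Multiset.count_map, Multiset.count_map]
  simpa [Finset.card_def, Finset.filter_val, eq_comm] using this

/-- The weakly increasing word of positive integers with strict increases exactly at `E`. -/
def ladder (n : ℕ) (E : Finset ℕ) : Fin n → ℕ+ :=
  fun a => Nat.succPNat (E.filter (· ≤ (a : ℕ))).card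

theorem ladder_monotone (E : Finset ℕ) : Monotone (ladder n E) := by
  intro a b hab
  refine Nat.succPNat_le_succPNat.mpr (Finset.card_le_card fun x hx => ?_)
  simp only [Finset.mem_filter] at hx ⊢
  exact ⟨hx.1, hx.2.trans hab⟩

theorem fWord_ladder {D E : Finset ℕ} (hD : D ⊆ Finset.Icc 1 (n - 1)) :
    FWord noNeg D (ladder n E) ↔ D ⊆ E := by
  simp only [FWord, ladder_monotone, true_and, noNeg, not_false_eq_true, true_implies,
    false_implies, and_true]
  constructor
  · intro h j hj
    have hj' := Finset.mem_Icc.mp (hD hj)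
    obtain ⟨a, rfl⟩ : ∃ a, a + 1 = j := ⟨j - 1, by omega⟩
    by_contra hE
    refine h ⟨a, by omega⟩ ⟨a + 1, by omega⟩ rfl ?_ hj
    simp only [ladder]
    congr 2
    refine Finset.filter_congr fun x hx => ?_
    have : x ≠ a + 1 := fun he => hE (he ▸ hx)
    omega
  · intro h a b hab he hD
    have h2 := Nat.succPNat_injective he
    refine absurd h2 (Finset.card_lt_card (Finset.ssubset_iff_of_subset ?_ |>.mpr
      ⟨(a : ℕ) + 1, ?_, ?_⟩)).ne
    · intro x hx
      simp only [Finset.mem_filter] at hx ⊢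
      exact ⟨hx.1, by omega⟩
    · simpa [hab] using h hD
    · simp

/-- A weakly increasing word is determined by its content, so only the ladder word itself can
contribute to this coefficient. -/
theorem coeff_genF_ladder {m : ℕ} {D E : Finset ℕ} (hD : D ⊆ Finset.Icc 1 (m - 1)) :
    MvPowerSeries.coeff (content (ladder n E)) (genF noNeg m D) =
      if m = n ∧ D ⊆ E then 1 else 0 := by
  rw [genF, coeff_monomialSum]
  by_cases hm : m = n
  · subst hm
    rw [Finset.sum_eq_single (ladder m E)]
    · simp [fWord_ladder hD]
    · intro f hf hne
      refine if_neg fun h => hne ?_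
      exact Monotone.eq_of_content_eq h.1 (ladder_monotone E) (mem_contentFiber.mp hf)
    · simp
  · rw [if_neg fun h => hm h.1]
    refine Finset.sum_eq_zero fun f hf => absurd ?_ hm
    have h := congrArg Finsupp.degree (mem_contentFiber.mp hf)
    simpa [content, Finsupp.degree_single] using h

/-- The index set of the fundamental basis. -/
abbrev FIndex : Type := {p : ℕ × Finset ℕ // p.2 ⊆ Finset.Icc 1 (p.1 - 1)}

/-- Triangularity: the coefficient at the ladder of D sees only those F_{n,E} with E ⊆ D. Induction
on the size of D removes the proper subsets. -/
theorem linearIndependent_genF :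
    LinearIndependent Kqt fun p : FIndex => genF noNeg p.1.1 p.1.2 := by
  rw [linearIndependent_iff]
  intro l hl
  suffices h : ∀ k (p : FIndex), p.1.2.card = k → l p = 0 from
    Finsupp.ext fun p => h _ p rfl
  intro k
  induction k using Nat.strong_induction_on with
  | _ k ih =>
    rintro ⟨⟨n, D⟩, hD⟩ hk
    have h := congrArg (MvPowerSeries.coeff (content (ladder n D))) hl
    rw [Finsupp.linearCombination_apply, Finsupp.sum, map_sum, map_zero,
      Finset.sum_eq_single ⟨(n, D), hD⟩] at h
    · simpa [coeff_genF_ladder hD] using h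
    · rintro ⟨⟨m, E⟩, hE⟩ _ hne
      simp only [MvPowerSeries.coeff_smul, coeff_genF_ladder hE]
      split_ifs with hc
      · obtain ⟨rfl, hED⟩ := hc
        have hss : E ⊂ D := Finset.ssubset_iff_subset_ne.mpr
          ⟨hED, fun he => hne (by subst he; rfl)⟩
        rw [ih E.card (hk ▸ Finset.card_lt_card hss) ⟨(m, E), hE⟩ rfl, zero_mul]
      · exact mul_zero _
    · intro hn
      rw [Finsupp.notMem_support_iff.mp hn, zero_smul, map_zero]

end Independence

/-! ### Superization through pairs of quasisymmetric functions -/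

section SuperPairs

variable {A : Type} [LinearOrder A] (neg : A → Prop) {n : ℕ}

/-- The standardization expansion read backwards, for the weight that is 1 on the words
standardizing to τ and 0 on the others. -/
theorem genF_iDes (τ : Equiv.Perm (Fin n)) :
    genF neg n (iDes τ) =
      monomialSum fun f : Fin n → A => if Standardizes neg f τ then (1 : Kqt) else 0 := by
  rw [monomialSum_eq_sum_genF neg _ fun τ' => if τ' = τ then 1 else 0]
  · simp
  · intro f τ' h
    refine if_congr ⟨fun h' => h.unique h', fun h' => h' ▸ h⟩ rfl rfl

/-- `τ'` induces the inversions of `τ` on the places in the image of `e`. -/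
def Induces {m : ℕ} (e : Fin n → Fin m) (τ' : Equiv.Perm (Fin m)) (τ : Equiv.Perm (Fin n)) : Prop :=
  ∀ a b, a < b → (τ' (e b) < τ' (e a) ↔ τ b < τ a)

theorem Standardizes.comp_iff {neg : A → Prop} {m : ℕ} {e : Fin n → Fin m} (he : StrictMono e)
    {f : Fin m → A} {τ' : Equiv.Perm (Fin m)} (h : Standardizes neg f τ')
    (τ : Equiv.Perm (Fin n)) : Standardizes neg (f ∘ e) τ ↔ Induces e τ' τ := by
  refine forall₃_congr fun a b hab => ?_
  rw [← h _ _ (he hab)]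
  rfl

/-- The standardization of a concatenated word determines those of its two parts. What matters is
that the coefficients on the right involve neither the alphabet nor its signs. -/
theorem genF_mul_genF {m : ℕ} (σ : Equiv.Perm (Fin n)) (τ : Equiv.Perm (Fin m)) :
    genF neg n (iDes σ) * genF neg m (iDes τ) =
      ∑ ρ : Equiv.Perm (Fin (n + m)),
        (if Induces (Fin.castAdd m) ρ σ ∧ Induces (Fin.natAdd n) ρ τ then (1 : Kqt) else 0) •
          genF neg (n + m) (iDes ρ) := by
  rw [genF_iDes, genF_iDes, monomialSum_mul, monomialSum_equiv finSumFinEquiv]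
  refine monomialSum_eq_sum_genF neg _ _ fun f ρ h => ?_
  have h1 : (f ∘ finSumFinEquiv) ∘ Sum.inl = f ∘ Fin.castAdd m := by
    funext a
    simp
  have h2 : (f ∘ finSumFinEquiv) ∘ Sum.inr = f ∘ Fin.natAdd n := by
    funext a
    simp
  rw [h1, h2, h.comp_iff (Fin.strictMono_castAdd m) σ, h.comp_iff (Fin.strictMono_natAdd n) τ]
  by_cases hc : Induces (Fin.castAdd m) ρ σ <;> simp [hc]

theorem monomialSum_const {A B : Type} [Fintype B] [Nonempty B] (S : Set A) (k : ℕ+)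
    (hk : Fintype.card B = k) :
    monomialSum (fun f : B → A => if ∃ a ∈ S, ∀ b, f b = a then (1 : Kqt) else 0) =
      powerSum S k := by
  ext m
  rw [coeff_monomialSum]
  change _ = if ∃ a ∈ S, m = Finsupp.single a (k : ℕ) then 1 else 0
  have hc : ∀ a : A, content (fun _ : B => a) = Finsupp.single a (k : ℕ) := fun a => by
    simp [content, hk]
  split_ifs with h
  · obtain ⟨a, ha, rfl⟩ := h
    rw [Finset.sum_eq_single fun _ => a]
    · exact if_pos ⟨a, ha, fun _ => rfl⟩
    · intro f hf hne
      refine if_neg ?_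
      rintro ⟨a', _, hf'⟩
      obtain rfl : f = fun _ => a' := funext hf'
      rw [mem_contentFiber, hc] at hf
      have := Finsupp.single_left_injective k.ne_zero hf
      exact hne (by rw [this])
    · intro h
      exact absurd (mem_contentFiber.mpr (hc a)) h
  · refine Finset.sum_eq_zero fun f hf => if_neg ?_
    rintro ⟨a, ha, hf'⟩
    obtain rfl : f = fun _ => a := funext hf'
    exact h ⟨a, ha, by rw [← mem_contentFiber.mp hf, hc]⟩

/-- For a monotone word the signed sum over D factors over the places 1, …, k-1. A strict increase
gives the factor 1 - 1 = 0, a repeated positive letter gives 1, a repeated negative letter gives -1;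
so only constant words survive. -/
theorem sum_sign_fWord {k : ℕ} (hk : 0 < k) (i : Fin k → A) :
    ∑ D ∈ (Finset.Icc 1 (k - 1)).powerset,
        (-1 : Kqt) ^ D.card * (if FWord neg D i then 1 else 0) =
      (if ∃ a ∈ {a | ¬ neg a}, ∀ b, i b = a then (1 : Kqt) else 0) +
        (-1) ^ (k + 1) * (if ∃ a ∈ {a | neg a}, ∀ b, i b = a then 1 else 0) := by
  by_cases hm : Monotone i
  swap
  · have h0 : ¬ ∃ a, ∀ b, i b = a := by
      rintro ⟨a, ha⟩
      exact hm fun x y _ => by rw [ha, ha]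
    rw [Finset.sum_eq_zero fun D _ => by rw [if_neg fun h => hm h.1, mul_zero],
      if_neg fun ⟨a, _, h⟩ => h0 ⟨a, h⟩, if_neg fun ⟨a, _, h⟩ => h0 ⟨a, h⟩]
    ring
  -- P j and N j say that the letters number j and j + 1 are equal and positive, respectively
  -- negative: P forbids j ∈ D and N forces it.
  let P : ℕ → Prop := fun j => ∃ a b : Fin k, (a : ℕ) + 1 = j ∧ (b : ℕ) = j ∧ i a = i b ∧ ¬ neg (i a)
  let N : ℕ → Prop := fun j => ∃ a b : Fin k, (a : ℕ) + 1 = j ∧ (b : ℕ) = j ∧ i a = i b ∧ neg (i a)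
  have hF : ∀ D ∈ (Finset.Icc 1 (k - 1)).powerset,
      (-1 : Kqt) ^ D.card * (if FWord neg D i then 1 else 0) =
        (∏ j ∈ D, -(if ¬ P j then (1 : Kqt) else 0)) *
          ∏ j ∈ Finset.Icc 1 (k - 1) \ D, if ¬ N j then (1 : Kqt) else 0 := by
    intro D hD
    rw [Finset.prod_neg, Finset.prod_boole, Finset.prod_boole, mul_assoc]
    congr 1
    rw [ite_zero_mul_ite_zero, mul_one]
    refine if_congr ?_ rfl rfl
    constructor
    · rintro ⟨_, h⟩
      constructor
      · rintro j hj ⟨a, b, rfl, hb, he, hn⟩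
        exact (h a b hb he).1 hn hj
      · rintro j hj ⟨a, b, rfl, hb, he, hn⟩
        exact (Finset.mem_sdiff.mp hj).2 ((h a b hb he).2 hn)
    · rintro ⟨h1, h2⟩
      refine ⟨hm, fun a b hab he => ⟨fun hn hD' => h1 _ hD' ⟨a, b, rfl, hab, he, hn⟩, fun hn => ?_⟩⟩
      by_contra hc
      refine h2 (a + 1) (Finset.mem_sdiff.mpr ⟨?_, hc⟩) ⟨a, b, rfl, hab, he, hn⟩
      have := b.2
      exact Finset.mem_Icc.mpr (by omega)
  rw [Finset.sum_congr rfl hF, ← Finset.prod_add]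
  by_cases hc : ∀ b, i b = i ⟨0, hk⟩
  · by_cases hn : neg (i ⟨0, hk⟩)
    · have e1 : ∀ j ∈ Finset.Icc 1 (k - 1),
          (-(if ¬ P j then (1 : Kqt) else 0) + if ¬ N j then (1 : Kqt) else 0) = -1 := by
        intro j hj
        rw [Finset.mem_Icc] at hj
        have hP : ¬ P j := by
          rintro ⟨a, b, _, _, _, h⟩
          exact h (by rwa [hc a])
        have hN : N j := ⟨⟨j - 1, by omega⟩, ⟨j, by omega⟩, by simp; omega, rfl,
          by rw [hc, hc ⟨j, _⟩], by rwa [hc]⟩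
        simp [hP, hN]
      rw [Finset.prod_congr rfl e1, Finset.prod_const, Nat.card_Icc, if_neg, if_pos]
      · obtain ⟨m, rfl⟩ : ∃ m, k = m + 1 := ⟨k - 1, by omega⟩
        simp [pow_succ]
      · exact ⟨_, hn, hc⟩
      · rintro ⟨a, ha, h⟩
        exact ha (by rwa [← h ⟨0, hk⟩])
    · have e1 : ∀ j ∈ Finset.Icc 1 (k - 1),
          (-(if ¬ P j then (1 : Kqt) else 0) + if ¬ N j then (1 : Kqt) else 0) = 1 := by
        intro j hj
        rw [Finset.mem_Icc] at hj
        have hN : ¬ N j := by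
          rintro ⟨a, b, _, _, _, h⟩
          exact hn (by rwa [hc a] at h)
        have hP : P j := ⟨⟨j - 1, by omega⟩, ⟨j, by omega⟩, by simp; omega, rfl,
          by rw [hc, hc ⟨j, _⟩], by rwa [hc]⟩
        simp [hP, hN]
      rw [Finset.prod_congr rfl e1, Finset.prod_const_one, if_pos, if_neg]
      · ring
      · rintro ⟨a, ha, h⟩
        exact hn (by rwa [h ⟨0, hk⟩])
      · exact ⟨_, hn, hc⟩
  · have h0 : ¬ ∃ a, ∀ b, i b = a := by
      rintro ⟨a, ha⟩
      exact hc fun b => by rw [ha, ha]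
    rw [if_neg fun ⟨a, _, h⟩ => h0 ⟨a, h⟩, if_neg fun ⟨a, _, h⟩ => h0 ⟨a, h⟩]
    have : ∃ a b : Fin k, (b : ℕ) = a + 1 ∧ i a ≠ i b := by
      by_contra hall
      push Not at hall
      refine hc fun b => ?_
      rcases (Fin.le_def.mpr (Nat.zero_le _) : (⟨0, hk⟩ : Fin k) ≤ b).eq_or_lt with h | h
      · rw [← h]
      · exact (Fin.rel_of_consecutive (R := fun x y => i x = i y) (fun _ _ _ => Eq.trans) h
          fun x y _ _ hxy => hall x y hxy).symm
    obtain ⟨a, b, hab, hne⟩ := this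
    have hb := b.2
    rw [Finset.prod_eq_zero (i := (b : ℕ)) (Finset.mem_Icc.mpr (by omega))]
    · ring
    · have hP : ¬ P b := by
        rintro ⟨a', b', h1, h2, he, _⟩
        rw [show a' = a from Fin.ext (by omega), show b' = b from Fin.ext h2] at he
        exact hne he
      have hN : ¬ N b := by
        rintro ⟨a', b', h1, h2, he, _⟩
        rw [show a' = a from Fin.ext (by omega), show b' = b from Fin.ext h2] at he
        exact hne he
      simp [hP, hN]

/-- This one combination of the F̃_{k,D} is p_k in a positive alphabet and the superization of p_k
in a signed one, which places the generators of the symmetric functions in the span of pairs. -/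
theorem sum_sign_genF (k : ℕ+) :
    ∑ D ∈ (Finset.Icc 1 ((k : ℕ) - 1)).powerset, (-1 : Kqt) ^ D.card • genF neg k D =
      powerSum {a | ¬ neg a} k + (-1 : Kqt) ^ ((k : ℕ) + 1) • powerSum {a | neg a} k := by
  have : Nonempty (Fin k) := ⟨⟨0, k.pos⟩⟩
  simp only [genF, ← monomialSum_smul]
  rw [← monomialSum_sum]
  rw [← monomialSum_const (B := Fin k) _ k (by simp), ← monomialSum_const (B := Fin k) _ k (by simp),
    ← monomialSum_smul]
  ext m
  rw [map_add]
  simp only [coeff_monomialSum]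
  rw [← Finset.sum_add_distrib]
  exact Finset.sum_congr rfl fun i _ => sum_sign_fWord neg k.pos i

/-- The superization homomorphism on polynomials in the power sums. -/
def superHom : MvPolynomial ℕ+ Kqt →ₐ[Kqt] MvPowerSeries SuperLetter Kqt :=
  (ofPowerSums₂.comp omegaY).comp plethXY

theorem superHom_X (k : ℕ+) : superHom (MvPolynomial.X k) =
    powerSum (Set.range SuperLetter.pos) k +
      (-1 : Kqt) ^ ((k : ℕ) + 1) • powerSum (Set.range SuperLetter.bar) k := by
  simp [superHom, plethXY, omegaY, ofPowerSums₂, Algebra.smul_def]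

variable [LinearOrder SuperLetter]

/-- The pair of `F_{n,D}` and `F̃_{n,D}`. -/
def superPair (p : FIndex) : MvPowerSeries ℕ+ Kqt × MvPowerSeries SuperLetter Kqt :=
  (genF noNeg p.1.1 p.1.2, genF SuperLetter.IsNeg p.1.1 p.1.2)

/-- The span of the pairs of `F_{n,D}` and `F̃_{n,D}`. -/
def superSpan : Submodule Kqt (MvPowerSeries ℕ+ Kqt × MvPowerSeries SuperLetter Kqt) :=
  Submodule.span Kqt (Set.range superPair)

theorem genF_pair_mem_superSpan {n : ℕ} {D : Finset ℕ} (hD : D ⊆ Finset.Icc 1 (n - 1)) :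
    (genF noNeg n D, genF SuperLetter.IsNeg n D) ∈ superSpan :=
  Submodule.subset_span ⟨⟨(n, D), hD⟩, rfl⟩

theorem sum_genF_pair_mem_superSpan {ι : Type*} {n : ℕ} (s : Finset ι) (c : ι → Kqt)
    (D : ι → Finset ℕ) (hD : ∀ i ∈ s, D i ⊆ Finset.Icc 1 (n - 1)) :
    (∑ i ∈ s, c i • genF noNeg n (D i), ∑ i ∈ s, c i • genF SuperLetter.IsNeg n (D i)) ∈
      superSpan := by
  have h : (∑ i ∈ s, c i • genF noNeg n (D i), ∑ i ∈ s, c i • genF SuperLetter.IsNeg n (D i)) =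
      ∑ i ∈ s, c i • (genF noNeg n (D i), genF SuperLetter.IsNeg n (D i)) := by
    simp only [Prod.smul_mk, Prod.ext_iff, Prod.fst_sum, Prod.snd_sum, and_self]
  rw [h]
  exact Submodule.sum_mem _ fun i hi =>
    Submodule.smul_mem _ _ (genF_pair_mem_superSpan (hD i hi))

theorem superSpan_mul_mem {x y : MvPowerSeries ℕ+ Kqt × MvPowerSeries SuperLetter Kqt}
    (hx : x ∈ superSpan) (hy : y ∈ superSpan) : x * y ∈ superSpan := by
  induction hx using Submodule.span_induction with
  | zero => simp
  | add a b _ _ ha hb => rw [add_mul]; exact Submodule.add_mem _ ha hb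
  | smul c a _ ha => rw [smul_mul_assoc]; exact Submodule.smul_mem _ _ ha
  | mem x hx =>
    induction hy using Submodule.span_induction with
    | zero => simp
    | add a b _ _ ha hb => rw [mul_add]; exact Submodule.add_mem _ ha hb
    | smul c a _ ha => rw [mul_smul_comm]; exact Submodule.smul_mem _ _ ha
    | mem y hy =>
      obtain ⟨⟨⟨n, D⟩, hD⟩, rfl⟩ := hx
      obtain ⟨⟨⟨m, E⟩, hE⟩, rfl⟩ := hy
      -- Every index set is the inverse descent set of some permutation, so the product rule applies
      -- to arbitrary basis elements.
      obtain ⟨σ, hσ⟩ := exists_iDes_eq hD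
      obtain ⟨τ, hτ⟩ := exists_iDes_eq hE
      dsimp only at σ τ hσ hτ
      subst hσ hτ
      simp only [superPair, Prod.mk_mul_mk, genF_mul_genF]
      exact sum_genF_pair_mem_superSpan _ _ _ fun ρ _ => iDes_subset ρ

theorem one_mem_superSpan : (1 : MvPowerSeries ℕ+ Kqt × MvPowerSeries SuperLetter Kqt) ∈
    superSpan := by
  have h : ∀ {A : Type} [LinearOrder A] (neg : A → Prop), genF neg 0 ∅ = 1 := by
    intro A _ neg
    rw [genF, monomialSum_isEmpty, if_pos, map_one]
    exact ⟨fun a => a.elim0, fun a => a.elim0⟩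
  have h2 := genF_pair_mem_superSpan (n := 0) (D := ∅) (Finset.empty_subset _)
  rwa [h, h] at h2

theorem powerSums_pair_mem_superSpan (P : MvPolynomial ℕ+ Kqt) :
    (ofPowerSums P, superHom P) ∈ superSpan := by
  induction P using MvPolynomial.induction_on with
  | C a =>
    have h := Submodule.smul_mem _ a one_mem_superSpan
    rw [show MvPolynomial.C a = algebraMap Kqt (MvPolynomial ℕ+ Kqt) a from rfl,
      AlgHom.commutes, AlgHom.commutes, Algebra.algebraMap_eq_smul_one,
      Algebra.algebraMap_eq_smul_one]
    exact h
  | add P Q hP hQ =>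
    rw [map_add, map_add]
    exact Submodule.add_mem _ hP hQ
  | mul_X P k hP =>
    rw [map_mul, map_mul]
    refine superSpan_mul_mem hP (y := (_, _)) ?_
    have h := sum_genF_pair_mem_superSpan (n := k) (Finset.Icc 1 ((k : ℕ) - 1)).powerset
      (fun D => (-1) ^ D.card) id fun D hD => Finset.mem_powerset.mp hD
    simp only [id, sum_sign_genF] at h
    rw [superHom_X, ofPowerSums, MvPolynomial.aeval_X]
    convert h using 2
    · have h1 : powerSum {a : ℕ+ | noNeg a} k = 0 := by
        ext m
        change (if ∃ a ∈ {a : ℕ+ | noNeg a}, m = Finsupp.single a (k : ℕ) then (1 : Kqt) else 0) = 0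
        simp [noNeg]
      rw [h1, smul_zero, add_zero]
      congr 1
      ext a
      simp [noNeg]
    · congr 2
      · ext a
        cases a <;> simp [SuperLetter.IsNeg]
      · congr 1
        ext a
        cases a <;> simp [SuperLetter.IsNeg]

/-- Since the first components F_{n,D} are linearly independent, the span of pairs is the graph of a
linear map: the first component determines the second. -/
theorem eq_zero_of_mem_superSpan {g : MvPowerSeries SuperLetter Kqt}
    (h : ((0 : MvPowerSeries ℕ+ Kqt), g) ∈ superSpan) : g = 0 := by
  rw [superSpan, Finsupp.mem_span_range_iff_exists_finsupp] at h
  obtain ⟨c, hc⟩ := h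
  have h1 := congrArg Prod.fst hc
  have h2 := congrArg Prod.snd hc
  rw [Finsupp.sum, Prod.fst_sum] at h1
  have h3 := linearIndependent_iff.mp linearIndependent_genF c (by
    rw [Finsupp.linearCombination_apply]
    exact h1)
  rw [h3] at h2
  simpa using h2.symm

theorem isSuperization_of_mem_superSpan {f : MvPowerSeries ℕ+ Kqt}
    {g : MvPowerSeries SuperLetter Kqt} (hf : ∃ P, ofPowerSums P = f)
    (h : (f, g) ∈ superSpan) : IsSuperization f g := by
  refine ⟨hf, fun P hP => ?_⟩
  have h1 := Submodule.sub_mem _ (powerSums_pair_mem_superSpan P) h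
  rw [Prod.mk_sub_mk, hP, sub_self] at h1
  exact sub_eq_zero.mp (eq_zero_of_mem_superSpan h1)

end SuperPairs

/-! ### Symmetric series are polynomials in power sums -/

section Symmetric

/-- The permutations of the variables leaving a family of coefficients invariant. -/
def invariantPerms {K : Type} (a : (ℕ+ →₀ ℕ) → K) : Subgroup (Equiv.Perm ℕ+) where
  carrier := {s | ∀ m, a (m.mapDomain s) = a m}
  one_mem' m := by simp
  mul_mem' {s s'} hs hs' m := by
    rw [Equiv.Perm.coe_mul, Finsupp.mapDomain_comp, hs, hs']
  inv_mem' {s} hs m := by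
    rw [← hs, ← Finsupp.mapDomain_comp, ← Equiv.Perm.coe_mul, mul_inv_cancel]
    simp

theorem swap_mem_invariantPerms {K : Type} {a : (ℕ+ →₀ ℕ) → K}
    (h : ∀ i, Equiv.swap i (i + 1) ∈ invariantPerms a) (i j : ℕ+) :
    Equiv.swap i j ∈ invariantPerms a := by
  have key : ∀ j i : ℕ+, i < j → Equiv.swap i j ∈ invariantPerms a := by
    intro j
    induction j using PNat.recOn with
    | one => exact fun i hi => absurd hi (not_lt_one)
    | succ j ih =>
      intro i hi
      rcases (PNat.lt_add_one_iff.mp hi).eq_or_lt with rfl | hlt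
      · exact h i
      · rw [Equiv.swap_comm, ← Equiv.swap_mul_swap_mul_swap (x := i) (y := j) (z := j + 1)
          hlt.ne hi.ne]
        exact Subgroup.mul_mem _ (Subgroup.mul_mem _ (h j) (ih i hlt)) (h j)
  rcases lt_trichotomy i j with hij | rfl | hij
  · exact key j i hij
  · rw [Equiv.swap_self]
    exact Subgroup.one_mem _
  · rw [Equiv.swap_comm]
    exact key i j hij

theorem ofSubtype_mem_invariantPerms {K : Type} {a : (ℕ+ →₀ ℕ) → K}
    (h : ∀ i, Equiv.swap i (i + 1) ∈ invariantPerms a) {U : Finset ℕ+} (s : Equiv.Perm U) :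
    Equiv.Perm.ofSubtype s ∈ invariantPerms a := by
  have h1 : Subgroup.closure {σ : Equiv.Perm U | σ.IsSwap} ≤
      (invariantPerms a).comap Equiv.Perm.ofSubtype := by
    rw [Subgroup.closure_le]
    rintro _ ⟨x, y, _, rfl⟩
    rw [SetLike.mem_coe, Subgroup.mem_comap, Equiv.Perm.ofSubtype_swap_eq]
    exact swap_mem_invariantPerms h _ _
  rw [Equiv.Perm.closure_isSwap] at h1
  exact h1 (Subgroup.mem_top s)

variable {B : Type} [Fintype B]

/-- Two words with the same pattern of equal letters differ by a renaming of letters. It can be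
chosen to move only the finitely many letters occurring in them, hence it is a product of
transpositions. -/
theorem exists_perm_comp_eq {K : Type} {a : (ℕ+ →₀ ℕ) → K}
    (h : ∀ i, Equiv.swap i (i + 1) ∈ invariantPerms a) {f g : B → ℕ+}
    (hfg : Setoid.ker f = Setoid.ker g) : ∃ s ∈ invariantPerms a, s ∘ f = g := by
  let U : Finset ℕ+ := Finset.univ.image f ∪ Finset.univ.image g
  have hf : ∀ b, f b ∈ U := fun b =>
    Finset.mem_union_left _ (Finset.mem_image_of_mem _ (Finset.mem_univ b))
  have hg : ∀ b, g b ∈ U := fun b =>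
    Finset.mem_union_right _ (Finset.mem_image_of_mem _ (Finset.mem_univ b))
  have hiff : ∀ x y, f x = f y ↔ g x = g y := fun x y => by
    rw [← Setoid.ker_def, ← Setoid.ker_def, hfg]
  let F : Quotient (Setoid.ker f) → U :=
    Quotient.lift (fun b => ⟨f b, hf b⟩) fun x y hxy => Subtype.ext hxy
  let G : Quotient (Setoid.ker f) → U :=
    Quotient.lift (fun b => ⟨g b, hg b⟩) fun x y hxy => Subtype.ext ((hiff x y).mp hxy)
  have hF : Function.Injective F := by
    rintro ⟨x⟩ ⟨y⟩ hxy
    exact Quotient.sound (congrArg Subtype.val hxy : f x = f y)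
  have hG : Function.Injective G := by
    rintro ⟨x⟩ ⟨y⟩ hxy
    exact Quotient.sound ((hiff x y).mpr (congrArg Subtype.val hxy : g x = g y))
  let e := (Equiv.ofInjective F hF).symm.trans (Equiv.ofInjective G hG)
  refine ⟨Equiv.Perm.ofSubtype (Equiv.extendSubtype e), ofSubtype_mem_invariantPerms h _, ?_⟩
  funext b
  rw [Function.comp_apply, Equiv.Perm.ofSubtype_apply_of_mem _ (hf b)]
  have h1 : (⟨f b, hf b⟩ : U) = F (Quotient.mk _ b) := rfl
  rw [h1, Equiv.extendSubtype_apply_of_mem _ _ ⟨_, rfl⟩]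
  have h2 : (⟨F (Quotient.mk _ b), ⟨_, rfl⟩⟩ : Set.range F) =
    Equiv.ofInjective F hF (Quotient.mk _ b) := rfl
  change ((Equiv.ofInjective G hG ((Equiv.ofInjective F hF).symm ⟨F (Quotient.mk _ b), _⟩) : U)
    : ℕ+) = g b
  rw [h2, Equiv.symm_apply_apply]
  rfl

theorem content_perm_comp (s : Equiv.Perm ℕ+) (f : B → ℕ+) :
    content (s ∘ f) = (content f).mapDomain s := by
  simp [content, Finsupp.mapDomain_finsetSum, Finsupp.mapDomain_single]

theorem card_contentFiber_mapDomain (s : Equiv.Perm ℕ+) (m : ℕ+ →₀ ℕ) :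
    (contentFiber B (m.mapDomain s)).card = (contentFiber B m).card := by
  symm
  refine Finset.card_nbij' (fun f => s ∘ f) (fun f => s.symm ∘ f) ?_ ?_ ?_ ?_
  · intro f hf
    simp only [Finset.mem_coe, mem_contentFiber] at hf ⊢
    rw [content_perm_comp, hf]
  · intro f hf
    simp only [Finset.mem_coe, mem_contentFiber] at hf ⊢
    rw [content_perm_comp, hf, ← Finsupp.mapDomain_comp]
    simp
  · intro f _
    funext b
    simp
  · intro f _
    funext b
    simp

/-- Every function on a finite poset is a sum over lower sets. -/
theorem exists_sum_le_eq {P K : Type} [Fintype P] [PartialOrder P] [AddCommGroup K] (φ : P → K) :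
    ∃ c : P → K, ∀ x, φ x = ∑ y ∈ Finset.univ.filter (· ≤ x), c y := by
  have : WellFoundedLT P := Finite.to_wellFoundedLT
  let c : P → K := (wellFounded_lt (α := P)).fix fun x ih =>
    φ x - ∑ y : {y // y < x}, ih y.1 y.2
  have hc : ∀ x, c x = φ x - ∑ y : {y // y < x}, c y.1 := fun x =>
    (wellFounded_lt (α := P)).fix_eq _ x
  refine ⟨c, fun x => ?_⟩
  have h1 : Finset.univ.filter (· ≤ x) = insert x (Finset.univ.filter (· < x)) := by
    ext y
    simp [le_iff_eq_or_lt]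
  rw [h1, Finset.sum_insert (by simp), hc x,
    ← Finset.sum_subtype (Finset.univ.filter (· < x)) (p := fun y => y < x) (by simp) c,
    sub_add_cancel]

theorem finite_setoid : Finite (Setoid B) :=
  Finite.of_injective (fun ρ : Setoid B => (ρ.r : B → B → Prop)) fun _ _ h =>
    Setoid.ext fun x y => iff_of_eq (congrFun₂ h x y)

/-- A word constant on the blocks of ρ is a free choice of one letter per block, so its generating
function is the product of the p_k over the block sizes k. -/
theorem monomialSum_le_ker (ρ : Setoid B) : ∃ P, ofPowerSums P =
    monomialSum fun f : B → ℕ+ => if ρ ≤ Setoid.ker f then (1 : Kqt) else 0 := by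
  let β : Quotient ρ → Type := fun x => {b : B // Quotient.mk ρ b = x}
  have hne : ∀ x, Nonempty (β x) := fun x => by
    obtain ⟨b, rfl⟩ := Quotient.exists_rep x
    exact ⟨⟨b, rfl⟩⟩
  let k : Quotient ρ → ℕ+ := fun x => ⟨Fintype.card (β x), Fintype.card_pos⟩
  refine ⟨∏ x, MvPolynomial.X (k x), ?_⟩
  rw [map_prod]
  have h1 : ∀ x, ofPowerSums (MvPolynomial.X (k x)) =
      monomialSum (fun f : β x → ℕ+ => if ∃ a ∈ Set.univ, ∀ b, f b = a then (1 : Kqt) else 0) := by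
    intro x
    rw [ofPowerSums, MvPolynomial.aeval_X, monomialSum_const _ (k x) rfl]
  let e : (Σ x : (Finset.univ : Finset (Quotient ρ)), β x) ≃ B :=
    { toFun := fun x => x.2.1
      invFun := fun b => ⟨⟨Quotient.mk ρ b, Finset.mem_univ _⟩, ⟨b, rfl⟩⟩
      left_inv := by
        rintro ⟨⟨x, hx⟩, ⟨b, hb⟩⟩
        change Quotient.mk ρ b = x at hb
        subst hb
        rfl
      right_inv := fun b => rfl }
  rw [Finset.prod_congr rfl fun x _ => h1 x,
    prod_monomialSum (β := β) Finset.univ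
      fun x f => if ∃ a ∈ Set.univ, ∀ b, f b = a then (1 : Kqt) else 0,
    monomialSum_equiv e]
  congr 1
  funext f
  rw [Fintype.prod_boole]
  refine if_congr ?_ rfl rfl
  constructor
  · intro h x y hxy
    obtain ⟨a, _, ha⟩ := h ⟨Quotient.mk ρ x, Finset.mem_univ _⟩
    exact (ha ⟨x, rfl⟩).trans (ha ⟨y, Quotient.sound (ρ.symm hxy)⟩).symm
  · rintro h ⟨x, _⟩
    obtain ⟨b, rfl⟩ := Quotient.exists_rep x
    exact ⟨f b, Set.mem_univ _, fun b' => h (Quotient.exact b'.2)⟩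

/-- A homogeneous formal power series with coefficients invariant under the exchanges of
consecutive variables is a polynomial in the power sums. -/
theorem exists_ofPowerSums_eq (w : (B → ℕ+) → Kqt)
    (h : ∀ (i : ℕ+) m, MvPowerSeries.coeff (Finsupp.mapDomain (Equiv.swap i (i + 1)) m)
      (monomialSum w) = MvPowerSeries.coeff m (monomialSum w)) :
    ∃ P, ofPowerSums P = monomialSum w := by
  let a : (ℕ+ →₀ ℕ) → Kqt := fun m => MvPowerSeries.coeff m (monomialSum w)
  have ha : ∀ i, Equiv.swap i (i + 1) ∈ invariantPerms a := h
  have : Fintype (Setoid B) := @Fintype.ofFinite _ finite_setoid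
  -- The coefficient of a monomial is spread evenly over the words with that content. By symmetry
  -- the share of a word depends only on its pattern of equal letters.
  let φ : Setoid B → Kqt := fun ρ => if hρ : ∃ f : B → ℕ+, Setoid.ker f = ρ then
    a (content hρ.choose) / (contentFiber B (content hρ.choose)).card else 0
  have hφ : ∀ f : B → ℕ+, φ (Setoid.ker f) = a (content f) / (contentFiber B (content f)).card := by
    intro f
    have hρ : ∃ g : B → ℕ+, Setoid.ker g = Setoid.ker f := ⟨f, rfl⟩
    obtain ⟨s, hs, hsf⟩ := exists_perm_comp_eq ha hρ.choose_spec
    have h2 : content f = (content hρ.choose).mapDomain s := by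
      rw [← content_perm_comp, hsf]
    simp only [φ]
    rw [dif_pos hρ, h2, card_contentFiber_mapDomain, hs]
  have hw : monomialSum w = monomialSum fun f : B → ℕ+ => φ (Setoid.ker f) := by
    ext m
    rw [coeff_monomialSum (fun f : B → ℕ+ => φ (Setoid.ker f))]
    have h1 : ∀ f ∈ contentFiber B m, φ (Setoid.ker f) = a m / (contentFiber B m).card := by
      intro f hf
      rw [hφ, mem_contentFiber.mp hf]
    rw [Finset.sum_congr rfl h1, Finset.sum_const, nsmul_eq_mul]
    rcases (contentFiber B m).eq_empty_or_nonempty with he | hne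
    · rw [coeff_monomialSum, he]
      simp
    · have : ((contentFiber B m).card : Kqt) ≠ 0 := by
        exact_mod_cast hne.card_pos.ne'
      rw [mul_div_cancel₀ _ this]
  -- Möbius inversion on the lattice of equivalence relations: conditions `ker f = ρ` are traded for
  -- conditions `ρ ≤ ker f`, which generate products of power sums.
  obtain ⟨c, hc⟩ := exists_sum_le_eq φ
  choose P hP using fun ρ : Setoid B => monomialSum_le_ker ρ
  refine ⟨∑ ρ, c ρ • P ρ, ?_⟩
  rw [hw, map_sum]
  simp only [map_smul, hP, ← monomialSum_smul]
  rw [← monomialSum_sum]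
  congr 1
  funext f
  rw [hc, Finset.sum_filter]
  simp

end Symmetric

/-! ### Symmetry for two-letter words with nested inversion weights -/

section TwoLetters

variable {V K : Type} [LinearOrder V] [Field K]

/-- The product of the weights of the inversions of the two-letter word that has its larger letter
at the places in `T` and its smaller letter at the places in `S \ T`. -/
def twoLetterWeight (c : V → V → K) (S T : Finset V) : K :=
  ∏ u ∈ T, ∏ v ∈ S \ T, if u < v then c u v else 1

/-- A pair of nontrivial weight is such that all pairs formed by one of its members and an element
between them have the weight `x`. -/
def NestedWeights (x : K) (c : V → V → K) (S : Finset V) : Prop :=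
  ∀ u ∈ S, ∀ w ∈ S, u < w → c u w ≠ 1 → ∀ z ∈ S, u < z → z < w → c u z = x ∧ c z w = x

/-- With u in T and w outside, a place z strictly between them contributes one factor x in either
case: c u z if z ∉ T, c z w if z ∈ T. The other places contribute 1 against u and w. The factor
taken out is therefore independent of T. -/
theorem twoLetterWeight_of_extremal {x : K} {c : V → V → K} {S : Finset V}
    {u w : V} (hw : w ∈ S) (huw : u < w)
    (hc : ∀ z ∈ S, u < z → z < w → c u z = x ∧ c z w = x)
    (h1 : ∀ z ∈ S, z < u → c z w = 1) (h2 : ∀ z ∈ S, w < z → c u z = 1)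
    {T : Finset V} (hT : T ⊆ (S.erase u).erase w) :
    twoLetterWeight c S (insert u T) =
      c u w * ((∏ z ∈ (S.erase u).erase w, if u < z ∧ z < w then x else 1) *
        twoLetterWeight c ((S.erase u).erase w) T) := by
  have huT : u ∉ T := fun h => by simpa using hT h
  have hwT : w ∉ T := fun h => by simpa using hT h
  have hS : S \ insert u T = insert w ((S.erase u).erase w \ T) := by
    ext z
    simp only [Finset.mem_sdiff, Finset.mem_insert, Finset.mem_erase]
    constructor
    · rintro ⟨hz, hn⟩
      by_cases hzw : z = w
      · exact Or.inl hzw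
      · exact Or.inr ⟨⟨hzw, fun h => hn (Or.inl h), hz⟩, fun h => hn (Or.inr h)⟩
    · rintro (rfl | ⟨⟨hzw, hzu, hz⟩, hzT⟩)
      · exact ⟨hw, fun h => h.elim huw.ne' hwT⟩
      · exact ⟨hz, fun h => h.elim hzu hzT⟩
  have hwn : w ∉ (S.erase u).erase w \ T := by simp
  rw [twoLetterWeight, hS, Finset.prod_insert huT, Finset.prod_insert hwn, if_pos huw]
  simp only [Finset.prod_insert hwn]
  rw [Finset.prod_mul_distrib, mul_assoc, twoLetterWeight, ← mul_assoc, ← mul_assoc, ← mul_assoc]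
  congr 1
  rw [mul_assoc]
  congr 1
  rw [← Finset.prod_sdiff hT]
  have mem : ∀ {z}, z ∈ (S.erase u).erase w → z ∈ S ∧ z ≠ u ∧ z ≠ w := fun hz => by
    simp only [Finset.mem_erase] at hz
    exact ⟨hz.2.2, hz.2.1, hz.1⟩
  congr 1
  · refine Finset.prod_congr rfl fun z hz => ?_
    obtain ⟨hzS, hzu, hzw⟩ := mem (Finset.mem_sdiff.mp hz).1
    by_cases hlt : u < z
    · by_cases hlt' : z < w
      · rw [if_pos hlt, if_pos ⟨hlt, hlt'⟩, (hc z hzS hlt hlt').1]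
      · rw [if_pos hlt, if_neg (fun h => hlt' h.2),
          h2 z hzS (lt_of_le_of_ne (not_lt.mp hlt') hzw.symm)]
    · rw [if_neg hlt, if_neg fun h => hlt h.1]
  · refine Finset.prod_congr rfl fun z hz => ?_
    obtain ⟨hzS, hzu, hzw⟩ := mem (hT hz)
    by_cases hlt' : z < w
    · by_cases hlt : u < z
      · rw [if_pos hlt', if_pos ⟨hlt, hlt'⟩, (hc z hzS hlt hlt').2]
      · rw [if_pos hlt', if_neg (fun h => hlt h.1),
          h1 z hzS (lt_of_le_of_ne (not_lt.mp hlt) hzu)]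
    · rw [if_neg hlt', if_neg fun h => hlt' h.2]

/-- Subsets of `S` that contain `u` and not `w`. -/
theorem sum_powerset_filter_mem_notMem {M : Type} [AddCommMonoid M] {S : Finset V} {u w : V}
    (hu : u ∈ S) (huw : u ≠ w) (F : Finset V → M) :
    ∑ T ∈ S.powerset.filter (fun T => u ∈ T ∧ w ∉ T), F T =
      ∑ T ∈ ((S.erase u).erase w).powerset, F (insert u T) := by
  symm
  refine Finset.sum_nbij' (fun T => insert u T) (fun T => T.erase u) ?_ ?_ ?_ ?_ ?_
  · intro T hT
    rw [Finset.mem_powerset] at hT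
    simp only [Finset.mem_filter, Finset.mem_powerset, Finset.mem_insert_self, true_and,
      Finset.mem_insert, not_or]
    refine ⟨Finset.insert_subset hu (hT.trans ?_), huw.symm, fun h => by simpa using hT h⟩
    exact (Finset.erase_subset _ _).trans (Finset.erase_subset _ _)
  · intro T hT
    simp only [Finset.mem_filter, Finset.mem_powerset] at hT ⊢
    intro z hz
    simp only [Finset.mem_erase] at hz ⊢
    exact ⟨fun h => hT.2.2 (h ▸ hz.2), hz.1, hT.1 hz.2⟩
  · intro T hT
    rw [Finset.mem_powerset] at hT
    exact Finset.erase_insert fun h => by simpa using hT h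
  · intro T hT
    simp only [Finset.mem_filter] at hT
    exact Finset.insert_erase hT.2.1
  · intro T _
    rfl

/-- Resetting c u w to 1 affects only those T that contain u and not w. The difference is a multiple
of the same kind of sum on S without u and w; the shifts by 1 in φ record these two places. -/
theorem sum_twoLetterWeight_sub {x : K} {c : V → V → K} {S : Finset V}
    (hc : NestedWeights x c S) {u w : V} (hu : u ∈ S) (hw : w ∈ S) (huw : u < w) (hcuw : c u w ≠ 1)
    (h1 : ∀ z ∈ S, z < u → c z w = 1) (h2 : ∀ z ∈ S, w < z → c u z = 1)
    (φ : ℕ → ℕ → K) :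
    ∑ T ∈ S.powerset, φ T.card (S \ T).card * twoLetterWeight c S T =
      (∑ T ∈ S.powerset, φ T.card (S \ T).card *
        twoLetterWeight (fun a b => if a = u ∧ b = w then 1 else c a b) S T) +
      (c u w - 1) * (∏ z ∈ (S.erase u).erase w, if u < z ∧ z < w then x else 1) *
        ∑ T ∈ ((S.erase u).erase w).powerset,
          φ (T.card + 1) (((S.erase u).erase w \ T).card + 1) *
            twoLetterWeight c ((S.erase u).erase w) T := by
  set c' : V → V → K := fun a b => if a = u ∧ b = w then 1 else c a b with hc'def
  have hsame : ∀ T ∈ S.powerset, ¬ (u ∈ T ∧ w ∉ T) →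
      twoLetterWeight c S T = twoLetterWeight c' S T := by
    intro T _ hT
    refine Finset.prod_congr rfl fun a ha => Finset.prod_congr rfl fun b hb => ?_
    have : ¬ (a = u ∧ b = w) := by
      rintro ⟨rfl, rfl⟩
      exact hT ⟨ha, (Finset.mem_sdiff.mp hb).2⟩
    simp only [hc'def, if_neg this]
  rw [← Finset.sum_filter_add_sum_filter_not S.powerset (fun T => u ∈ T ∧ w ∉ T),
    ← Finset.sum_filter_add_sum_filter_not S.powerset (fun T => u ∈ T ∧ w ∉ T)
      (fun T => φ T.card (S \ T).card * twoLetterWeight c' S T),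
    Finset.sum_congr rfl (s₁ := S.powerset.filter fun T => ¬ (u ∈ T ∧ w ∉ T))
      (g := fun T => φ T.card (S \ T).card * twoLetterWeight c' S T)
      fun T hT => by
        rw [Finset.mem_filter] at hT
        rw [hsame T hT.1 hT.2],
    add_right_comm]
  congr 1
  rw [sum_powerset_filter_mem_notMem hu huw.ne, sum_powerset_filter_mem_notMem hu huw.ne,
    Finset.mul_sum, ← Finset.sum_add_distrib]
  refine Finset.sum_congr rfl fun T hT => ?_
  rw [Finset.mem_powerset] at hT
  have huT : u ∉ T := fun h => by simpa using hT h
  have hcard : (S \ insert u T).card = ((S.erase u).erase w \ T).card + 1 := by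
    have hTS : insert u T ⊆ S := Finset.insert_subset hu
      (hT.trans ((Finset.erase_subset _ _).trans (Finset.erase_subset _ _)))
    have hlt := Finset.card_le_card hT
    have hwu : w ∈ S.erase u := Finset.mem_erase.mpr ⟨huw.ne', hw⟩
    have hp1 := Finset.card_pos.mpr ⟨w, hwu⟩
    have hp2 := Finset.card_pos.mpr ⟨u, hu⟩
    rw [Finset.card_sdiff_of_subset hTS, Finset.card_insert_of_notMem huT,
      Finset.card_sdiff_of_subset hT]
    rw [Finset.card_erase_of_mem hwu, Finset.card_erase_of_mem hu] at *
    omega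
  have hw' : twoLetterWeight c' S (insert u T) =
      (∏ z ∈ (S.erase u).erase w, if u < z ∧ z < w then x else 1) *
        twoLetterWeight c ((S.erase u).erase w) T := by
    rw [twoLetterWeight_of_extremal (c := c') (x := x) hw huw ?_ ?_ ?_ hT]
    · have e1 : twoLetterWeight c' ((S.erase u).erase w) T =
          twoLetterWeight c ((S.erase u).erase w) T := by
        refine Finset.prod_congr rfl fun a ha => Finset.prod_congr rfl fun b _ => ?_
        have : ¬ (a = u ∧ b = w) := fun h => huT (h.1 ▸ ha)
        simp only [hc'def, if_neg this]
      have e2 : c' u w = 1 := if_pos ⟨rfl, rfl⟩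
      rw [e1, e2, one_mul]
    · intro z hz hlt hlt'
      have := hc u hu w hw huw hcuw z hz hlt hlt'
      simpa only [hc'def, hlt'.ne, hlt.ne', and_false, false_and, if_false] using this
    · intro z hz hlt
      simpa only [hc'def, hlt.ne, false_and, if_false] using h1 z hz hlt
    · intro z hz hlt
      simpa only [hc'def, hlt.ne', and_false, if_false] using h2 z hz hlt
  rw [twoLetterWeight_of_extremal hw huw (hc u hu w hw huw hcuw) h1 h2 hT, hw',
    Finset.card_insert_of_notMem huT, hcard]
  ring

/-- The symmetry of the generating function of two-letter words. -/
theorem sum_twoLetterWeight_symm {x : K} (n : ℕ) : ∀ (c : V → V → K) (S : Finset V),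
    NestedWeights x c S →
    ((S ×ˢ S).filter fun p => p.1 < p.2 ∧ c p.1 p.2 ≠ 1).card = n →
    ∀ φ : ℕ → ℕ → K,
      ∑ T ∈ S.powerset, φ T.card (S \ T).card * twoLetterWeight c S T =
        ∑ T ∈ S.powerset, φ (S \ T).card T.card * twoLetterWeight c S T := by
  induction n using Nat.strong_induction_on with
  | _ n ih =>
    intro c S hc hn φ
    rcases ((S ×ˢ S).filter fun p => p.1 < p.2 ∧ c p.1 p.2 ≠ 1).eq_empty_or_nonempty with he | hne
    · have h1 : ∀ T ∈ S.powerset, twoLetterWeight c S T = 1 := by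
        intro T hT
        refine Finset.prod_eq_one fun u hu => Finset.prod_eq_one fun v hv => ?_
        split_ifs with huv
        · by_contra hcuv
          have : (u, v) ∈ (S ×ˢ S).filter fun p => p.1 < p.2 ∧ c p.1 p.2 ≠ 1 := by
            simp only [Finset.mem_filter, Finset.mem_product]
            exact ⟨⟨Finset.mem_powerset.mp hT hu, (Finset.mem_sdiff.mp hv).1⟩, huv, hcuv⟩
          rw [he] at this
          simp at this
        · rfl
      refine Finset.sum_nbij' (fun T => S \ T) (fun T => S \ T) ?_ ?_ ?_ ?_ ?_
      · intro T _
        exact Finset.mem_powerset.mpr Finset.sdiff_subset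
      · intro T _
        exact Finset.mem_powerset.mpr Finset.sdiff_subset
      · intro T hT
        exact Finset.sdiff_sdiff_eq_self (Finset.mem_powerset.mp hT)
      · intro T hT
        exact Finset.sdiff_sdiff_eq_self (Finset.mem_powerset.mp hT)
      · intro T hT
        rw [Finset.sdiff_sdiff_eq_self (Finset.mem_powerset.mp hT), h1 T hT,
          h1 _ (Finset.mem_powerset.mpr Finset.sdiff_subset)]
    · obtain ⟨u, w, hu, hw, huw, hcuw, h1, h2⟩ : ∃ u w, u ∈ S ∧ w ∈ S ∧ u < w ∧ c u w ≠ 1 ∧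
          (∀ z ∈ S, ∀ y ∈ S, z < u → z < y → c z y = 1) ∧
          (∀ z ∈ S, w < z → c u z = 1) := by
        obtain ⟨p, hp, hpmin⟩ := Finset.exists_min_image _ Prod.fst hne
        have hne2 : (S.filter fun y => p.1 < y ∧ c p.1 y ≠ 1).Nonempty := by
          simp only [Finset.mem_filter, Finset.mem_product] at hp
          exact ⟨p.2, Finset.mem_filter.mpr ⟨hp.1.2, hp.2⟩⟩
        obtain ⟨w, hw, hwmax⟩ := Finset.exists_max_image _ id hne2
        simp only [Finset.mem_filter, Finset.mem_product, id, and_imp, Prod.forall] at hp hpmin hw hwmax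
        refine ⟨p.1, w, hp.1.1, hw.1, hw.2.1, hw.2.2, ?_, ?_⟩
        · intro z hz y hy hzu hzy
          by_contra hcz
          exact absurd (hpmin z y hz hy hzy hcz) (not_le.mpr hzu)
        · intro z hz hwz
          by_contra hcz
          exact absurd (hwmax z hz (hw.2.1.trans hwz) hcz) (not_le.mpr hwz)
      have h1' : ∀ z ∈ S, z < u → c z w = 1 := fun z hz h => h1 z hz w hw h (h.trans huw)
      rw [sum_twoLetterWeight_sub hc hu hw huw hcuw h1' h2,
        sum_twoLetterWeight_sub hc hu hw huw hcuw h1' h2 fun a b => φ b a]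
      have hmem : (u, w) ∈ (S ×ˢ S).filter fun p => p.1 < p.2 ∧ c p.1 p.2 ≠ 1 := by
        simp only [Finset.mem_filter, Finset.mem_product]
        exact ⟨⟨hu, hw⟩, huw, hcuw⟩
      congr 1
      · refine ih _ ?_ _ S ?_ rfl φ
        · rw [← hn]
          refine Finset.card_lt_card (Finset.ssubset_iff_of_subset ?_ |>.mpr ⟨(u, w), hmem, ?_⟩)
          · rintro ⟨a, b⟩ hab
            simp only [Finset.mem_filter] at hab ⊢
            refine ⟨hab.1, hab.2.1, fun h => hab.2.2 ?_⟩
            split_ifs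
            · rfl
            · exact h
          · simp
        -- Nestedness survives the reset of c u w: by extremality, (u, w) is not one of the pairs
        -- (a, z), (z, b) inside another nontrivial pair (a, b).
        · intro a ha b hb hab hcab z hz haz hzb
          have hne : ¬ (a = u ∧ b = w) := fun h => hcab (if_pos h)
          simp only [if_neg hne] at hcab
          have hau : a = u → b < w ∨ b = w := by
            rintro rfl
            by_contra h
            push Not at h
            exact hcab (h2 b hb (lt_of_le_of_ne h.1 h.2.symm))
          have hau' : ¬ a < u := fun h => hcab (h1 a ha b hb h hab)
          have e1 : ¬ (a = u ∧ z = w) := by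
            rintro ⟨rfl, rfl⟩
            rcases hau rfl with h | h
            · exact hzb.asymm h
            · exact hzb.ne' h
          have e2 : ¬ (z = u ∧ b = w) := by
            rintro ⟨rfl, rfl⟩
            exact hau' haz
          simp only [if_neg e1, if_neg e2]
          exact hc a ha b hb hab hcab z hz haz hzb
      · congr 1
        have hsub : (S.erase u).erase w ⊆ S :=
          (Finset.erase_subset _ _).trans (Finset.erase_subset _ _)
        refine ih _ ?_ c ((S.erase u).erase w) ?_ rfl fun a b => φ (a + 1) (b + 1)
        · rw [← hn]
          refine Finset.card_lt_card (Finset.ssubset_iff_of_subset ?_ |>.mpr ⟨(u, w), hmem, ?_⟩)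
          · exact Finset.filter_subset_filter _ (Finset.product_subset_product hsub hsub)
          · simp
        · exact fun a ha b hb hab hcab z hz =>
            hc a (hsub ha) b (hsub hb) hab hcab z (hsub hz)

end TwoLetters

/-! ### From two-letter words to arbitrary words -/

section Words

variable {n : ℕ}

/-- The product of the weights of the inversions of a word. -/
def inversionWeight (c : Fin n → Fin n → Kqt) (f : Fin n → ℕ+) : Kqt :=
  ∏ u, ∏ v, if u < v ∧ f v < f u then c u v else 1

/-- Replacing the letter `i + 1` by `i`. -/
def collapse (i : ℕ+) (x : ℕ+) : ℕ+ := if x = i + 1 then i else x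

theorem collapse_eq_iff {i x : ℕ+} : collapse i x = i ↔ x = i ∨ x = i + 1 := by
  unfold collapse
  split_ifs with h
  · simp [h]
  · simp [h]

theorem collapse_lt_iff {i x y : ℕ+} (h : ¬ (collapse i x = i ∧ collapse i y = i)) :
    collapse i x < collapse i y ↔ x < y := by
  rw [collapse_eq_iff, collapse_eq_iff] at h
  unfold collapse
  simp only [← PNat.coe_lt_coe, ← PNat.coe_inj, PNat.add_coe, PNat.one_coe] at *
  rw [apply_ite PNat.val, apply_ite PNat.val]
  split_ifs <;> omega

/-- An inversion either involves a letter other than i and i + 1, and then survives the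
identification of these two, or it has an i + 1 to the left of an i. -/
theorem inversionWeight_eq (c : Fin n → Fin n → Kqt) (i : ℕ+) (f : Fin n → ℕ+) :
    inversionWeight c f = inversionWeight c (collapse i ∘ f) *
      twoLetterWeight c (Finset.univ.filter fun u => collapse i (f u) = i)
        (Finset.univ.filter fun u => f u = i + 1) := by
  have h : twoLetterWeight c (Finset.univ.filter fun u => collapse i (f u) = i)
        (Finset.univ.filter fun u => f u = i + 1) =
      ∏ u, ∏ v, if f u = i + 1 ∧ f v = i ∧ u < v then c u v else 1 := by
    rw [twoLetterWeight, Finset.prod_filter]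
    refine Finset.prod_congr rfl fun u _ => ?_
    split_ifs with hu
    · have : (Finset.univ.filter fun u => collapse i (f u) = i) \
          (Finset.univ.filter fun u => f u = i + 1) = Finset.univ.filter fun v => f v = i := by
        ext v
        simp only [Finset.mem_sdiff, Finset.mem_filter, Finset.mem_univ, true_and, collapse_eq_iff]
        have hne : i ≠ i + 1 := (PNat.lt_add_right i 1).ne
        constructor
        · rintro ⟨h1, h2⟩
          exact h1.resolve_right h2
        · intro h1
          simp [h1, hne]
      rw [this, Finset.prod_filter]
      refine Finset.prod_congr rfl fun v _ => ?_
      by_cases hv : f v = i <;> simp [hu, hv]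
    · simp [hu]
  rw [h, inversionWeight, inversionWeight, ← Finset.prod_mul_distrib]
  refine Finset.prod_congr rfl fun u _ => ?_
  rw [← Finset.prod_mul_distrib]
  refine Finset.prod_congr rfl fun v _ => ?_
  by_cases huv : u < v
  swap
  · simp [huv]
  simp only [huv, true_and, and_true, Function.comp_apply]
  by_cases hS : collapse i (f v) = i ∧ collapse i (f u) = i
  · have h1 : ¬ collapse i (f v) < collapse i (f u) := by simp [hS.1, hS.2]
    rw [if_neg h1, one_mul]
    refine if_congr ?_ rfl rfl
    have hlt : i < i + 1 := PNat.lt_add_right i 1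
    rcases collapse_eq_iff.mp hS.1 with h2 | h2 <;> rcases collapse_eq_iff.mp hS.2 with h3 | h3 <;>
      simp [h2, h3, hlt.ne, hlt.ne', hlt.asymm, hlt]
  · have h2 : ¬ (f u = i + 1 ∧ f v = i) := by
      rintro ⟨h3, h4⟩
      refine hS ⟨?_, ?_⟩
      · simp [collapse, h4]
      · simp [collapse, h3]
    rw [if_neg h2, mul_one]
    exact if_congr (collapse_lt_iff hS).symm rfl rfl

theorem mapDomain_apply_eq_sum (φ : ℕ+ → ℕ+) (m : ℕ+ →₀ ℕ) (a : ℕ+) :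
    m.mapDomain φ a = ∑ x ∈ m.support.filter fun x => φ x = a, m x := by
  rw [Finsupp.mapDomain, Finsupp.sum_apply, Finsupp.sum, Finset.sum_filter]
  exact Finset.sum_congr rfl fun x _ => by rw [Finsupp.single_apply]

theorem content_comp (φ : ℕ+ → ℕ+) (f : Fin n → ℕ+) :
    content (φ ∘ f) = (content f).mapDomain φ := by
  simp [content, Finsupp.mapDomain_finsetSum, Finsupp.mapDomain_single]

/-- The coefficients of the generating function of words, grouped according to the collapsed
word. -/
theorem sum_contentFiber_inversionWeight (c : Fin n → Fin n → Kqt) (i : ℕ+) (m : ℕ+ →₀ ℕ) :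
    ∑ f ∈ contentFiber (Fin n) m, inversionWeight c f =
      ∑ g ∈ contentFiber (Fin n) (m.mapDomain (collapse i)), inversionWeight c g *
        ∑ T ∈ (Finset.univ.filter fun u => g u = i).powerset,
          (if T.card = m (i + 1) ∧ ((Finset.univ.filter fun u => g u = i) \ T).card = m i
            then (1 : Kqt) else 0) *
          twoLetterWeight c (Finset.univ.filter fun u => g u = i) T := by
  have hne : i ≠ i + 1 := (PNat.lt_add_right i 1).ne
  rw [← Finset.sum_fiberwise_of_maps_to (t := contentFiber (Fin n) (m.mapDomain (collapse i)))
    (g := fun f => collapse i ∘ f)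
    (fun f hf => by rw [mem_contentFiber, content_comp, mem_contentFiber.mp hf])]
  refine Finset.sum_congr rfl fun g hg => ?_
  rw [Finset.mul_sum]
  set S := Finset.univ.filter fun u => g u = i with hS
  simp only [ite_mul, one_mul, zero_mul, mul_ite, mul_zero]
  rw [← Finset.sum_filter]
  have hg' : ∀ u, g u ≠ i + 1 := by
    intro u hu
    have h1 := mem_support_content g u
    rw [mem_contentFiber.mp hg] at h1
    obtain ⟨x, _, hx⟩ := Finset.mem_image.mp (Finsupp.mapDomain_support h1)
    rw [hu] at hx
    unfold collapse at hx
    split_ifs at hx with hx'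
    · exact hne hx
    · exact hx' hx
  let fill : Finset (Fin n) → Fin n → ℕ+ := fun T u => if u ∈ T then i + 1 else g u
  have hfill : ∀ T ⊆ S, collapse i ∘ fill T = g := by
    intro T hT
    funext u
    simp only [Function.comp_apply, fill, collapse]
    split_ifs with h1 h2 h2
    · exact ((Finset.mem_filter.mp (hT h1)).2).symm
    · exact absurd rfl h2
    · exact absurd h2 (hg' u)
    · rfl
  refine Finset.sum_nbij' (fun f => Finset.univ.filter fun u => f u = i + 1) fill ?_ ?_ ?_ ?_ ?_
  · intro f hf
    obtain ⟨hf1, rfl⟩ := Finset.mem_filter.mp hf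
    rw [mem_contentFiber] at hf1
    rw [Finset.mem_filter, Finset.mem_powerset]
    refine ⟨fun u hu => ?_, ?_, ?_⟩
    · simp only [hS, Finset.mem_filter, Finset.mem_univ, true_and] at hu ⊢
      simp [collapse, hu]
    · rw [← hf1, content_apply]
    · rw [← hf1, content_apply]
      congr 1
      ext u
      simp only [hS, Finset.mem_sdiff, Finset.mem_filter, Finset.mem_univ, true_and,
        Function.comp_apply, collapse_eq_iff]
      constructor
      · rintro ⟨h1, h2⟩
        exact h1.resolve_right h2
      · intro h1
        simp [h1, hne]
  · intro T hT
    rw [Finset.mem_filter, Finset.mem_powerset] at hT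
    obtain ⟨hTS, h1, h2⟩ := hT
    rw [Finset.mem_filter, mem_contentFiber]
    refine ⟨?_, hfill T hTS⟩
    ext a
    rw [content_apply]
    by_cases ha1 : a = i + 1
    · rw [ha1, ← h1]
      congr 1
      ext u
      simp only [fill, Finset.mem_filter, Finset.mem_univ, true_and]
      split_ifs with hu
      · simp [hu]
      · simp [hu, hg' u]
    · by_cases ha2 : a = i
      · rw [ha2, ← h2]
        congr 1
        ext u
        simp only [fill, hS, Finset.mem_filter, Finset.mem_univ, true_and, Finset.mem_sdiff]
        split_ifs with hu
        · simp [hu, hne.symm]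
        · simp [hu]
      · have h3 : (Finset.univ.filter fun u => fill T u = a) =
            Finset.univ.filter fun u => g u = a := by
          refine Finset.filter_congr fun u _ => ?_
          simp only [fill]
          split_ifs with hu
          · have := (Finset.mem_filter.mp (hTS hu)).2
            rw [this]
            exact iff_of_false (fun h => ha1 h.symm) fun h => ha2 h.symm
          · rfl
        rw [h3, ← content_apply, mem_contentFiber.mp hg, mapDomain_apply_eq_sum,
          Finset.sum_eq_single a]
        · intro x hx hxa
          refine absurd (Finset.mem_filter.mp hx).2 ?_
          unfold collapse
          split_ifs
          · exact fun h => ha2 h.symm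
          · exact hxa
        · intro h
          have : collapse i a = a := if_neg ha1
          rw [Finset.mem_filter, not_and_or] at h
          rcases h with h | h
          · exact Finsupp.notMem_support_iff.mp h
          · exact absurd this h
  · intro f hf
    obtain ⟨_, rfl⟩ := Finset.mem_filter.mp hf
    funext u
    simp only [fill, Finset.mem_filter, Finset.mem_univ, true_and, Function.comp_apply]
    split_ifs with hu
    · exact hu.symm
    · exact if_neg hu
  · intro T hT
    ext u
    simp only [fill, Finset.mem_filter, Finset.mem_univ, true_and]
    split_ifs with hu
    · simp [hu]
    · simp [hu, hg' u]
  · intro f hf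
    obtain ⟨_, rfl⟩ := Finset.mem_filter.mp hf
    rw [inversionWeight_eq c i f]
    rfl

/-- Symmetry of the generating function of words with nested inversion weights. -/
theorem exists_ofPowerSums_eq_inversionWeight {x : Kqt} {c : Fin n → Fin n → Kqt}
    (hc : NestedWeights x c Finset.univ) :
    ∃ P, ofPowerSums P = monomialSum (inversionWeight c) := by
  refine exists_ofPowerSums_eq _ fun i m => ?_
  have hne : i ≠ i + 1 := (PNat.lt_add_right i 1).ne
  rw [coeff_monomialSum, coeff_monomialSum, sum_contentFiber_inversionWeight c i,
    sum_contentFiber_inversionWeight c i m, ← Finsupp.mapDomain_comp]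
  -- The two contents to be compared collapse to the same one, so the sums run over the same
  -- collapsed words g, and only the placements of i and i + 1 inside each g differ.
  have h1 : collapse i ∘ Equiv.swap i (i + 1) = collapse i := by
    funext y
    simp only [Function.comp_apply, collapse]
    by_cases h1 : y = i
    · subst h1
      simp
    · by_cases h2 : y = i + 1
      · subst h2
        simp
      · rw [Equiv.swap_apply_of_ne_of_ne h1 h2]
  rw [h1]
  refine Finset.sum_congr rfl fun g _ => ?_
  congr 1
  have h2 : (m.mapDomain (Equiv.swap i (i + 1))) (i + 1) = m i := by
    have := Finsupp.mapDomain_apply (Equiv.swap i (i + 1)).injective m i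
    rwa [Equiv.swap_apply_left] at this
  have h3 : (m.mapDomain (Equiv.swap i (i + 1))) i = m (i + 1) := by
    have := Finsupp.mapDomain_apply (Equiv.swap i (i + 1)).injective m (i + 1)
    rwa [Equiv.swap_apply_right] at this
  rw [h2, h3]
  refine (sum_twoLetterWeight_symm _ c _ (fun u _ w _ huw h z _ =>
    hc u (Finset.mem_univ _) w (Finset.mem_univ _) huw h z (Finset.mem_univ _)) rfl
      fun a b => if a = m i ∧ b = m (i + 1) then 1 else 0).trans ?_
  refine Finset.sum_congr rfl fun T _ => ?_
  congr 1
  exact if_congr and_comm rfl rfl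

end Words

theorem q_ne_zero : q ≠ 0 := by
  rw [q, Ne, FaithfulSMul.algebraMap_eq_zero_iff]
  exact MvPolynomial.X_ne_zero 0

/-! ### The reading order -/

section Reading

variable {μ : YoungDiagram}

theorem cell_ext {u v : μ.cells} (h1 : u.1.1 = v.1.1) (h2 : u.1.2 = v.1.2) : u = v :=
  Subtype.ext (Prod.ext h1 h2)

theorem precedes_trichotomy (u v : μ.cells) : Precedes u v ∨ u = v ∨ Precedes v u := by
  unfold Precedes
  by_cases h1 : u.1.1 = v.1.1
  · by_cases h2 : u.1.2 = v.1.2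
    · exact Or.inr (Or.inl (cell_ext h1 h2))
    · omega
  · omega

theorem readingIndex_lt_of_precedes {u v : μ.cells} (h : Precedes u v) :
    readingIndex u < readingIndex v := by
  refine Finset.card_lt_card (Finset.ssubset_iff_of_subset (fun w hw => ?_) |>.mpr ⟨u, ?_, ?_⟩)
  · simp only [Finset.mem_filter, Finset.mem_univ, true_and] at hw ⊢
    unfold Precedes at *
    omega
  · simpa using h
  · simp only [Finset.mem_filter, Finset.mem_univ, true_and]
    unfold Precedes
    omega

theorem readingIndex_lt_iff {u v : μ.cells} :
    readingIndex u < readingIndex v ↔ Precedes u v := by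
  refine ⟨fun h => ?_, readingIndex_lt_of_precedes⟩
  rcases precedes_trichotomy u v with h' | rfl | h'
  · exact h'
  · exact absurd h (lt_irrefl _)
  · exact absurd h (readingIndex_lt_of_precedes h').asymm

theorem readingIndex_bijective : Function.Bijective (readingIndex (μ := μ)) := by
  rw [Fintype.bijective_iff_injective_and_card]
  refine ⟨fun u v h => ?_, by simp⟩
  rcases precedes_trichotomy u v with h' | h' | h'
  · exact absurd h (readingIndex_lt_of_precedes h').ne
  · exact h'
  · exact absurd h (readingIndex_lt_of_precedes h').ne'

/-- The boxes of `μ` in reading order. -/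
def readingEquiv (μ : YoungDiagram) : μ.cells ≃ Fin μ.card :=
  Equiv.ofBijective readingIndex readingIndex_bijective

theorem readingEquiv_lt_iff {u v : μ.cells} :
    readingEquiv μ u < readingEquiv μ v ↔ Precedes u v := readingIndex_lt_iff

theorem symm_lt_iff {a b : Fin μ.card} :
    Precedes ((readingEquiv μ).symm a) ((readingEquiv μ).symm b) ↔ a < b := by
  rw [← readingEquiv_lt_iff, Equiv.apply_symm_apply, Equiv.apply_symm_apply]

end Reading

/-! ### Inversion pairs and the symmetry of Macdonald polynomials -/

section Inversions

variable {μ : YoungDiagram}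

@[simp] theorem leNeg_noNeg {x y : ℕ+} : leNeg noNeg x y ↔ x < y := by simp [leNeg, noNeg]

@[simp] theorem lePos_noNeg {x y : ℕ+} : lePos noNeg x y ↔ x ≤ y := by
  simp [lePos, noNeg, le_iff_lt_or_eq]

theorem DirectlyAbove.unique {u w w' : μ.cells} (h : DirectlyAbove u w) (h' : DirectlyAbove u w') :
    w = w' := by
  obtain ⟨h1, h2⟩ := h
  obtain ⟨h3, h4⟩ := h'
  exact cell_ext (by omega) (by omega)

theorem exists_directlyAbove {u : μ.cells} (h : u.1.1 ≠ 0) : ∃ w, DirectlyAbove u w := by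
  have hm : (u.1.1 - 1, u.1.2) ∈ μ := μ.up_left_mem (Nat.sub_le _ _) le_rfl u.2
  exact ⟨⟨_, hm⟩, by simp only; omega, rfl⟩

/-- The pairs of boxes in one row, the first one to the left of the second one. -/
def rowPairs (μ : YoungDiagram) : Finset (μ.cells × μ.cells) :=
  Finset.univ.filter fun p => p.1.1.1 = p.2.1.1 ∧ p.1.1.2 < p.2.1.2

theorem mem_rowPairs {p : μ.cells × μ.cells} :
    p ∈ rowPairs μ ↔ p.1.1.1 = p.2.1.1 ∧ p.1.1.2 < p.2.1.2 := by
  simp [rowPairs]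

theorem arm_eq_card (u : μ.cells) :
    arm u = ((rowPairs μ).filter fun p => p.1 = u).card := by
  have h : arm u = (Finset.Ico (u.1.2 + 1) (μ.rowLen u.1.1)).card := by
    rw [Nat.card_Ico]
    rfl
  rw [h]
  symm
  refine Finset.card_bij (fun p _ => p.2.1.2) ?_ ?_ ?_
  · rintro ⟨a, v⟩ hp
    rw [Finset.mem_filter, mem_rowPairs] at hp
    obtain ⟨⟨h1, h2⟩, rfl⟩ := hp
    have := YoungDiagram.mem_iff_lt_rowLen.mp ((YoungDiagram.mem_cells _).mp v.2)
    dsimp only at h1 h2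
    rw [Finset.mem_Ico, h1]
    exact ⟨h2, this⟩
  · rintro ⟨a, v⟩ hp ⟨a', v'⟩ hp' he
    rw [Finset.mem_filter, mem_rowPairs] at hp hp'
    obtain ⟨⟨h1, h2⟩, rfl⟩ := hp
    obtain ⟨⟨h1', h2'⟩, rfl⟩ := hp'
    dsimp only at h1 h1' he
    rw [cell_ext (h1.symm.trans h1') he]
  · intro j hj
    rw [Finset.mem_Ico] at hj
    refine ⟨(u, ⟨(u.1.1, j), YoungDiagram.mem_iff_lt_rowLen.mpr hj.2⟩), ?_, rfl⟩
    rw [Finset.mem_filter, mem_rowPairs]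
    exact ⟨⟨rfl, hj.1⟩, rfl⟩

theorem mem_Des {A : Type} [LinearOrder A] {neg : A → Prop} {f : Filling μ A} {u : μ.cells} :
    u ∈ Des neg f ↔ ∃ w, DirectlyAbove u w ∧ leNeg neg (f w) (f u) := by
  simp [Des]

theorem sum_arm_eq_card (D : Finset μ.cells) :
    ∑ u ∈ D, arm u = ((rowPairs μ).filter fun p => p.1 ∈ D).card := by
  rw [Finset.card_eq_sum_card_fiberwise (f := Prod.fst) (t := D)
    (s := (rowPairs μ).filter fun p => p.1 ∈ D)
    fun p hp => (Finset.mem_filter.mp hp).2]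
  refine Finset.sum_congr rfl fun u hu => ?_
  rw [arm_eq_card, Finset.filter_filter]
  congr 1
  refine Finset.filter_congr fun p _ => ?_
  exact ⟨fun h => ⟨h ▸ hu, h⟩, fun h => h.2⟩

/-- In an inversion between consecutive rows the upper box v lies to the right of the lower box w.
The box u above w belongs to the diagram, being to the left of v in its row, so the inversion can be
recorded by the row pair (u, v). Both kinds of inversions are thus indexed by row pairs. -/
theorem card_Inv_eq (f : Filling μ ℕ+) :
    (Inv noNeg f).card = ((rowPairs μ).filter fun p => f p.2 < f p.1).card +
      ((rowPairs μ).filter fun p => ∃ w, DirectlyAbove p.1 w ∧ f w < f p.2).card := by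
  rw [← Finset.card_filter_add_card_filter_not (s := Inv noNeg f)
    (fun p => p.1.1.1 = p.2.1.1)]
  congr 1
  · congr 1
    ext p
    simp only [Inv, Finset.mem_filter, Finset.mem_univ, true_and, mem_rowPairs, leNeg_noNeg,
      Attack, Precedes]
    constructor
    · rintro ⟨⟨_, h2, h3⟩, h4⟩
      exact ⟨⟨h4, by omega⟩, h3⟩
    · rintro ⟨⟨h1, h2⟩, h3⟩
      refine ⟨⟨Or.inl ⟨fun h => ?_, h1⟩, Or.inr ⟨h1, h2⟩, h3⟩, h1⟩
      rw [h] at h2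
      exact lt_irrefl _ h2
  · symm
    have hb : ∀ p : μ.cells × μ.cells, (p.1.1.1 - 1, p.1.1.2) ∈ μ.cells := fun p =>
      (YoungDiagram.mem_cells _).mpr (μ.up_left_mem (Nat.sub_le _ _) le_rfl p.1.2)
    refine Finset.card_bij (fun p _ => (p.2, ⟨_, hb p⟩)) ?_ ?_ ?_
    · intro p hp
      rw [Finset.mem_filter, mem_rowPairs] at hp
      obtain ⟨⟨h1, h2⟩, w, h3, h4⟩ := hp
      have hw : w = ⟨_, hb p⟩ := cell_ext (by have := h3.1; simp only; omega) h3.2.symm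
      rw [← hw]
      have h5 := h3.1
      have h6 := h3.2
      simp only [Inv, Finset.mem_filter, Finset.mem_univ, true_and, leNeg_noNeg, Attack, Precedes]
      exact ⟨⟨Or.inr (Or.inl ⟨by omega, by omega⟩), Or.inl (by omega), h4⟩, by omega⟩
    · intro p hp p' hp' he
      rw [Finset.mem_filter, mem_rowPairs] at hp hp'
      obtain ⟨⟨h1, h2⟩, w, h3, h4⟩ := hp
      obtain ⟨⟨h1', h2'⟩, w', h3', h4'⟩ := hp'
      have e1 : p.2 = p'.2 := congrArg Prod.fst he
      have e2 : (p.1.1.1 - 1, p.1.1.2) = (p'.1.1.1 - 1, p'.1.1.2) :=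
        congrArg Subtype.val (congrArg Prod.snd he)
      refine Prod.ext (cell_ext ?_ (Prod.mk.inj e2).2) e1
      rw [h1, h1', e1]
    · rintro ⟨v, w⟩ hp
      simp only [Inv, Finset.mem_filter, Finset.mem_univ, true_and, leNeg_noNeg, Attack,
        Precedes] at hp
      obtain ⟨⟨h1, h2, h3⟩, h4⟩ := hp
      have h5 : v.1.1 = w.1.1 + 1 := by omega
      have h6 : w.1.2 < v.1.2 := by omega
      have hm : (v.1.1, w.1.2) ∈ μ := μ.up_left_mem le_rfl h6.le v.2
      refine ⟨(⟨_, hm⟩, v), ?_, ?_⟩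
      · rw [Finset.mem_filter, mem_rowPairs]
        exact ⟨⟨rfl, h6⟩, w, ⟨h5, rfl⟩, h3⟩
      · refine Prod.ext rfl (cell_ext ?_ rfl)
        simp only
        omega

/-- The number of inversions is the number of inversion pairs plus the arms of the descents. -/
theorem card_Inv (f : Filling μ ℕ+) :
    (Inv noNeg f).card = (InvP noNeg f).card + ∑ u ∈ Des noNeg f, arm u := by
  have hP : InvP noNeg f = (rowPairs μ).filter fun p =>
      (p.1.1.1 = 0 ∧ leNeg noNeg (f p.2) (f p.1)) ∨
        ∃ w, DirectlyAbove p.1 w ∧ Counterclockwise noNeg f p.1 p.2 w := by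
    ext p
    simp only [InvP, Finset.mem_filter, Finset.mem_univ, true_and, mem_rowPairs, and_assoc]
  rw [card_Inv_eq, sum_arm_eq_card, hP]
  simp only [Finset.card_filter, ← Finset.sum_add_distrib]
  refine Finset.sum_congr rfl fun p _ => ?_
  by_cases h0 : p.1.1.1 = 0
  · have hno : ∀ w, ¬ DirectlyAbove p.1 w := fun w hw => by
      have := hw.1
      omega
    have hD : p.1 ∉ Des noNeg f := fun h => by
      obtain ⟨w, hw, _⟩ := mem_Des.mp h
      exact hno w hw
    simp [h0, hno, hD]
  -- For each row pair (u, v), with w below u, the count is [f v < f u] + [f w < f v] =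
  -- [counterclockwise] + [f w < f u]; the last term, summed over v, gives the arm of a descent u.
  · obtain ⟨w, hw⟩ := exists_directlyAbove h0
    have hex : ∀ Q : μ.cells → Prop, (∃ w', DirectlyAbove p.1 w' ∧ Q w') ↔ Q w := fun Q =>
      ⟨fun ⟨w', h, h'⟩ => hw.unique h ▸ h', fun h => ⟨w, hw, h⟩⟩
    simp only [mem_Des, hex, h0, false_and, false_or, Counterclockwise, leNeg_noNeg, lePos_noNeg]
    simp only [← PNat.coe_lt_coe, ← PNat.coe_le_coe]
    split_ifs <;> omega

theorem inv_eq_card_InvP (f : Filling μ ℕ+) : inv noNeg f = (InvP noNeg f).card := by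
  rw [inv, card_Inv, Nat.add_sub_cancel]

/-- The weight of an inversion in the generating function `H̃_μ`. -/
def boxWeight (u v : μ.cells) : Kqt :=
  (if Attack u v then q else 1) * if DirectlyAbove u v then t ^ (leg u + 1) * (q ^ arm u)⁻¹ else 1

/-- A descent is an inversion of the reading word between vertically adjacent boxes, so its factor
t^{leg+1} q^{-arm} can be attached to that pair; attacking pairs carry q. -/
theorem prod_boxWeight (f : Filling μ ℕ+) :
    ∏ u, ∏ v, (if Precedes u v ∧ f v < f u then boxWeight u v else 1) =
      q ^ inv noNeg f * t ^ maj noNeg f := by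
  have h1 : ∀ u v : μ.cells, (if Precedes u v ∧ f v < f u then boxWeight u v else 1) =
      (if (u, v) ∈ Inv noNeg f then q else 1) *
        if DirectlyAbove u v ∧ f v < f u then t ^ (leg u + 1) * (q ^ arm u)⁻¹ else 1 := by
    intro u v
    have hd : DirectlyAbove u v → Precedes u v := fun h => Or.inl (by have := h.1; omega)
    have hI : (u, v) ∈ Inv noNeg f ↔ Attack u v ∧ Precedes u v ∧ f v < f u := by simp [Inv]
    simp only [hI, boxWeight]
    by_cases hp : Precedes u v
    · by_cases hf : f v < f u
      · simp [hp, hf]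
      · simp [hf]
    · simp [hp, mt hd hp]
  have h2 : ∀ u : μ.cells, (∏ v, if DirectlyAbove u v ∧ f v < f u then
      t ^ (leg u + 1) * (q ^ arm u)⁻¹ else 1) =
      if u ∈ Des noNeg f then t ^ (leg u + 1) * (q ^ arm u)⁻¹ else 1 := by
    intro u
    split_ifs with hu
    · obtain ⟨w, hw, hlt⟩ := mem_Des.mp hu
      rw [Finset.prod_eq_single w, if_pos ⟨hw, leNeg_noNeg.mp hlt⟩]
      · intro v _ hv
        exact if_neg fun h => hv (h.1.unique hw)
      · simp
    · refine Finset.prod_eq_one fun v _ => if_neg fun h => hu (mem_Des.mpr ⟨v, h.1, ?_⟩)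
      exact leNeg_noNeg.mpr h.2
  simp only [h1, Finset.prod_mul_distrib, h2]
  rw [← Fintype.prod_prod_type' fun u v => if (u, v) ∈ Inv noNeg f then q else 1]
  simp only [Prod.mk.eta, Finset.prod_ite_mem, Finset.univ_inter, Finset.prod_const,
    Finset.prod_mul_distrib, Finset.prod_inv_distrib, Finset.prod_pow_eq_pow_sum]
  rw [card_Inv, inv_eq_card_InvP, pow_add, maj]
  have := pow_ne_zero (∑ u ∈ Des noNeg f, arm u) q_ne_zero
  field_simp

theorem macdonaldH_eq (μ : YoungDiagram) :
    macdonaldH μ = monomialSum (inversionWeight fun a b =>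
      boxWeight ((readingEquiv μ).symm a) ((readingEquiv μ).symm b)) := by
  rw [macdonaldH, monomialSum_equiv (readingEquiv μ)]
  congr 1
  funext f
  rw [← prod_boxWeight, inversionWeight, ← (readingEquiv μ).prod_comp]
  refine Finset.prod_congr rfl fun u _ => ?_
  rw [← (readingEquiv μ).prod_comp]
  refine Finset.prod_congr rfl fun v _ => ?_
  simp only [Function.comp_apply, Equiv.symm_apply_apply, readingEquiv_lt_iff]

/-- Macdonald polynomials are symmetric. -/
theorem exists_ofPowerSums_eq_macdonaldH (μ : YoungDiagram) :
    ∃ P, ofPowerSums P = macdonaldH μ := by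
  rw [macdonaldH_eq]
  refine exists_ofPowerSums_eq_inversionWeight (x := q) ?_
  intro a _ b _ _ hc z _ haz hzb
  rw [← symm_lt_iff] at haz hzb
  change boxWeight _ _ ≠ 1 at hc
  change boxWeight _ _ = q ∧ boxWeight _ _ = q
  generalize (readingEquiv μ).symm a = u at *
  generalize (readingEquiv μ).symm b = w at *
  generalize (readingEquiv μ).symm z = v at *
  have hne : ∀ {x y : μ.cells}, x.1.2 ≠ y.1.2 → x ≠ y := fun h h' => h (by rw [h'])
  have key : Attack u w ∨ DirectlyAbove u w := by
    by_contra h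
    push Not at h
    exact hc (by simp [boxWeight, h.1, h.2])
  have h1 : Attack u v ∧ ¬ DirectlyAbove u v ∧ Attack v w ∧ ¬ DirectlyAbove v w := by
    unfold Attack DirectlyAbove Precedes at *
    have e1 : u.1.1 = v.1.1 → u ≠ v := fun h => hne (by omega)
    have e2 : v.1.1 = w.1.1 → v ≠ w := fun h => hne (by omega)
    refine ⟨?_, by omega, ?_, by omega⟩
    · by_cases h : u.1.1 = v.1.1
      · exact Or.inl ⟨e1 h, h⟩
      · right; omega
    · by_cases h : v.1.1 = w.1.1
      · exact Or.inl ⟨e2 h, h⟩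
      · right; omega
  simp [boxWeight, h1]

end Inversions

set_option linter.unusedSectionVars false

/-! ### Recursions for cumulants of set functions -/

section Cumulants

variable {α R : Type} [DecidableEq α] [CommRing R]

/-- `P` is a set partition of `s`. -/
def IsSetPartition (s : Finset α) (P : Finset (Finset α)) : Prop :=
  (∀ B ∈ P, B.Nonempty ∧ B ⊆ s) ∧ ∀ a ∈ s, ∃! B, B ∈ P ∧ a ∈ B

theorem Finpartition.isSetPartition {s : Finset α} (π : Finpartition s) :
    IsSetPartition s π.parts :=
  ⟨fun _ hB => ⟨π.nonempty_of_mem_parts hB, π.le hB⟩, fun _ ha => π.existsUnique_mem ha⟩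

/-- The set partitions of `s`. -/
def setPartitions (s : Finset α) : Finset (Finset (Finset α)) :=
  s.powerset.powerset.filter (IsSetPartition s)

theorem mem_setPartitions {s : Finset α} {P : Finset (Finset α)} :
    P ∈ setPartitions s ↔ IsSetPartition s P := by
  rw [setPartitions, Finset.mem_filter, and_iff_right_iff_imp]
  intro h
  exact Finset.mem_powerset.mpr fun B hB => Finset.mem_powerset.mpr (h.1 B hB).2

/-- Set partitions as plain sets of blocks allow a block to be removed or inserted without changing
types. -/
theorem sum_finpartition {M : Type} [AddCommMonoid M] (s : Finset α)
    (G : Finset (Finset α) → M) :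
    ∑ π : Finpartition s, G π.parts = ∑ P ∈ setPartitions s, G P := by
  refine Finset.sum_bij (fun π _ => π.parts) ?_ ?_ ?_ ?_
  · exact fun π _ => mem_setPartitions.mpr (Finpartition.isSetPartition π)
  · exact fun π _ π' _ h => Finpartition.ext h
  · intro P hP
    rw [mem_setPartitions] at hP
    exact ⟨Finpartition.ofExistsUnique P (fun B hB => (hP.1 B hB).2) hP.2
      (fun h => by simpa using (hP.1 ∅ h).1), Finset.mem_univ _, rfl⟩
  · exact fun _ _ => rfl

theorem IsSetPartition.erase {s : Finset α} {P : Finset (Finset α)} (h : IsSetPartition s P)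
    {B : Finset α} (hB : B ∈ P) : IsSetPartition (s \ B) (P.erase B) := by
  constructor
  · intro C hC
    rw [Finset.mem_erase] at hC
    refine ⟨(h.1 C hC.2).1, fun a ha => Finset.mem_sdiff.mpr ⟨(h.1 C hC.2).2 ha, fun haB => ?_⟩⟩
    exact hC.1 ((h.2 a ((h.1 C hC.2).2 ha)).unique ⟨hC.2, ha⟩ ⟨hB, haB⟩)
  · intro a ha
    rw [Finset.mem_sdiff] at ha
    obtain ⟨C, hC, huniq⟩ := h.2 a ha.1
    refine ⟨C, ⟨Finset.mem_erase.mpr ⟨fun he => ha.2 (he ▸ hC.2), hC.1⟩, hC.2⟩, fun D hD => ?_⟩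
    exact huniq D ⟨(Finset.mem_erase.mp hD.1).2, hD.2⟩

theorem IsSetPartition.notMem {s : Finset α} {B : Finset α} {P : Finset (Finset α)}
    (h : IsSetPartition (s \ B) P) (hB : B.Nonempty) : B ∉ P := by
  intro hBP
  obtain ⟨a, ha⟩ := hB
  exact (Finset.mem_sdiff.mp ((h.1 B hBP).2 ha)).2 ha

theorem IsSetPartition.insert {s : Finset α} {B : Finset α} {P : Finset (Finset α)}
    (h : IsSetPartition (s \ B) P) (hB : B.Nonempty) (hBs : B ⊆ s) :
    IsSetPartition s (insert B P) := by
  constructor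
  · intro C hC
    rcases Finset.mem_insert.mp hC with rfl | hC
    · exact ⟨hB, hBs⟩
    · exact ⟨(h.1 C hC).1, (h.1 C hC).2.trans Finset.sdiff_subset⟩
  · intro a ha
    by_cases haB : a ∈ B
    · refine ⟨B, ⟨Finset.mem_insert_self _ _, haB⟩, fun D hD => ?_⟩
      rcases Finset.mem_insert.mp hD.1 with rfl | hD'
      · rfl
      · exact absurd haB (Finset.mem_sdiff.mp ((h.1 D hD').2 hD.2)).2
    · obtain ⟨C, hC, huniq⟩ := h.2 a (Finset.mem_sdiff.mpr ⟨ha, haB⟩)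
      refine ⟨C, ⟨Finset.mem_insert_of_mem hC.1, hC.2⟩, fun D hD => ?_⟩
      rcases Finset.mem_insert.mp hD.1 with rfl | hD'
      · exact absurd hD.2 haB
      · exact huniq D ⟨hD', hD.2⟩

/-- Removing a block from a set partition. -/
theorem sum_setPartitions_erase (s : Finset α) (F : Finset α → Finset (Finset α) → R) :
    ∑ P ∈ setPartitions s, ∑ B ∈ P, F B (P.erase B) =
      ∑ B ∈ s.powerset.filter Finset.Nonempty, ∑ P ∈ setPartitions (s \ B), F B P := by
  rw [Finset.sum_sigma', Finset.sum_sigma']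
  refine Finset.sum_nbij' (fun x => ⟨x.2, x.1.erase x.2⟩) (fun x => ⟨insert x.1 x.2, x.1⟩)
    ?_ ?_ ?_ ?_ ?_
  · rintro ⟨P, B⟩ h
    simp only [Finset.mem_sigma, mem_setPartitions, Finset.mem_filter, Finset.mem_powerset] at h ⊢
    exact ⟨⟨(h.1.1 B h.2).2, (h.1.1 B h.2).1⟩, h.1.erase h.2⟩
  · rintro ⟨B, P⟩ h
    simp only [Finset.mem_sigma, mem_setPartitions, Finset.mem_filter, Finset.mem_powerset] at h ⊢
    exact ⟨h.2.insert h.1.2 h.1.1, Finset.mem_insert_self _ _⟩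
  · rintro ⟨P, B⟩ h
    simp only [Finset.mem_sigma] at h
    simp [Finset.insert_erase h.2]
  · rintro ⟨B, P⟩ h
    simp only [Finset.mem_sigma, mem_setPartitions, Finset.mem_filter] at h
    simp [Finset.erase_insert (h.2.notMem h.1.2)]
  · rintro ⟨P, B⟩ _
    rfl

/-- The cumulant of a set function on a finite set. -/
def cumulantOn (u : Finset α → R) (s : Finset α) : R :=
  ∑ P ∈ setPartitions s, (-1 : R) ^ (P.card - 1) * ((P.card - 1).factorial : R) * ∏ B ∈ P, u B

/-- The inverse of a set function under subset convolution. -/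
def convInverse (u : Finset α → R) (s : Finset α) : R :=
  ∑ P ∈ setPartitions s, (-1 : R) ^ P.card * (P.card.factorial : R) * ∏ B ∈ P, u B

theorem setPartitions_empty : setPartitions (∅ : Finset α) = {∅} := by
  ext P
  rw [mem_setPartitions, Finset.mem_singleton]
  constructor
  · intro h
    refine Finset.eq_empty_of_forall_notMem fun B hB => ?_
    obtain ⟨⟨a, ha⟩, h2⟩ := h.1 B hB
    simpa using h2 ha
  · rintro rfl
    exact ⟨by simp, by simp⟩

theorem convInverse_empty (u : Finset α → R) : convInverse u ∅ = 1 := by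
  simp [convInverse, setPartitions_empty]

/-- Since (-1)^k k! = -k · (-1)^{k-1} (k-1)!, the term of a partition with k blocks is shared among
the k choices of a distinguished block B; what remains is a partition of s \ B. -/
theorem sum_mul_convInverse {u : Finset α → R} (h0 : u ∅ = 1) {s : Finset α} (hs : s.Nonempty) :
    ∑ B ∈ s.powerset, u B * convInverse u (s \ B) = 0 := by
  have h1 : convInverse u s =
      -∑ B ∈ s.powerset.filter Finset.Nonempty, u B * convInverse u (s \ B) := by
    simp only [convInverse, Finset.mul_sum]
    rw [← sum_setPartitions_erase s fun B P =>
      u B * ((-1 : R) ^ P.card * (P.card.factorial : R) * ∏ B ∈ P, u B), ← Finset.sum_neg_distrib]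
    refine Finset.sum_congr rfl fun P hP => ?_
    have hne : P.Nonempty := by
      obtain ⟨a, ha⟩ := hs
      obtain ⟨B, hB, _⟩ := (mem_setPartitions.mp hP).2 a ha
      exact ⟨B, hB.1⟩
    obtain ⟨k, hk⟩ : ∃ k, P.card = k + 1 := ⟨P.card - 1, by have := hne.card_pos; omega⟩
    have h2 : ∀ B ∈ P, u B * ((-1 : R) ^ (P.erase B).card * ((P.erase B).card.factorial : R) *
        ∏ C ∈ P.erase B, u C) = (-1) ^ k * (k.factorial : R) * ∏ C ∈ P, u C := by
      intro B hB
      rw [Finset.card_erase_of_mem hB, hk, Nat.add_sub_cancel, ← Finset.mul_prod_erase P u hB]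
      ring
    rw [Finset.sum_congr rfl h2, Finset.sum_const, hk, Nat.factorial_succ, nsmul_eq_mul]
    push_cast
    ring
  rw [← Finset.sum_filter_add_sum_filter_not _ Finset.Nonempty]
  have h3 : s.powerset.filter (fun B => ¬ B.Nonempty) = {∅} := by
    ext B
    simp only [Finset.mem_filter, Finset.mem_powerset, Finset.not_nonempty_iff_eq_empty,
      Finset.mem_singleton, and_iff_right_iff_imp]
    rintro rfl
    simp
  rw [h3, Finset.sum_singleton, h0, Finset.sdiff_empty, one_mul, h1]
  ring

/-- Removing the block of x leaves one block fewer, and (-1)^{k-1} (k-1)! is then the coefficient of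
the remaining partition in `convInverse`. -/
theorem cumulantOn_eq (u : Finset α → R) {s : Finset α} {x : α} (hx : x ∈ s) :
    cumulantOn u s = ∑ B ∈ s.powerset.filter (x ∈ ·), u B * convInverse u (s \ B) := by
  have h1 : s.powerset.filter (x ∈ ·) = (s.powerset.filter Finset.Nonempty).filter (x ∈ ·) := by
    rw [Finset.filter_filter]
    exact Finset.filter_congr fun B _ => ⟨fun h => ⟨⟨x, h⟩, h⟩, fun h => h.2⟩
  rw [h1, Finset.sum_filter]
  have h2 : ∀ B ∈ s.powerset.filter Finset.Nonempty,
      (if x ∈ B then u B * convInverse u (s \ B) else 0) =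
      ∑ P ∈ setPartitions (s \ B), if x ∈ B then
        u B * ((-1 : R) ^ P.card * (P.card.factorial : R) * ∏ B ∈ P, u B) else 0 := by
    intro B _
    split_ifs
    · rw [convInverse, Finset.mul_sum]
    · simp
  rw [Finset.sum_congr rfl h2, ← sum_setPartitions_erase s fun B P => if x ∈ B then
        u B * ((-1 : R) ^ P.card * (P.card.factorial : R) * ∏ B ∈ P, u B) else 0, cumulantOn]
  refine Finset.sum_congr rfl fun P hP => ?_
  obtain ⟨B, ⟨hB, hxB⟩, huniq⟩ := (mem_setPartitions.mp hP).2 x hx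
  rw [Finset.sum_eq_single B, if_pos hxB, Finset.card_erase_of_mem hB,
    ← Finset.mul_prod_erase P u hB]
  · ring
  · intro C hC hne
    exact if_neg fun h => hne (huniq C ⟨hC, h⟩)
  · exact fun h => absurd hB h

/-- Exchanging two nested sums over subsets. -/
theorem sum_powerset_nested {M : Type} [AddCommMonoid M] (s : Finset α)
    (G : Finset α → Finset α → Finset α → M) :
    ∑ C ∈ s.powerset, ∑ B ∈ C.powerset, G B (C \ B) (s \ C) =
      ∑ B ∈ s.powerset, ∑ D ∈ (s \ B).powerset, G B D ((s \ B) \ D) := by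
  rw [Finset.sum_sigma', Finset.sum_sigma']
  have hd : ∀ {B D : Finset α}, D ⊆ s \ B → (B ∪ D) \ B = D := by
    intro B D h
    rw [Finset.union_sdiff_left, Finset.sdiff_eq_self_iff_disjoint]
    exact Finset.disjoint_left.mpr fun a ha hb => (Finset.mem_sdiff.mp (h ha)).2 hb
  refine Finset.sum_nbij' (fun x => ⟨x.2, x.1 \ x.2⟩) (fun x => ⟨x.1 ∪ x.2, x.1⟩) ?_ ?_ ?_ ?_ ?_
  · rintro ⟨C, B⟩ h
    simp only [Finset.mem_sigma, Finset.mem_powerset] at h ⊢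
    exact ⟨h.2.trans h.1, Finset.sdiff_subset_sdiff h.1 subset_rfl⟩
  · rintro ⟨B, D⟩ h
    simp only [Finset.mem_sigma, Finset.mem_powerset] at h ⊢
    exact ⟨Finset.union_subset h.1 (h.2.trans Finset.sdiff_subset), Finset.subset_union_left⟩
  · rintro ⟨C, B⟩ h
    simp only [Finset.mem_sigma, Finset.mem_powerset] at h
    simp [Finset.union_sdiff_of_subset h.2]
  · rintro ⟨B, D⟩ h
    simp only [Finset.mem_sigma, Finset.mem_powerset] at h
    simp only [hd h.2]
  · rintro ⟨C, B⟩ h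
    simp only [Finset.mem_sigma, Finset.mem_powerset] at h
    have : (s \ B) \ (C \ B) = s \ C := by
      rw [sdiff_sdiff, Finset.sup_eq_union, Finset.union_sdiff_of_subset h.2]
    simp only [this]

theorem sum_powerset_compl {M : Type} [AddCommMonoid M] (s : Finset α)
    (G : Finset α → Finset α → M) :
    ∑ B ∈ s.powerset, G B (s \ B) = ∑ B ∈ s.powerset, G (s \ B) B := by
  refine Finset.sum_nbij' (fun B => s \ B) (fun B => s \ B) ?_ ?_ ?_ ?_ ?_
  · exact fun B _ => Finset.mem_powerset.mpr Finset.sdiff_subset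
  · exact fun B _ => Finset.mem_powerset.mpr Finset.sdiff_subset
  · exact fun B hB => Finset.sdiff_sdiff_eq_self (Finset.mem_powerset.mp hB)
  · exact fun B hB => Finset.sdiff_sdiff_eq_self (Finset.mem_powerset.mp hB)
  · intro B hB
    rw [Finset.sdiff_sdiff_eq_self (Finset.mem_powerset.mp hB)]

/-- The recursion expressing a set function through its cumulants. -/
theorem sum_cumulantOn_mul {u : Finset α → R} (h0 : u ∅ = 1) {s : Finset α} {x : α} (hx : x ∈ s) :
    ∑ C ∈ s.powerset.filter (x ∈ ·), cumulantOn u C * u (s \ C) = u s := by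
  have h1 : ∀ C ∈ s.powerset, (if x ∈ C then cumulantOn u C * u (s \ C) else 0) =
      ∑ B ∈ C.powerset, if x ∈ B then u B * convInverse u (C \ B) * u (s \ C) else 0 := by
    intro C _
    split_ifs with hC
    · rw [cumulantOn_eq u hC, Finset.sum_mul, Finset.sum_filter]
    · refine (Finset.sum_eq_zero fun B hB => if_neg fun h => hC ?_).symm
      exact Finset.mem_powerset.mp hB h
  -- The cumulant is u, restricted to sets containing x, convolved with the inverse of u. A further
  -- convolution with u cancels the inverse, and only B = s remains.
  rw [Finset.sum_filter, Finset.sum_congr rfl h1,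
    sum_powerset_nested s fun B D E => if x ∈ B then u B * convInverse u D * u E else 0,
    Finset.sum_eq_single s]
  · simp [hx, h0, convInverse_empty]
  · intro B hB hne
    split_ifs
    · have hne' : (s \ B).Nonempty := by
        rw [Finset.nonempty_iff_ne_empty, Ne, Finset.sdiff_eq_empty_iff_subset]
        exact fun h => hne (subset_antisymm (Finset.mem_powerset.mp hB) h)
      have h2 := sum_mul_convInverse h0 hne'
      rw [sum_powerset_compl (s \ B) fun C D => u C * convInverse u D] at h2
      have h3 : ∑ D ∈ (s \ B).powerset, u B * convInverse u D * u ((s \ B) \ D) =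
          u B * ∑ D ∈ (s \ B).powerset, u ((s \ B) \ D) * convInverse u D := by
        rw [Finset.mul_sum]
        exact Finset.sum_congr rfl fun D _ => by ring
      rw [h3, h2, mul_zero]
    · simp
  · simp

/-- A recursion for cumulants of set functions that are multiplicative with respect to one
point. -/
theorem cumulantOn_recursion {u a : Finset α → R} (h0 : u ∅ = 1) {p x : α} (hpx : p ≠ x)
    (hu : ∀ B, p ∉ B → u (insert p B) = a B * u B)
    (ha : ∀ B C, Disjoint B C → a (B ∪ C) = a B * a C) (s : Finset α) :
    p ∈ s → x ∈ s →
    cumulantOn u s = ∑ C ∈ (s.erase p).powerset.filter (x ∈ ·),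
      cumulantOn u C * (a C - 1) * cumulantOn u (s \ C) := by
  induction s using Finset.strongInduction with
  | H s ih =>
    intro hp hx
    let Rec : Finset α → R := fun V => ∑ C ∈ V.powerset, if x ∈ C ∧ p ∉ C then
      cumulantOn u C * (a C - 1) * cumulantOn u (V \ C) else 0
    have hRec : ∀ V : Finset α, ∑ C ∈ (V.erase p).powerset.filter (x ∈ ·),
        cumulantOn u C * (a C - 1) * cumulantOn u (V \ C) = Rec V := by
      intro V
      simp only [Rec]
      rw [← Finset.sum_filter]
      refine Finset.sum_congr ?_ fun _ _ => rfl
      ext C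
      simp only [Finset.mem_filter, Finset.mem_powerset, Finset.subset_erase]
      tauto
    rw [hRec]
    set Q : Finset (Finset α) := s.powerset.filter fun V => p ∈ V ∧ x ∈ V with hQ
    have hsQ : s ∈ Q := by simp [hQ, hp, hx]
    -- The two sides of the recursion are compared after summation against u (s \ V) over all V
    -- containing p and x. Terms with V ≠ s agree by induction, so equality of the sums gives
    -- equality at V = s.
    suffices h : ∑ V ∈ Q, Rec V * u (s \ V) = ∑ V ∈ Q, cumulantOn u V * u (s \ V) by
      rw [← Finset.add_sum_erase _ _ hsQ, ← Finset.add_sum_erase _ _ hsQ] at h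
      have h2 : ∀ V ∈ Q.erase s, cumulantOn u V * u (s \ V) = Rec V * u (s \ V) := by
        intro V hV
        rw [Finset.mem_erase, hQ, Finset.mem_filter, Finset.mem_powerset] at hV
        rw [ih V (Finset.ssubset_iff_subset_ne.mpr ⟨hV.2.1, hV.1⟩) hV.2.2.1 hV.2.2.2, hRec]
      rw [Finset.sum_congr rfl h2] at h
      have h3 := add_right_cancel h
      rw [Finset.sdiff_self, h0, mul_one, mul_one] at h3
      exact h3.symm
    have e1 : ∑ V ∈ Q, Rec V * u (s \ V) =
        ∑ C ∈ s.powerset, if x ∈ C ∧ p ∉ C then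
          cumulantOn u C * (a C - 1) * u (s \ C) else 0 := by
      rw [hQ, Finset.sum_filter]
      have h1 : ∀ V ∈ s.powerset, (if p ∈ V ∧ x ∈ V then Rec V * u (s \ V) else 0) =
          ∑ C ∈ V.powerset, if (x ∈ C ∧ p ∉ C) ∧ p ∈ V \ C then
            cumulantOn u C * (a C - 1) * (cumulantOn u (V \ C) * u (s \ V)) else 0 := by
        intro V _
        split_ifs with hV
        · rw [Finset.sum_mul]
          refine Finset.sum_congr rfl fun C hC => ?_
          by_cases hc : x ∈ C ∧ p ∉ C
          · rw [if_pos hc, if_pos ⟨hc, Finset.mem_sdiff.mpr ⟨hV.1, hc.2⟩⟩]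
            ring
          · rw [if_neg hc, if_neg fun h => hc h.1, zero_mul]
        · refine (Finset.sum_eq_zero fun C hC => if_neg fun h => hV ?_).symm
          exact ⟨(Finset.mem_sdiff.mp h.2).1, Finset.mem_powerset.mp hC h.1.1⟩
      rw [Finset.sum_congr rfl h1, sum_powerset_nested s fun C D E =>
        if (x ∈ C ∧ p ∉ C) ∧ p ∈ D then cumulantOn u C * (a C - 1) * (cumulantOn u D * u E) else 0]
      refine Finset.sum_congr rfl fun C _ => ?_
      split_ifs with hc
      -- For fixed C, the sum over D = V \ C is the expansion of u (s \ C) through the cumulants of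
      -- sets containing p.
      · rw [← sum_cumulantOn_mul h0 (Finset.mem_sdiff.mpr ⟨hp, hc.2⟩), Finset.mul_sum,
          Finset.sum_filter]
        refine Finset.sum_congr rfl fun D _ => ?_
        simp only [hc, true_and, not_false_eq_true]
      · exact Finset.sum_eq_zero fun D _ => if_neg fun h => hc h.1
    -- Extracting p from s \ C yields the factor a, which combines with a C into a (s.erase p). What
    -- is left is the expansion of u (s.erase p) through the cumulants of sets containing x.
    have e2 : ∑ C ∈ s.powerset, (if x ∈ C ∧ p ∉ C then cumulantOn u C * a C * u (s \ C) else 0) =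
        u s := by
      have hxe : x ∈ s.erase p := Finset.mem_erase.mpr ⟨hpx.symm, hx⟩
      have hus : u s = a (s.erase p) * u (s.erase p) := by
        rw [← hu _ (Finset.notMem_erase p s), Finset.insert_erase hp]
      rw [hus, ← sum_cumulantOn_mul h0 hxe, Finset.mul_sum, ← Finset.sum_filter]
      refine Finset.sum_congr ?_ fun C hC => ?_
      · ext C
        simp only [Finset.mem_filter, Finset.mem_powerset, Finset.subset_erase]
        tauto
      · simp only [Finset.mem_filter, Finset.mem_powerset] at hC
        have hC' : C ⊆ s.erase p := hC.1
        have hpC : p ∉ C := (Finset.subset_erase.mp hC').2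
        have h1 : s \ C = insert p (s.erase p \ C) := by
          ext z
          simp only [Finset.mem_sdiff, Finset.mem_insert, Finset.mem_erase]
          by_cases hz : z = p
          · subst hz
            simp [hp, hpC]
          · simp [hz]
        have h2 : a (s.erase p) = a C * a (s.erase p \ C) := by
          rw [← ha _ _ Finset.disjoint_sdiff, Finset.union_sdiff_of_subset hC']
        rw [h1, hu _ (by simp), h2]
        ring
    -- The expansion of u s through the cumulants of sets containing x, split according to whether p
    -- belongs to the set.
    have e3 : ∑ C ∈ s.powerset, (if x ∈ C ∧ p ∉ C then cumulantOn u C * u (s \ C) else 0) +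
        ∑ V ∈ Q, cumulantOn u V * u (s \ V) = u s := by
      rw [← sum_cumulantOn_mul h0 hx, hQ, Finset.sum_filter, Finset.sum_filter,
        ← Finset.sum_add_distrib]
      refine Finset.sum_congr rfl fun C _ => ?_
      by_cases h1 : x ∈ C <;> by_cases h2 : p ∈ C <;> simp [h1, h2]
    have e4 : ∑ C ∈ s.powerset, (if x ∈ C ∧ p ∉ C then
          cumulantOn u C * (a C - 1) * u (s \ C) else 0) =
        ∑ C ∈ s.powerset, (if x ∈ C ∧ p ∉ C then cumulantOn u C * a C * u (s \ C) else 0) -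
        ∑ C ∈ s.powerset, (if x ∈ C ∧ p ∉ C then cumulantOn u C * u (s \ C) else 0) := by
      rw [← Finset.sum_sub_distrib]
      refine Finset.sum_congr rfl fun C _ => ?_
      split_ifs <;> ring
    rw [e1, e4, e2, ← e3]
    ring

theorem cumulantOn_singleton (u : Finset α → R) (h0 : u ∅ = 1) (p : α) :
    cumulantOn u {p} = u {p} := by
  have h := sum_cumulantOn_mul h0 (Finset.mem_singleton_self p)
  rw [Finset.sum_eq_single {p}] at h
  · simpa [h0] using h
  · intro C hC hne
    simp only [Finset.mem_filter, Finset.mem_powerset] at hC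
    exact absurd (subset_antisymm hC.1 (Finset.singleton_subset_iff.mpr hC.2)) hne
  · intro h
    simp at h

theorem jointCumulant_eq_cumulantOn [Fintype α] (u : Finset α → R) :
    jointCumulant u = cumulantOn u Finset.univ := by
  rw [jointCumulant, cumulantOn, ← sum_finpartition]

end Cumulants

set_option linter.unusedSectionVars false

/-! ### Decomposing a rooted tree along an edge at its root -/

section Trees

variable {α : Type} [DecidableEq α]

/-- `T` is a tree with vertex set `V`. -/
structure TreeOn (V : Finset α) (T : SimpleGraph α) : Prop where
  acyclic : T.IsAcyclic
  mem : ∀ {a b}, T.Adj a b → a ∈ V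
  reachable : ∀ {a b}, a ∈ V → b ∈ V → T.Reachable a b

theorem TreeOn.mem' {V : Finset α} {T : SimpleGraph α} (h : TreeOn V T) {a b : α}
    (hab : T.Adj a b) : b ∈ V := h.mem hab.symm

/-- The vertex `i` lies on the path from `j` to the root `p`. -/
def OnPath (T : SimpleGraph α) (p i j : α) : Prop :=
  ∃ w : T.Walk j p, w.IsPath ∧ i ∈ w.support

theorem TreeOn.exists_path {V : Finset α} {T : SimpleGraph α} (h : TreeOn V T) {a b : α}
    (ha : a ∈ V) (hb : b ∈ V) : ∃ w : T.Walk a b, w.IsPath := by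
  obtain ⟨w⟩ := h.reachable ha hb
  exact ⟨w.bypass, w.bypass_isPath⟩

theorem TreeOn.support_subset {V : Finset α} {T : SimpleGraph α} (h : TreeOn V T) {a b : α}
    (w : T.Walk a b) (hb : b ∈ V) : ∀ c ∈ w.support, c ∈ V := by
  induction w with
  | nil => simpa using hb
  | cons hadj w ih =>
    intro c hc
    rw [SimpleGraph.Walk.support_cons, List.mem_cons] at hc
    rcases hc with rfl | hc
    · exact h.mem hadj
    · exact ih hb c hc

theorem TreeOn.onPath_mem {V : Finset α} {T : SimpleGraph α} (h : TreeOn V T) {p i j : α}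
    (hp : p ∈ V) (hij : OnPath T p i j) : i ∈ V ∧ j ∈ V := by
  obtain ⟨w, _, hi⟩ := hij
  exact ⟨h.support_subset w hp i hi, h.support_subset w hp j w.start_mem_support⟩

theorem onPath_root_iff {T : SimpleGraph α} {p i : α} : OnPath T p i p ↔ i = p := by
  constructor
  · rintro ⟨w, hw, hi⟩
    rw [SimpleGraph.Walk.nil_iff_support_eq.mp (SimpleGraph.Walk.isPath_iff_nil.mp hw)] at hi
    simpa using hi
  · rintro rfl
    exact ⟨SimpleGraph.Walk.nil, SimpleGraph.Walk.IsPath.nil, by simp⟩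

theorem TreeOn.onPath_self {V : Finset α} {T : SimpleGraph α} (h : TreeOn V T) {p j : α}
    (hp : p ∈ V) (hj : j ∈ V) : OnPath T p p j ∧ OnPath T p j j := by
  obtain ⟨w, hw⟩ := h.exists_path hj hp
  exact ⟨⟨w, hw, w.end_mem_support⟩, ⟨w, hw, w.start_mem_support⟩⟩

/-- Two disjoint trees, one of them with root `v`, joined by an edge linking `v` to a vertex `p` of
the other one. -/
structure Grafting (C D : Finset α) (p v : α) (T₁ T₂ T : SimpleGraph α) : Prop where
  disj : Disjoint C D
  hv : v ∈ C
  hp : p ∈ D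
  tree₁ : TreeOn C T₁
  tree₂ : TreeOn D T₂
  eq : T = T₁ ⊔ T₂ ⊔ SimpleGraph.edge p v

namespace Grafting

variable {C D : Finset α} {p v : α} {T₁ T₂ T : SimpleGraph α}

theorem notMem_right (h : Grafting C D p v T₁ T₂ T) {a : α} (ha : a ∈ C) : a ∉ D :=
  Finset.disjoint_left.mp h.disj ha

theorem ne (h : Grafting C D p v T₁ T₂ T) : p ≠ v := fun he => h.notMem_right h.hv (he ▸ h.hp)

theorem adj_iff (h : Grafting C D p v T₁ T₂ T) {a b : α} :
    T.Adj a b ↔ T₁.Adj a b ∨ T₂.Adj a b ∨ (a = p ∧ b = v) ∨ (a = v ∧ b = p) := by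
  rw [h.eq]
  simp only [SimpleGraph.sup_adj, SimpleGraph.edge_adj, or_assoc]
  have := h.ne
  constructor
  · rintro (h1 | h1 | h1)
    · exact Or.inl h1
    · exact Or.inr (Or.inl h1)
    · exact Or.inr (Or.inr h1.1)
  · rintro (h1 | h1 | ⟨rfl, rfl⟩ | ⟨rfl, rfl⟩)
    · exact Or.inl h1
    · exact Or.inr (Or.inl h1)
    · exact Or.inr (Or.inr ⟨Or.inl ⟨rfl, rfl⟩, this⟩)
    · exact Or.inr (Or.inr ⟨Or.inr ⟨rfl, rfl⟩, this.symm⟩)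

theorem le₁ (h : Grafting C D p v T₁ T₂ T) : T₁ ≤ T := fun _ _ hab => h.adj_iff.mpr (Or.inl hab)

theorem le₂ (h : Grafting C D p v T₁ T₂ T) : T₂ ≤ T :=
  fun _ _ hab => h.adj_iff.mpr (Or.inr (Or.inl hab))

theorem adj_root (h : Grafting C D p v T₁ T₂ T) : T.Adj v p :=
  h.adj_iff.mpr (Or.inr (Or.inr (Or.inr ⟨rfl, rfl⟩)))

/-- No edge joins C to D, so a walk starting in C stays there and uses edges of T₁ only. -/
theorem edges_sup {C D : Finset α} {T₁ T₂ : SimpleGraph α} (hd : Disjoint C D)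
    (h₁ : TreeOn C T₁) (h₂ : TreeOn D T₂) {a b : α} (w : (T₁ ⊔ T₂).Walk a b) :
    a ∈ C → b ∈ C ∧ ∀ e ∈ w.edges, e ∈ T₁.edgeSet := by
  induction w with
  | nil => simp
  | cons hadj w ih =>
    intro ha
    rcases hadj with hadj | hadj
    · obtain ⟨hb, he⟩ := ih (h₁.mem' hadj)
      refine ⟨hb, fun e hmem => ?_⟩
      rw [SimpleGraph.Walk.edges_cons, List.mem_cons] at hmem
      rcases hmem with rfl | hmem
      · exact hadj
      · exact he e hmem
    · exact absurd (h₂.mem hadj) (Finset.disjoint_left.mp hd ha)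

theorem acyclic_sup {C D : Finset α} {T₁ T₂ : SimpleGraph α} (hd : Disjoint C D)
    (h₁ : TreeOn C T₁) (h₂ : TreeOn D T₂) : (T₁ ⊔ T₂).IsAcyclic := by
  intro a w hw
  cases w with
  | nil => exact hw.ne_nil rfl
  | cons hadj w' =>
    have h := hadj
    rcases h with h | h
    · have := (edges_sup hd h₁ h₂ (SimpleGraph.Walk.cons hadj w') (h₁.mem h)).2
      exact h₁.acyclic _ (hw.transfer this)
    · have hw2 : ∀ e ∈ (SimpleGraph.Walk.cons hadj w').edges, e ∈ (T₂ ⊔ T₁).edgeSet := by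
        intro e he
        rw [sup_comm]
        exact SimpleGraph.Walk.edges_subset_edgeSet _ he
      have hw3 := hw.transfer hw2
      exact h₂.acyclic _ (hw3.transfer (edges_sup hd.symm h₂ h₁ _ (h₂.mem h)).2)

theorem treeOn (h : Grafting C D p v T₁ T₂ T) : TreeOn (C ∪ D) T where
  acyclic := by
    rw [h.eq]
    refine SimpleGraph.IsAcyclic.sup_edge_of_not_reachable ?_ (acyclic_sup h.disj h.tree₁ h.tree₂)
    intro hr
    obtain ⟨w⟩ := hr.symm
    exact h.notMem_right (edges_sup h.disj h.tree₁ h.tree₂ w h.hv).1 h.hp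
  mem := by
    intro a b hab
    rw [Finset.mem_union]
    rcases h.adj_iff.mp hab with hab | hab | ⟨rfl, rfl⟩ | ⟨rfl, rfl⟩
    · exact Or.inl (h.tree₁.mem hab)
    · exact Or.inr (h.tree₂.mem hab)
    · exact Or.inr h.hp
    · exact Or.inl h.hv
  reachable := by
    have key : ∀ {a}, a ∈ C ∪ D → T.Reachable a p := by
      intro a ha
      rcases Finset.mem_union.mp ha with ha | ha
      · exact ((h.tree₁.reachable ha h.hv).mono h.le₁).trans h.adj_root.reachable
      · exact (h.tree₂.reachable ha h.hp).mono h.le₂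
    intro a b ha hb
    exact (key ha).trans (key hb).symm

theorem onPath_iff_of_path (h : Grafting C D p v T₁ T₂ T) {i j : α} {w : T.Walk j p}
    (hw : w.IsPath) : OnPath T p i j ↔ i ∈ w.support := by
  constructor
  · rintro ⟨w', hw', hi⟩
    have := (h.treeOn.acyclic.subsingleton_path j p).elim ⟨w, hw⟩ ⟨w', hw'⟩
    rw [Subtype.mk.injEq] at this
    rwa [this]
  · exact fun hi => ⟨w, hw, hi⟩

theorem onPath_right (h : Grafting C D p v T₁ T₂ T) {i j : α} (hj : j ∈ D) :
    OnPath T p i j ↔ OnPath T₂ p i j := by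
  constructor
  · obtain ⟨w, hw⟩ := h.tree₂.exists_path hj h.hp
    intro h1
    have hw' := (SimpleGraph.Walk.isPath_mapLe h.le₂).mpr hw
    rw [h.onPath_iff_of_path hw', SimpleGraph.Walk.support_mapLe_eq_support] at h1
    exact ⟨w, hw, h1⟩
  · rintro ⟨w, hw, hi⟩
    refine ⟨w.mapLe h.le₂, (SimpleGraph.Walk.isPath_mapLe h.le₂).mpr hw, ?_⟩
    rwa [SimpleGraph.Walk.support_mapLe_eq_support]

/-- From C, the path to the root p runs to v inside T₁ and then crosses the grafting edge. -/
theorem onPath_left (h : Grafting C D p v T₁ T₂ T) {i j : α} (hj : j ∈ C) :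
    OnPath T p i j ↔ OnPath T₁ v i j ∨ i = p := by
  have key : ∀ w : T₁.Walk j v, w.IsPath →
      (OnPath T p i j ↔ i ∈ w.support ∨ i = p) := by
    intro w hw
    have hw' := (SimpleGraph.Walk.isPath_mapLe h.le₁).mpr hw
    have hp : p ∉ (w.mapLe h.le₁).support := by
      rw [SimpleGraph.Walk.support_mapLe_eq_support]
      exact fun hp => h.notMem_right (h.tree₁.support_subset w h.hv p hp) h.hp
    rw [h.onPath_iff_of_path (hw'.concat hp h.adj_root), SimpleGraph.Walk.support_concat,
      SimpleGraph.Walk.support_mapLe_eq_support]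
    simp
  constructor
  · obtain ⟨w, hw⟩ := h.tree₁.exists_path hj h.hv
    intro h1
    rcases (key w hw).mp h1 with h2 | h2
    · exact Or.inl ⟨w, hw, h2⟩
    · exact Or.inr h2
  · rintro (⟨w, hw, hi⟩ | rfl)
    · exact (key w hw).mpr (Or.inl hi)
    · obtain ⟨w, hw⟩ := h.tree₁.exists_path hj h.hv
      exact (key w hw).mpr (Or.inr rfl)

theorem child_unique (h : Grafting C D p v T₁ T₂ T) {v' x : α} (hx : x ∈ C) (hv' : T.Adj v' p)
    (hon : OnPath T p v' x) : v' = v := by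
  have hne : v' ≠ p := hv'.ne
  have hC := (h.tree₁.onPath_mem h.hv (((h.onPath_left hx).mp hon).resolve_right hne)).1
  rcases h.adj_iff.mp hv' with h1 | h1 | h1 | h1
  · exact absurd h.hp (h.notMem_right (h.tree₁.mem' h1))
  · exact absurd (h.tree₂.mem h1) (h.notMem_right hC)
  · exact absurd h1.1 hne
  · exact h1.1

theorem onPath_child_iff (h : Grafting C D p v T₁ T₂ T) {y : α} (hy : y ∈ C ∪ D) :
    OnPath T p v y ↔ y ∈ C := by
  rcases Finset.mem_union.mp hy with hy | hy
  · exact iff_of_true ((h.onPath_left hy).mpr (Or.inl (h.tree₁.onPath_self h.hv hy).1)) hy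
  · refine iff_of_false (fun h1 => ?_) fun h1 => h.notMem_right h1 hy
    exact h.notMem_right h.hv (h.tree₂.onPath_mem h.hp ((h.onPath_right hy).mp h1)).1

theorem adj_left_iff (h : Grafting C D p v T₁ T₂ T) {a b : α} :
    T₁.Adj a b ↔ T.Adj a b ∧ a ∈ C ∧ b ∈ C := by
  constructor
  · exact fun h1 => ⟨h.le₁ h1, h.tree₁.mem h1, h.tree₁.mem' h1⟩
  · rintro ⟨h1, ha, hb⟩
    rcases h.adj_iff.mp h1 with h1 | h1 | ⟨rfl, rfl⟩ | ⟨rfl, rfl⟩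
    · exact h1
    · exact absurd (h.tree₂.mem h1) (h.notMem_right ha)
    · exact absurd h.hp (h.notMem_right ha)
    · exact absurd h.hp (h.notMem_right hb)

theorem adj_right_iff (h : Grafting C D p v T₁ T₂ T) {a b : α} :
    T₂.Adj a b ↔ T.Adj a b ∧ a ∈ D ∧ b ∈ D := by
  constructor
  · exact fun h1 => ⟨h.le₂ h1, h.tree₂.mem h1, h.tree₂.mem' h1⟩
  · rintro ⟨h1, ha, hb⟩
    rcases h.adj_iff.mp h1 with h1 | h1 | ⟨rfl, rfl⟩ | ⟨rfl, rfl⟩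
    · exact absurd ha (h.notMem_right (h.tree₁.mem h1))
    · exact h1
    · exact absurd hb (h.notMem_right h.hv)
    · exact absurd ha (h.notMem_right h.hv)

/-- The tree T and the marked vertex x determine everything: v is the neighbour of p on the path
from x, C consists of the vertices whose path to p passes through v, and T₁, T₂ are the restrictions
of T. -/
theorem unique {V C' : Finset α} {v' x : α} {T₁' T₂' : SimpleGraph α}
    (hC : C ⊆ V) (hC' : C' ⊆ V)
    (h : Grafting C (V \ C) p v T₁ T₂ T) (h' : Grafting C' (V \ C') p v' T₁' T₂' T)
    (hx : x ∈ C) (hx' : x ∈ C') : C = C' ∧ v = v' ∧ T₁ = T₁' ∧ T₂ = T₂' := by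
  have hun := Finset.union_sdiff_of_subset hC
  have hun' := Finset.union_sdiff_of_subset hC'
  have hxV : x ∈ C' ∪ (V \ C') := Finset.mem_union_left _ hx'
  obtain rfl : v' = v := h.child_unique hx h'.adj_root ((h'.onPath_child_iff hxV).mpr hx')
  obtain rfl : C = C' := by
    ext y
    by_cases hy : y ∈ V
    · rw [← h.onPath_child_iff (hun.symm ▸ hy), ← h'.onPath_child_iff (hun'.symm ▸ hy)]
    · exact iff_of_false (fun h => hy (hC h)) fun h => hy (hC' h)
  refine ⟨rfl, rfl, ?_, ?_⟩
  · ext a b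
    rw [h.adj_left_iff, h'.adj_left_iff]
  · ext a b
    rw [h.adj_right_iff, h'.adj_right_iff]

end Grafting

/-- The vertex v is the one from which the walk enters p for the first time; the walk up to v avoids
p, hence also the deleted edge. -/
theorem exists_last_edge {T : SimpleGraph α} {x p : α} (w : T.Walk x p) (hne : x ≠ p) :
    ∃ v, T.Adj v p ∧ (T.deleteEdges {s(v, p)}).Reachable x v := by
  induction w with
  | nil => exact absurd rfl hne
  | @cons a b c hadj w ih =>
    by_cases hb : b = c
    · subst hb
      exact ⟨a, hadj, SimpleGraph.Reachable.refl _⟩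
    · obtain ⟨v, hv, hr⟩ := ih hb
      refine ⟨v, hv, SimpleGraph.Reachable.trans (SimpleGraph.Adj.reachable ?_) hr⟩
      rw [SimpleGraph.deleteEdges_adj]
      refine ⟨hadj, fun h => ?_⟩
      rw [Set.mem_singleton_iff, Sym2.eq_iff] at h
      rcases h with h | h
      · exact hb h.2
      · exact hne h.1

theorem reachable_or_of_walk {T : SimpleGraph α} {y p v : α} (w : T.Walk y p) :
    (T.deleteEdges {s(v, p)}).Reachable y v ∨ (T.deleteEdges {s(v, p)}).Reachable y p := by
  induction w with
  | nil => exact Or.inr (SimpleGraph.Reachable.refl _)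
  | @cons a b c hadj w ih =>
    by_cases h : s(a, b) = s(v, c)
    · rw [Sym2.eq_iff] at h
      rcases h with h | h
      · exact Or.inl (h.1 ▸ SimpleGraph.Reachable.refl _)
      · exact Or.inr (h.1 ▸ SimpleGraph.Reachable.refl _)
    · have h1 : (T.deleteEdges {s(v, c)}).Adj a b := by
        rw [SimpleGraph.deleteEdges_adj]
        exact ⟨hadj, h⟩
      exact ih.imp h1.reachable.trans h1.reachable.trans

/-- The part of a graph with both endpoints in a set. -/
def restrictTo (T : SimpleGraph α) (C : Finset α) : SimpleGraph α where
  Adj a b := T.Adj a b ∧ a ∈ C ∧ b ∈ C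
  symm := ⟨fun _ _ h => ⟨h.1.symm, h.2.2, h.2.1⟩⟩
  loopless := ⟨fun _ h => h.1.ne rfl⟩

theorem treeOn_restrictTo {T : SimpleGraph α} (hT : T.IsAcyclic) {C : Finset α} {v : α}
    (hC : ∀ y, y ∈ C → T.Reachable y v) (hC' : ∀ a b, a ∈ C → T.Adj a b → b ∈ C) :
    TreeOn C (restrictTo T C) where
  acyclic := hT.anti fun _ _ h => h.1
  mem h := h.2.1
  reachable := by
    have key : ∀ {y z : α}, T.Walk y z → y ∈ C → (restrictTo T C).Reachable y z := by
      intro y z w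
      induction w with
      | nil => exact fun _ => SimpleGraph.Reachable.refl _
      | cons hadj w ih =>
        intro hy
        have hb := hC' _ _ hy hadj
        exact (SimpleGraph.Adj.reachable (⟨hadj, hy, hb⟩ : (restrictTo T C).Adj _ _)).trans (ih hb)
    intro a b ha hb
    obtain ⟨w⟩ := hC a ha
    obtain ⟨w'⟩ := hC b hb
    exact (key w ha).trans (key w' hb).symm

/-- Deleting the edge from p towards x disconnects the tree, every edge of an acyclic graph being a
bridge. The component of v, which contains x, is C, and every other vertex remains connected to p.
-/
theorem exists_grafting {V : Finset α} {T : SimpleGraph α} (hT : TreeOn V T) {p x : α} (hp : p ∈ V)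
    (hx : x ∈ V) (hne : x ≠ p) :
    ∃ C v T₁ T₂, C ⊆ V ∧ x ∈ C ∧ Grafting C (V \ C) p v T₁ T₂ T := by
  obtain ⟨w⟩ := hT.reachable hx hp
  obtain ⟨v, hv, hr⟩ := exists_last_edge w hne
  set T' := T.deleteEdges {s(v, p)} with hT'
  have hvV : v ∈ V := hT.mem hv
  have hle : T' ≤ T := SimpleGraph.deleteEdges_le _
  have hbridge : ¬ T'.Reachable v p :=
    SimpleGraph.isAcyclic_iff_forall_isBridge.mp hT.acyclic (e := s(v, p)) hv
  have hacyc : T'.IsAcyclic := hT.acyclic.anti hle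
  have hD : ∀ {y}, y ∈ V → ¬ T'.Reachable y v → T'.Reachable y p := by
    intro y hy hn
    obtain ⟨w⟩ := hT.reachable hy hp
    exact (reachable_or_of_walk (v := v) w).resolve_left hn
  set C := V.filter fun y => T'.Reachable y v with hC
  have mem_D : ∀ {y}, y ∈ V \ C ↔ y ∈ V ∧ ¬ T'.Reachable y v := by
    intro y
    simp only [hC, Finset.mem_sdiff, Finset.mem_filter, not_and]
    exact ⟨fun h => ⟨h.1, h.2 h.1⟩, fun h => ⟨h.1, fun _ => h.2⟩⟩
  have t₁ : TreeOn C (restrictTo T' C) := by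
    refine treeOn_restrictTo hacyc (v := v) (fun y hy => (Finset.mem_filter.mp hy).2) ?_
    intro a b ha hab
    exact Finset.mem_filter.mpr ⟨hT.mem' (hle hab),
      hab.symm.reachable.trans (Finset.mem_filter.mp ha).2⟩
  have t₂ : TreeOn (V \ C) (restrictTo T' (V \ C)) := by
    refine treeOn_restrictTo hacyc (v := p) (fun y hy => hD (mem_D.mp hy).1 (mem_D.mp hy).2) ?_
    intro a b ha hab
    exact mem_D.mpr ⟨hT.mem' (hle hab), fun h => (mem_D.mp ha).2 (hab.reachable.trans h)⟩
  refine ⟨C, v, restrictTo T' C, restrictTo T' (V \ C), Finset.filter_subset _ _,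
    Finset.mem_filter.mpr ⟨hx, hr⟩, Finset.disjoint_sdiff,
    Finset.mem_filter.mpr ⟨hvV, SimpleGraph.Reachable.refl _⟩,
    mem_D.mpr ⟨hp, fun h => hbridge h.symm⟩, t₁, t₂, ?_⟩
  ext a b
  simp only [SimpleGraph.sup_adj, SimpleGraph.edge_adj]
  constructor
  · intro hab
    by_cases hs : s(a, b) = s(v, p)
    · right
      rw [Sym2.eq_iff] at hs
      exact ⟨hs.symm, hab.ne⟩
    · left
      have hab' : T'.Adj a b := by
        rw [hT', SimpleGraph.deleteEdges_adj]
        exact ⟨hab, hs⟩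
      by_cases ha : T'.Reachable a v
      · left
        exact ⟨hab', Finset.mem_filter.mpr ⟨hT.mem hab, ha⟩,
          Finset.mem_filter.mpr ⟨hT.mem' hab, hab'.symm.reachable.trans ha⟩⟩
      · right
        exact ⟨hab', mem_D.mpr ⟨hT.mem hab, ha⟩,
          mem_D.mpr ⟨hT.mem' hab, fun h => ha (hab'.reachable.trans h)⟩⟩
  · rintro ((h | h) | ⟨⟨rfl, rfl⟩ | ⟨rfl, rfl⟩, _⟩)
    · exact hle h.1
    · exact hle h.1
    · exact hv.symm
    · exact hv

end Trees

/-! ### Weighted counts of trees and the inversion polynomial -/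

section TreeSums

variable {r : ℕ} {R : Type} [CommRing R]

/-- `i` is a proper ancestor of `j` in the tree `T` with root `p`. -/
def AncestorIn (T : SimpleGraph (Fin r)) (p i j : Fin r) : Prop := i ≠ j ∧ OnPath T p i j

/-- `i` is an ancestor of `j`, `j < i`, and `a` is the parent of `i`, in the tree `T` with
root `p`. -/
def KappaTriple (T : SimpleGraph (Fin r)) (p : Fin r) (x : Fin r × Fin r × Fin r) : Prop :=
  AncestorIn T p x.2.1 x.2.2 ∧ x.2.2 < x.2.1 ∧ AncestorIn T p x.1 x.2.1 ∧ T.Adj x.1 x.2.1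

/-- An inversion whose upper vertex is not v lives in one of the two trees. Those with upper vertex
v have parent p, and any j < v in C qualifies, since v is the root of T₁. -/
theorem Grafting.kappaTriple_iff {C D : Finset (Fin r)} {p v : Fin r}
    {T₁ T₂ T : SimpleGraph (Fin r)} (h : Grafting C D p v T₁ T₂ T) (x : Fin r × Fin r × Fin r) :
    KappaTriple T p x ↔ KappaTriple T₁ v x ∨ KappaTriple T₂ p x ∨
      (x.1 = p ∧ x.2.1 = v ∧ x.2.2 ∈ C ∧ x.2.2 < v) := by
  obtain ⟨a, i, j⟩ := x
  simp only [KappaTriple, AncestorIn]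
  constructor
  · rintro ⟨⟨hij, hon⟩, hlt, ⟨hai, hon'⟩, hadj⟩
    have hj := (h.treeOn.onPath_mem (Finset.mem_union_right _ h.hp) hon).2
    rcases h.adj_iff.mp hadj with h1 | h1 | ⟨rfl, rfl⟩ | ⟨rfl, rfl⟩
    · have ha := h.tree₁.mem h1
      have hi := h.tree₁.mem' h1
      have hap : a ≠ p := fun he => h.notMem_right ha (he ▸ h.hp)
      have hip : i ≠ p := fun he => h.notMem_right hi (he ▸ h.hp)
      left
      rcases Finset.mem_union.mp hj with hj | hj
      · exact ⟨⟨hij, ((h.onPath_left hj).mp hon).resolve_right hip⟩, hlt,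
          ⟨hai, ((h.onPath_left hi).mp hon').resolve_right hap⟩, h1⟩
      · exact absurd (h.tree₂.onPath_mem h.hp ((h.onPath_right hj).mp hon)).1 (h.notMem_right hi)
    · have ha := h.tree₂.mem h1
      have hi := h.tree₂.mem' h1
      right; left
      have hon2 := (h.onPath_right hi).mp hon'
      rcases Finset.mem_union.mp hj with hj | hj
      · rcases (h.onPath_left hj).mp hon with h2 | rfl
        · exact absurd hi (h.notMem_right (h.tree₁.onPath_mem h.hv h2).1)
        · exact absurd (onPath_root_iff.mp hon2) hai
      · exact ⟨⟨hij, (h.onPath_right hj).mp hon⟩, hlt, ⟨hai, hon2⟩, h1⟩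
    · right; right
      exact ⟨rfl, rfl, (h.onPath_child_iff hj).mp hon, hlt⟩
    · exact absurd (onPath_root_iff.mp hon') hai
  · rintro (⟨⟨hij, hon⟩, hlt, ⟨hai, hon'⟩, hadj⟩ | ⟨⟨hij, hon⟩, hlt, ⟨hai, hon'⟩, hadj⟩ |
      ⟨rfl, rfl, hj, hlt⟩)
    · have hj := (h.tree₁.onPath_mem h.hv hon).2
      have hi := (h.tree₁.onPath_mem h.hv hon').2
      exact ⟨⟨hij, (h.onPath_left hj).mpr (Or.inl hon)⟩, hlt,
        ⟨hai, (h.onPath_left hi).mpr (Or.inl hon')⟩, h.le₁ hadj⟩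
    · have hj := (h.tree₂.onPath_mem h.hp hon).2
      have hi := (h.tree₂.onPath_mem h.hp hon').2
      exact ⟨⟨hij, (h.onPath_right hj).mpr hon⟩, hlt,
        ⟨hai, (h.onPath_right hi).mpr hon'⟩, h.le₂ hadj⟩
    · exact ⟨⟨hlt.ne', (h.onPath_child_iff (Finset.mem_union_left _ hj)).mpr hj⟩, hlt,
        ⟨h.ne, (h.onPath_left h.hv).mpr (Or.inr rfl)⟩, h.adj_root.symm⟩

/-- The sum of the numbers of edges over the `κ`-inversions of a tree with root `p`. -/
def kappaIn (e : Fin r → Fin r → ℕ) (T : SimpleGraph (Fin r)) (p : Fin r) : ℕ :=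
  ∑ x : Fin r × Fin r × Fin r, if KappaTriple T p x then e x.1 x.2.2 else 0

theorem Grafting.kappaIn_eq {C D : Finset (Fin r)} {p v : Fin r}
    {T₁ T₂ T : SimpleGraph (Fin r)} (h : Grafting C D p v T₁ T₂ T) (e : Fin r → Fin r → ℕ) :
    kappaIn e T p = kappaIn e T₁ v + kappaIn e T₂ p + ∑ j ∈ C.filter (· < v), e p j := by
  have h3 : ∑ j ∈ C.filter (· < v), e p j = ∑ x : Fin r × Fin r × Fin r,
      if x.1 = p ∧ x.2.1 = v ∧ x.2.2 ∈ C ∧ x.2.2 < v then e x.1 x.2.2 else 0 := by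
    symm
    rw [Fintype.sum_prod_type, Finset.sum_eq_single p, Fintype.sum_prod_type,
      Finset.sum_eq_single v, ← Finset.sum_filter]
    · refine Finset.sum_congr ?_ fun _ _ => rfl
      ext j
      simp
    · intro b _ hb
      simp [hb]
    · simp
    · intro b _ hb
      simp [hb]
    · simp
  rw [h3, kappaIn, kappaIn, kappaIn, ← Finset.sum_add_distrib, ← Finset.sum_add_distrib]
  refine Finset.sum_congr rfl fun x _ => ?_
  have hiff := h.kappaTriple_iff x
  have d12 : KappaTriple T₁ v x → ¬ KappaTriple T₂ p x := fun h1 h2 =>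
    h.notMem_right (h.tree₁.mem h1.2.2.2) (h.tree₂.mem h2.2.2.2)
  have d13 : KappaTriple T₁ v x → ¬ (x.1 = p ∧ x.2.1 = v ∧ x.2.2 ∈ C ∧ x.2.2 < v) := by
    rintro h1 ⟨h2, _⟩
    exact h.notMem_right (h.tree₁.mem h1.2.2.2) (h2 ▸ h.hp)
  have d23 : KappaTriple T₂ p x → ¬ (x.1 = p ∧ x.2.1 = v ∧ x.2.2 ∈ C ∧ x.2.2 < v) := by
    rintro h1 ⟨_, h2, _⟩
    exact h.notMem_right h.hv (h2 ▸ h.tree₂.mem' h1.2.2.2)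
  by_cases h1 : KappaTriple T₁ v x
  · rw [if_pos (hiff.mpr (Or.inl h1)), if_pos h1, if_neg (d12 h1), if_neg (d13 h1), add_zero,
      add_zero]
  · by_cases h2 : KappaTriple T₂ p x
    · rw [if_pos (hiff.mpr (Or.inr (Or.inl h2))), if_neg h1, if_pos h2, if_neg (d23 h2), zero_add,
        add_zero]
    · by_cases h4 : x.1 = p ∧ x.2.1 = v ∧ x.2.2 ∈ C ∧ x.2.2 < v
      · rw [if_pos (hiff.mpr (Or.inr (Or.inr h4))), if_neg h1, if_neg h2, if_pos h4, zero_add,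
          zero_add]
      · rw [if_neg fun h5 => (hiff.mp h5).elim h1 fun h6 => h6.elim h2 h4, if_neg h1, if_neg h2,
          if_neg h4]

/-- The product of the weights of the edges of a graph. -/
def edgeProd (g : Fin r → Fin r → R) (T : SimpleGraph (Fin r)) : R :=
  ∏ x : Fin r × Fin r, if x.1 < x.2 ∧ T.Adj x.1 x.2 then g x.1 x.2 else 1

theorem Grafting.edgeProd_eq {C D : Finset (Fin r)} {p v : Fin r}
    {T₁ T₂ T : SimpleGraph (Fin r)} (h : Grafting C D p v T₁ T₂ T) {g : Fin r → Fin r → R}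
    (hg : ∀ i j, g i j = g j i) : edgeProd g T = edgeProd g T₁ * edgeProd g T₂ * g p v := by
  have hE : ∃ y : Fin r × Fin r, y.1 < y.2 ∧ (y = (p, v) ∨ y = (v, p)) := by
    rcases lt_or_gt_of_ne h.ne with hlt | hlt
    · exact ⟨(p, v), hlt, Or.inl rfl⟩
    · exact ⟨(v, p), hlt, Or.inr rfl⟩
  obtain ⟨y, hy, hy'⟩ := hE
  have hgy : g p v = ∏ x : Fin r × Fin r, if x = y then g x.1 x.2 else 1 := by
    rw [Finset.prod_ite_eq' Finset.univ y, if_pos (Finset.mem_univ _)]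
    rcases hy' with rfl | rfl
    · rfl
    · exact hg _ _
  rw [hgy, edgeProd, edgeProd, edgeProd, ← Finset.prod_mul_distrib, ← Finset.prod_mul_distrib]
  refine Finset.prod_congr rfl fun x _ => ?_
  have hxy : x = y ↔ x.1 < x.2 ∧ ((x.1 = p ∧ x.2 = v) ∨ (x.1 = v ∧ x.2 = p)) := by
    constructor
    · rintro rfl
      exact ⟨hy, hy'.imp (fun h => ⟨congrArg Prod.fst h, congrArg Prod.snd h⟩)
        fun h => ⟨congrArg Prod.fst h, congrArg Prod.snd h⟩⟩
    · rintro ⟨hlt, h1⟩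
      rcases hy' with rfl | rfl <;> rcases h1 with h1 | h1 <;> dsimp only at hy
      · exact Prod.ext h1.1 h1.2
      · rw [h1.1, h1.2] at hlt
        exact absurd hlt hy.asymm
      · rw [h1.1, h1.2] at hlt
        exact absurd hlt hy.asymm
      · exact Prod.ext h1.1 h1.2
  by_cases hlt : x.1 < x.2
  · by_cases h1 : T₁.Adj x.1 x.2
    · have h2 : ¬ T₂.Adj x.1 x.2 := fun h2 => h.notMem_right (h.tree₁.mem h1) (h.tree₂.mem h2)
      have h3 : x ≠ y := fun h3 => by
        rcases (hxy.mp h3).2 with h4 | h4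
        · exact h.notMem_right (h.tree₁.mem h1) (h4.1 ▸ h.hp)
        · exact h.notMem_right (h.tree₁.mem' h1) (h4.2 ▸ h.hp)
      simp [hlt, h1, h2, h3, h.le₁ h1]
    · by_cases h2 : T₂.Adj x.1 x.2
      · have h3 : x ≠ y := fun h3 => by
          rcases (hxy.mp h3).2 with h4 | h4
          · exact h.notMem_right h.hv (h4.2 ▸ h.tree₂.mem' h2)
          · exact h.notMem_right h.hv (h4.1 ▸ h.tree₂.mem h2)
        simp [hlt, h1, h2, h3, h.le₂ h2]
      · by_cases h3 : x = y
        · have h4 : T.Adj x.1 x.2 := h.adj_iff.mpr (Or.inr (Or.inr (hxy.mp h3).2))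
          rw [if_pos ⟨hlt, h4⟩, if_neg fun h => h1 h.2, if_neg fun h => h2 h.2, if_pos h3, one_mul,
            one_mul]
        · have h4 : ¬ T.Adj x.1 x.2 := fun h4 => by
            rcases h.adj_iff.mp h4 with h5 | h5 | h5
            · exact h1 h5
            · exact h2 h5
            · exact h3 (hxy.mpr ⟨hlt, h5⟩)
          simp [h1, h2, h3, h4]
  · have h3 : x ≠ y := fun h3 => hlt (h3 ▸ hy)
    simp [hlt, h3]

/-- The trees with vertex set `V`. -/
def treesOn (V : Finset (Fin r)) : Finset (SimpleGraph (Fin r)) :=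
  Finset.univ.filter (TreeOn V)

theorem mem_treesOn {V : Finset (Fin r)} {T : SimpleGraph (Fin r)} :
    T ∈ treesOn V ↔ TreeOn V T := by simp [treesOn]

/-- Trees are obtained by grafting. -/
theorem sum_treesOn {V : Finset (Fin r)} {p x : Fin r} (hp : p ∈ V) (hx : x ∈ V) (hne : x ≠ p)
    (F : SimpleGraph (Fin r) → R) :
    ∑ T ∈ treesOn V, F T =
      ∑ C ∈ (V.erase p).powerset.filter (x ∈ ·), ∑ v ∈ C, ∑ T₁ ∈ treesOn C,
        ∑ T₂ ∈ treesOn (V \ C), F (T₁ ⊔ T₂ ⊔ SimpleGraph.edge p v) := by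
  have hgr : ∀ {C v T₁ T₂}, C ⊆ V.erase p → v ∈ C → TreeOn C T₁ → TreeOn (V \ C) T₂ →
      Grafting C (V \ C) p v T₁ T₂ (T₁ ⊔ T₂ ⊔ SimpleGraph.edge p v) := fun hC hv h₁ h₂ =>
    ⟨Finset.disjoint_sdiff, hv,
      Finset.mem_sdiff.mpr ⟨hp, fun h => by simpa using hC h⟩, h₁, h₂, rfl⟩
  simp only [Finset.sum_sigma']
  symm
  refine Finset.sum_nbij (fun y => y.2.2.1 ⊔ y.2.2.2 ⊔ SimpleGraph.edge p y.2.1) ?_ ?_ ?_ ?_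
  · rintro ⟨C, v, T₁, T₂⟩ h
    simp only [Finset.mem_sigma, Finset.mem_filter, Finset.mem_powerset, mem_treesOn] at h ⊢
    have := (hgr h.1.1 h.2.1 h.2.2.1 h.2.2.2).treeOn
    rwa [Finset.union_sdiff_of_subset (h.1.1.trans (Finset.erase_subset _ _))] at this
  · rintro ⟨C, v, T₁, T₂⟩ h ⟨C', v', T₁', T₂'⟩ h' he
    simp only [Finset.coe_sigma, Set.mem_sigma_iff, Finset.mem_coe, Finset.mem_filter,
      Finset.mem_powerset, mem_treesOn] at h h'
    dsimp only at he
    have g := hgr h.1.1 h.2.1 h.2.2.1 h.2.2.2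
    have g' := hgr h'.1.1 h'.2.1 h'.2.2.1 h'.2.2.2
    rw [← he] at g'
    obtain ⟨rfl, rfl, rfl, rfl⟩ := g.unique (h.1.1.trans (Finset.erase_subset _ _))
      (h'.1.1.trans (Finset.erase_subset _ _)) g' h.1.2 h'.1.2
    rfl
  · intro T hT
    rw [Finset.mem_coe, mem_treesOn] at hT
    obtain ⟨C, v, T₁, T₂, hC, hxC, hg⟩ := exists_grafting hT hp hx hne
    refine ⟨⟨C, v, T₁, T₂⟩, ?_, hg.eq.symm⟩
    simp only [Finset.coe_sigma, Set.mem_sigma_iff, Finset.mem_coe, Finset.mem_filter,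
      Finset.mem_powerset, mem_treesOn]
    exact ⟨⟨Finset.subset_erase.mpr ⟨hC, fun h => hg.notMem_right h hg.hp⟩, hxC⟩, hg.hv, hg.tree₁,
      hg.tree₂⟩
  · exact fun _ _ => rfl

/-- The `q`-integer at an element of a ring. -/
def qIntAt (x : R) (n : ℕ) : R := ∑ k ∈ Finset.range n, x ^ k

theorem sub_one_mul_qIntAt (x : R) (n : ℕ) : (x - 1) * qIntAt x n = x ^ n - 1 :=
  mul_geom_sum x n

/-- The weighted number of trees on `V` with root `p`. -/
def treeSum (x : R) (e : Fin r → Fin r → ℕ) (V : Finset (Fin r)) (p : Fin r) : R :=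
  ∑ T ∈ treesOn V, x ^ kappaIn e T p * edgeProd (fun i j => qIntAt x (e i j)) T

/-- The number of edges between the elements of a set. -/
def edgesWithin (e : Fin r → Fin r → ℕ) (B : Finset (Fin r)) : ℕ :=
  ∑ i ∈ B, ∑ j ∈ B.filter (i < ·), e i j

theorem edgesWithin_insert {e : Fin r → Fin r → ℕ} (he : ∀ i j, e i j = e j i) {p : Fin r}
    {B : Finset (Fin r)} (hp : p ∉ B) :
    edgesWithin e (insert p B) = ∑ j ∈ B, e p j + edgesWithin e B := by
  simp only [edgesWithin, Finset.sum_filter]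
  rw [Finset.sum_insert hp, Finset.sum_insert hp, if_neg (lt_irrefl p), zero_add]
  simp only [Finset.sum_insert hp]
  rw [Finset.sum_add_distrib, ← add_assoc, ← Finset.sum_add_distrib]
  congr 1
  refine Finset.sum_congr rfl fun j hj => ?_
  rcases lt_trichotomy p j with h | h | h
  · simp [h, h.asymm]
  · exact absurd (h ▸ hj) hp
  · simp [h, h.asymm, he j p]

/-- Trees on a one-element set. -/
theorem treeSum_singleton (x : R) (e : Fin r → Fin r → ℕ) (p : Fin r) :
    treeSum x e {p} p = 1 := by
  have h : treesOn ({p} : Finset (Fin r)) = {⊥} := by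
    ext T
    rw [mem_treesOn, Finset.mem_singleton]
    constructor
    · intro hT
      ext a b
      refine iff_of_false (fun hab => hab.ne ?_) id
      rw [Finset.mem_singleton.mp (hT.mem hab), Finset.mem_singleton.mp (hT.mem' hab)]
    · rintro rfl
      refine ⟨SimpleGraph.isAcyclic_bot, fun h => h.elim, fun ha hb => ?_⟩
      rw [Finset.mem_singleton.mp ha, Finset.mem_singleton.mp hb]
  rw [treeSum, h, Finset.sum_singleton]
  simp [kappaIn, edgeProd, KappaTriple]

/-- Since (x - 1)[e_v]_x = x^{e_v} - 1, the term of v is the difference of x^{∑_{j ≤ v} e_j} and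
x^{∑_{j < v} e_j}. The exponent of the κ-statistic at a child of the root is what makes the sum
telescope. -/
theorem sum_qIntAt_telescope (x : R) (e : Fin r → ℕ) (C : Finset (Fin r)) :
    ∑ v ∈ C, (x - 1) * qIntAt x (e v) * x ^ ∑ j ∈ C.filter (· < v), e j =
      x ^ ∑ j ∈ C, e j - 1 := by
  have h := Finset.prod_add_ordered C (fun _ => (1 : R)) fun j => x ^ e j - 1
  simp only [add_sub_cancel, Finset.prod_const_one, mul_one, Finset.prod_pow_eq_pow_sum] at h
  rw [h, add_sub_cancel_left]
  exact Finset.sum_congr rfl fun v _ => by rw [sub_one_mul_qIntAt]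

theorem treeSum_recursion (x : R) {e : Fin r → Fin r → ℕ} (he : ∀ i j, e i j = e j i)
    {V : Finset (Fin r)} {p y : Fin r} (hp : p ∈ V) (hy : y ∈ V) (hne : y ≠ p) :
    treeSum x e V p = ∑ C ∈ (V.erase p).powerset.filter (y ∈ ·), ∑ v ∈ C,
      qIntAt x (e p v) * x ^ (∑ j ∈ C.filter (· < v), e p j) *
        (treeSum x e C v * treeSum x e (V \ C) p) := by
  rw [treeSum, sum_treesOn hp hy hne]
  refine Finset.sum_congr rfl fun C hC => Finset.sum_congr rfl fun v hv => ?_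
  simp only [Finset.mem_filter, Finset.mem_powerset] at hC
  rw [treeSum, treeSum, Finset.sum_mul_sum, Finset.mul_sum]
  refine Finset.sum_congr rfl fun T₁ h₁ => ?_
  rw [Finset.mul_sum]
  refine Finset.sum_congr rfl fun T₂ h₂ => ?_
  have hg : Grafting C (V \ C) p v T₁ T₂ (T₁ ⊔ T₂ ⊔ SimpleGraph.edge p v) :=
    ⟨Finset.disjoint_sdiff, hv, Finset.mem_sdiff.mpr ⟨hp, fun h => by simpa using hC.1 h⟩,
      mem_treesOn.mp h₁, mem_treesOn.mp h₂, rfl⟩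
  rw [hg.kappaIn_eq, hg.edgeProd_eq fun i j => by rw [he]]
  ring

/-- The cumulants of `B ↦ x ^ e(B)` are weighted numbers of trees. -/
theorem cumulantOn_eq_treeSum (x : R) {e : Fin r → Fin r → ℕ} (he : ∀ i j, e i j = e j i)
    (n : ℕ) : ∀ (V : Finset (Fin r)) (p : Fin r), p ∈ V → V.card = n →
      cumulantOn (fun B => x ^ edgesWithin e B) V = (x - 1) ^ (n - 1) * treeSum x e V p := by
  have h0 : (fun B : Finset (Fin r) => x ^ edgesWithin e B) ∅ = 1 := by simp [edgesWithin]
  induction n using Nat.strong_induction_on with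
  | _ n ih =>
    intro V p hp hV
    by_cases hs : V = {p}
    · subst hs
      rw [Finset.card_singleton] at hV
      rw [cumulantOn_singleton _ h0, treeSum_singleton, ← hV]
      simp [edgesWithin, Finset.filter_singleton]
    · obtain ⟨y, hy, hne⟩ : ∃ y ∈ V, y ≠ p := by
        by_contra h
        push Not at h
        exact hs (Finset.eq_singleton_iff_unique_mem.mpr ⟨hp, h⟩)
      rw [cumulantOn_recursion (a := fun B => x ^ ∑ j ∈ B, e p j) h0 hne.symm
        (fun B hB => by rw [edgesWithin_insert he hB, pow_add])
        (fun B C h => by rw [Finset.sum_union h, pow_add]) V hp hy,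
        treeSum_recursion x he hp hy hne, Finset.mul_sum]
      refine Finset.sum_congr rfl fun C hC => ?_
      simp only [Finset.mem_filter, Finset.mem_powerset] at hC
      have hCV : C ⊆ V := hC.1.trans (Finset.erase_subset _ _)
      have hpC : p ∉ C := fun h => by simpa using hC.1 h
      have hpos : 0 < C.card := Finset.card_pos.mpr ⟨y, hC.2⟩
      have hpD : p ∈ V \ C := Finset.mem_sdiff.mpr ⟨hp, hpC⟩
      have hposD : 0 < (V \ C).card := Finset.card_pos.mpr ⟨p, hpD⟩
      have hcard : C.card + (V \ C).card = n := by
        rw [Finset.card_sdiff_of_subset hCV]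
        have := Finset.card_le_card hCV
        omega
      -- The factor a C - 1 of the cumulant recursion becomes a sum over the child v of p in C. The
      -- induction hypothesis is used on C with root v, which is why the root is arbitrary in the
      -- statement; the telescope also supplies the missing factor x - 1.
      rw [← sum_qIntAt_telescope, Finset.mul_sum, Finset.sum_mul, Finset.mul_sum]
      refine Finset.sum_congr rfl fun v hv => ?_
      rw [ih C.card (by omega) C v hv rfl, ih (V \ C).card (by omega) (V \ C) p hpD rfl]
      have : n - 1 = (C.card - 1) + ((V \ C).card - 1) + 1 := by omega
      rw [this, pow_succ, pow_add]
      ring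

variable [NeZero r]

/-- The root has no proper ancestor, so i ≠ 0 and j ≠ 0 are automatic; triples with no edge from the
parent to j contribute 0. -/
theorem kappa_eq_kappaIn (G : Multigraph (Fin r)) (T : SimpleGraph (Fin r)) :
    kappa G T = kappaIn G.e T 0 := by
  rw [kappa, Finset.sum_filter, kappaIn]
  refine Finset.sum_congr rfl fun x _ => ?_
  have hroot : ∀ {i : Fin r}, ¬ AncestorIn T 0 i 0 := fun h => h.1 (onPath_root_iff.mp h.2)
  by_cases h0 : 0 < G.e x.1 x.2.2
  · refine if_congr ?_ rfl rfl
    constructor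
    · rintro ⟨_, _, h1, h2, h3, _⟩
      exact ⟨h1, h2, h3⟩
    · rintro ⟨h1, h2, h3⟩
      exact ⟨fun h => hroot (h ▸ h3.1), fun h => hroot (h ▸ h1), h1, h2, h3, h0⟩
  · have : G.e x.1 x.2.2 = 0 := by omega
    simp [this]

/-- The restriction to subtrees of G can be dropped: a tree using a pair of vertices not linked in G
has weight 0 because [0]_q = 0. -/
theorem aeval_inversionPolynomial {K : Type} [Field K] [Algebra ℕ K] (x : K) (G : Multigraph (Fin r)) :
    Polynomial.aeval x (inversionPolynomial G) =
      x ^ (∑ i, G.e i i) * treeSum x G.e Finset.univ 0 := by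
  rw [inversionPolynomial, map_mul, map_pow, Polynomial.aeval_X, map_sum, treeSum]
  congr 1
  have hq : ∀ n, Polynomial.aeval x (qInt n) = qIntAt x n := by
    intro n
    simp [qInt, qIntAt]
  have hterm : ∀ T : SimpleGraph (Fin r), Polynomial.aeval x (Polynomial.X ^ kappa G T *
      ∏ y ∈ (Finset.univ : Finset (Fin r × Fin r)).filter (fun y => y.1 < y.2 ∧ T.Adj y.1 y.2),
          qInt (G.e y.1 y.2)) =
      x ^ kappaIn G.e T 0 * edgeProd (fun i j => qIntAt x (G.e i j)) T := by
    intro T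
    rw [map_mul, map_pow, Polynomial.aeval_X, map_prod, kappa_eq_kappaIn, edgeProd,
      Finset.prod_filter]
    simp only [hq]
  simp only [hterm]
  refine Finset.sum_subset (fun T hT => ?_) fun T hT hT' => ?_
  · rw [Finset.mem_filter] at hT
    rw [mem_treesOn]
    exact ⟨hT.2.1.isAcyclic, fun _ => Finset.mem_univ _, fun _ _ => hT.2.1.connected _ _⟩
  · rw [mem_treesOn] at hT
    have htree : T.IsTree := by
      refine ⟨⟨fun a b => hT.reachable (Finset.mem_univ _) (Finset.mem_univ _)⟩, hT.acyclic⟩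
    have hle : ¬ T ≤ G.simple := fun h => hT' (Finset.mem_filter.mpr ⟨Finset.mem_univ _, htree, h⟩)
    obtain ⟨a, b, hab, hlt, hzero⟩ : ∃ a b, T.Adj a b ∧ a < b ∧ G.e a b = 0 := by
      by_contra hcon
      push Not at hcon
      refine hle fun a b hab => ⟨hab.ne, Nat.pos_of_ne_zero ?_⟩
      rcases lt_or_gt_of_ne hab.ne with h | h
      · exact hcon a b hab h
      · rw [G.symm]
        exact hcon b a hab.symm h
    have : edgeProd (fun i j => qIntAt x (G.e i j)) T = 0 := by
      refine Finset.prod_eq_zero (Finset.mem_univ (a, b)) ?_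
      rw [if_pos ⟨hlt, hab⟩]
      simp [hzero, qIntAt]
    rw [this, mul_zero]

/-- The inversion polynomial of a multigraph as a cumulant. -/
theorem jointCumulant_pow_eq {K : Type} [Field K] [Algebra ℕ K] (x : K) (G : Multigraph (Fin r)) :
    jointCumulant (fun B : Finset (Fin r) => x ^ (∑ i ∈ B, G.e i i + edgesWithin G.e B)) =
      (x - 1) ^ (r - 1) * Polynomial.aeval x (inversionPolynomial G) := by
  have h1 := cumulantOn_eq_treeSum x G.symm r Finset.univ 0 (Finset.mem_univ _) (by simp)
  rw [aeval_inversionPolynomial, mul_left_comm, ← h1, ← jointCumulant_eq_cumulantOn,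
    jointCumulant, jointCumulant, Finset.mul_sum]
  refine Finset.sum_congr rfl fun π _ => ?_
  -- Loops contribute the same power of x for every set partition, so they factor out of the
  -- cumulant.
  have h2 : ∏ B ∈ π.parts, x ^ (∑ i ∈ B, G.e i i) = x ^ ∑ i, G.e i i := by
    rw [Finset.prod_pow_eq_pow_sum]
    congr 1
    have := Finset.sum_biUnion (s := π.parts) (t := id) (f := fun i => G.e i i) π.disjoint
    rw [π.biUnion_parts] at this
    exact this.symm
  simp only [pow_add, Finset.prod_mul_distrib]
  rw [h2]
  ring

end TreeSums

/-! ### The diagram of λ^B inside that of λ^{[r]} -/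

section Columns

variable {r : ℕ} (lam : Fin r → YoungDiagram) {B : Finset (Fin r)} {x y : Σ _ : Fin r, ℕ}

theorem colBefore_irrefl (x : Σ _ : Fin r, ℕ) : ¬ ColBefore lam x x := by
  simp [ColBefore]

variable {lam}

theorem ColBefore.trans {z : Σ _ : Fin r, ℕ} (h : ColBefore lam x y) (h' : ColBefore lam y z) :
    ColBefore lam x z := by
  simp only [ColBefore] at *
  grind

theorem colBefore_trichotomy (x y : Σ _ : Fin r, ℕ) :
    ColBefore lam x y ∨ x = y ∨ ColBefore lam y x := by
  obtain ⟨b, k⟩ := x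
  obtain ⟨c, l⟩ := y
  simp only [ColBefore, Sigma.mk.injEq, heq_eq_eq]
  grind

variable (lam)

/-- The columns with a color in `B`. -/
def columnsIn (B : Finset (Fin r)) : Finset (Σ _ : Fin r, ℕ) :=
  (columns lam).filter fun x => x.1 ∈ B

/-- The position of a column among those with a color in `B`. -/
def colRank (B : Finset (Fin r)) (x : Σ _ : Fin r, ℕ) : ℕ :=
  ((columnsIn lam B).filter fun y => ColBefore lam y x).card

variable {lam}

theorem columnsIn_univ : columnsIn lam Finset.univ = columns lam := by
  simp [columnsIn]

theorem colRank_univ : colRank lam Finset.univ x = colPosition lam x := by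
  rw [colRank, columnsIn_univ, colPosition]

theorem mem_columnsIn : x ∈ columnsIn lam B ↔ x ∈ columns lam ∧ x.1 ∈ B := Finset.mem_filter

theorem colRank_lt (hx : x ∈ columnsIn lam B) (h : ColBefore lam x y) :
    colRank lam B x < colRank lam B y := by
  refine Finset.card_lt_card ((Finset.ssubset_iff_of_subset ?_).mpr
    ⟨x, Finset.mem_filter.mpr ⟨hx, h⟩, fun hx' => ?_⟩)
  · exact Finset.monotone_filter_right _ fun z _ hz => ColBefore.trans hz h
  · exact colBefore_irrefl lam x (Finset.mem_filter.mp hx').2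

theorem colRank_lt_iff (hx : x ∈ columnsIn lam B) (hy : y ∈ columnsIn lam B) :
    colRank lam B x < colRank lam B y ↔ ColBefore lam x y := by
  refine ⟨fun h => ?_, colRank_lt hx⟩
  rcases colBefore_trichotomy (lam := lam) x y with h' | rfl | h'
  · exact h'
  · exact absurd h (lt_irrefl _)
  · exact absurd (colRank_lt hy h') h.asymm

theorem colRank_injOn : Set.InjOn (colRank lam B) (columnsIn lam B) := by
  intro x hx y hy h
  rcases colBefore_trichotomy (lam := lam) x y with h' | h' | h'
  · exact absurd (colRank_lt hx h') h.not_lt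
  · exact h'
  · exact absurd (colRank_lt hy h') h.not_gt

theorem colRank_lt_card (hx : x ∈ columnsIn lam B) : colRank lam B x < (columnsIn lam B).card :=
  Finset.card_lt_card (Finset.filter_ssubset.mpr ⟨x, hx, colBefore_irrefl lam x⟩)

theorem exists_colRank_eq {j : ℕ} (hj : j < (columnsIn lam B).card) :
    ∃ x ∈ columnsIn lam B, colRank lam B x = j := by
  have h : (columnsIn lam B).image (colRank lam B) = Finset.range (columnsIn lam B).card := by
    refine Finset.eq_of_subset_of_card_le (fun j hj => ?_) ?_
    · obtain ⟨x, hx, rfl⟩ := Finset.mem_image.mp hj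
      exact Finset.mem_range.mpr (colRank_lt_card hx)
    · rw [Finset.card_range, Finset.card_image_of_injOn colRank_injOn]
  exact Finset.mem_image.mp (h ▸ Finset.mem_range.mpr hj)

theorem sum_rowLen_eq_card (i : ℕ) : ∑ b ∈ B, (lam b).rowLen i =
    ((columnsIn lam B).filter fun y => i < (lam y.1).colLen y.2).card := by
  have h : (columnsIn lam B).filter (fun y => i < (lam y.1).colLen y.2) =
      B.sigma fun b => Finset.range ((lam b).rowLen i) := by
    ext ⟨b, k⟩
    simp only [Finset.mem_filter, mem_columnsIn, columns, Finset.mem_sigma, Finset.mem_univ,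
      true_and, Finset.mem_range, ← YoungDiagram.mem_iff_lt_colLen,
      ← YoungDiagram.mem_iff_lt_rowLen]
    refine ⟨fun h => ⟨h.1.2, h.2⟩, fun h => ⟨⟨?_, h.1⟩, h.2⟩⟩
    exact (lam b).up_left_mem (Nat.zero_le _) le_rfl h.2
  rw [h, Finset.card_sigma]
  simp

/-- Columns are sorted by decreasing length, so those of length greater than i occupy an initial
segment of positions, whose size is the length of row i. -/
theorem mem_oplus_colRank (hx : x ∈ columnsIn lam B) (i : ℕ) :
    (i, colRank lam B x) ∈ oplus lam B ↔ i < (lam x.1).colLen x.2 := by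
  rw [mem_oplus, sum_rowLen_eq_card]
  constructor
  · intro h
    by_contra hcon
    refine h.not_ge (Finset.card_le_card (Finset.monotone_filter_right _ fun y _ hy => Or.inl ?_))
    omega
  · intro h
    refine Finset.card_lt_card ((Finset.ssubset_iff_of_subset ?_).mpr
      ⟨x, Finset.mem_filter.mpr ⟨hx, h⟩, fun hx' => ?_⟩)
    · refine Finset.monotone_filter_right _ fun y _ hy => ?_
      have hle : (lam x.1).colLen x.2 ≤ (lam y.1).colLen y.2 := by
        rcases hy with hy | hy
        · exact hy.le
        · exact hy.1.ge
      exact lt_of_lt_of_le h hle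
    · exact colBefore_irrefl lam x (Finset.mem_filter.mp hx').2

theorem exists_column {i j : ℕ} (h : (i, j) ∈ oplus lam B) :
    ∃ x ∈ columnsIn lam B, colRank lam B x = j := by
  rw [mem_oplus, sum_rowLen_eq_card] at h
  exact exists_colRank_eq (h.trans_le (Finset.card_filter_le _ _))

theorem colLen_oplus (hx : x ∈ columnsIn lam B) :
    (oplus lam B).colLen (colRank lam B x) = (lam x.1).colLen x.2 := by
  refine eq_of_forall_lt_iff fun i => ?_
  rw [← YoungDiagram.mem_iff_lt_colLen, mem_oplus_colRank hx]

theorem columnsIn_subset_univ (hx : x ∈ columnsIn lam B) : x ∈ columnsIn lam Finset.univ := by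
  rw [columnsIn_univ]
  exact (mem_columnsIn.mp hx).1

variable (lam B)

/-- The column of one of the `λ^b` to which a box of `λ^B` belongs. -/
def columnOf (u : (oplus lam B).cells) : Σ _ : Fin r, ℕ :=
  (exists_column (i := u.1.1) (j := u.1.2) u.2).choose

theorem columnOf_mem (u : (oplus lam B).cells) : columnOf lam B u ∈ columnsIn lam B :=
  (exists_column (i := u.1.1) (j := u.1.2) u.2).choose_spec.1

theorem colRank_columnOf (u : (oplus lam B).cells) : colRank lam B (columnOf lam B u) = u.1.2 :=
  (exists_column (i := u.1.1) (j := u.1.2) u.2).choose_spec.2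

theorem lt_colLen_columnOf (u : (oplus lam B).cells) :
    u.1.1 < (lam (columnOf lam B u).1).colLen (columnOf lam B u).2 := by
  rw [← mem_oplus_colRank (columnOf_mem lam B u), colRank_columnOf]
  exact u.2

/-- The embedding of the diagram of `λ^B` into that of `λ^{[r]}` respecting columns. -/
def embedCell (u : (oplus lam B).cells) : (total lam).cells :=
  ⟨(u.1.1, colRank lam Finset.univ (columnOf lam B u)), (mem_oplus_colRank
    (columnsIn_subset_univ (columnOf_mem lam B u)) _).mpr (lt_colLen_columnOf lam B u)⟩

/-- The color of a box of `λ^{[r]}`. -/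
def cellColor (u : (total lam).cells) : Fin r := (columnOf lam Finset.univ u).1

variable {lam B}

theorem columnOf_eq {u : (oplus lam B).cells} (hx : x ∈ columnsIn lam B)
    (h : colRank lam B x = u.1.2) : columnOf lam B u = x :=
  colRank_injOn (columnOf_mem lam B u) hx ((colRank_columnOf lam B u).trans h.symm)

theorem columnOf_embedCell (u : (oplus lam B).cells) :
    columnOf lam Finset.univ (embedCell lam B u) = columnOf lam B u :=
  columnOf_eq (columnsIn_subset_univ (columnOf_mem lam B u)) rfl

theorem hasColor_iff (u : (total lam).cells) (b : Fin r) :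
    HasColor lam u.1.2 b ↔ cellColor lam u = b := by
  constructor
  · rintro ⟨x, hx, rfl, h⟩
    exact congrArg Sigma.fst (columnOf_eq (x := x) (by rwa [columnsIn_univ])
      (by rw [colRank_univ, h]))
  · rintro rfl
    refine ⟨columnOf lam Finset.univ u, ?_, rfl, ?_⟩
    · rw [← columnsIn_univ]
      exact columnOf_mem lam _ u
    · rw [← colRank_univ]
      exact colRank_columnOf lam _ u

theorem cellColor_embedCell (u : (oplus lam B).cells) : cellColor lam (embedCell lam B u) ∈ B := by
  rw [cellColor, columnOf_embedCell]
  exact (mem_columnsIn.mp (columnOf_mem lam B u)).2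

theorem exists_embedCell_eq {u : (total lam).cells} (h : cellColor lam u ∈ B) :
    ∃ v, embedCell lam B v = u := by
  have hx : columnOf lam Finset.univ u ∈ columnsIn lam B := by
    have := columnOf_mem lam Finset.univ u
    rw [columnsIn_univ] at this
    exact mem_columnsIn.mpr ⟨this, h⟩
  have hm := (mem_oplus_colRank hx u.1.1).mpr (lt_colLen_columnOf lam _ u)
  refine ⟨⟨(u.1.1, colRank lam B (columnOf lam Finset.univ u)), hm⟩, Subtype.ext (Prod.ext rfl ?_)⟩
  change colRank lam Finset.univ (columnOf lam B ⟨_, hm⟩) = _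
  rw [columnOf_eq hx rfl]
  exact colRank_columnOf lam Finset.univ u

theorem embedCell_col_lt_iff (u v : (oplus lam B).cells) :
    (embedCell lam B u).1.2 < (embedCell lam B v).1.2 ↔ u.1.2 < v.1.2 := by
  change colRank lam _ _ < colRank lam _ _ ↔ _
  rw [colRank_lt_iff (columnsIn_subset_univ (columnOf_mem lam B u))
    (columnsIn_subset_univ (columnOf_mem lam B v)), ← colRank_lt_iff (columnOf_mem lam B u)
    (columnOf_mem lam B v), colRank_columnOf, colRank_columnOf]

theorem embedCell_col_eq_iff (u v : (oplus lam B).cells) :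
    (embedCell lam B u).1.2 = (embedCell lam B v).1.2 ↔ u.1.2 = v.1.2 := by
  have h1 := embedCell_col_lt_iff u v
  have h2 := embedCell_col_lt_iff v u
  omega

theorem embedCell_injective : Function.Injective (embedCell lam B) := fun u v h =>
  Subtype.ext (Prod.ext (congrArg (fun w => w.1.1) h)
    ((embedCell_col_eq_iff u v).mp (congrArg (fun w => w.1.2) h)))

theorem leg_embedCell (u : (oplus lam B).cells) : leg (embedCell lam B u) = leg u := by
  change (oplus lam Finset.univ).colLen (colRank lam Finset.univ (columnOf lam B u)) - _ =
    (oplus lam B).colLen u.1.2 - _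
  rw [colLen_oplus (columnsIn_subset_univ (columnOf_mem lam B u)), ← colRank_columnOf lam B u,
    colLen_oplus (columnOf_mem lam B u)]
  rfl

theorem directlyAbove_embedCell (u w : (oplus lam B).cells) :
    DirectlyAbove (embedCell lam B u) (embedCell lam B w) ↔ DirectlyAbove u w :=
  and_congr Iff.rfl (embedCell_col_eq_iff u w)

/-- The box below an embedded box lies in the same column, hence has the same color and is embedded
too. This is why descents and inversion pairs can be tested inside λ^B. -/
theorem exists_directlyAbove_embedCell {u : (oplus lam B).cells} {P : (total lam).cells → Prop} :
    (∃ w, DirectlyAbove (embedCell lam B u) w ∧ P w) ↔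
      ∃ w, DirectlyAbove u w ∧ P (embedCell lam B w) := by
  constructor
  · rintro ⟨w, h, hP⟩
    have hcol : columnOf lam Finset.univ w = columnOf lam Finset.univ (embedCell lam B u) :=
      columnOf_eq (columnOf_mem lam _ _) ((colRank_columnOf lam _ _).trans h.2)
    have hw : cellColor lam w ∈ B := by
      rw [cellColor, hcol]
      exact cellColor_embedCell u
    obtain ⟨v, rfl⟩ := exists_embedCell_eq hw
    exact ⟨v, (directlyAbove_embedCell u v).mp h, hP⟩
  · rintro ⟨w, h, hP⟩
    exact ⟨_, (directlyAbove_embedCell u w).mpr h, hP⟩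

variable {A : Type} [LinearOrder A] (neg : A → Prop) (f : Filling (total lam) A)

theorem mem_Des_embedCell (u : (oplus lam B).cells) :
    embedCell lam B u ∈ Des neg f ↔ u ∈ Des neg (f ∘ embedCell lam B) := by
  simp only [Des, Finset.mem_filter, Finset.mem_univ, true_and, exists_directlyAbove_embedCell,
    Function.comp]

theorem mem_InvP_embedCell (u v : (oplus lam B).cells) :
    (embedCell lam B u, embedCell lam B v) ∈ InvP neg f ↔
      (u, v) ∈ InvP neg (f ∘ embedCell lam B) := by
  simp only [InvP, Finset.mem_filter, Finset.mem_univ, true_and, exists_directlyAbove_embedCell,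
    embedCell_col_lt_iff]
  rfl

variable (B)

theorem maj_comp_embedCell : maj neg (f ∘ embedCell lam B) =
    ∑ u ∈ (Des neg f).filter (fun u => cellColor lam u ∈ B), (leg u + 1) := by
  refine Finset.sum_bij (fun u _ => embedCell lam B u) ?_ ?_ ?_ ?_
  · exact fun u hu => Finset.mem_filter.mpr
      ⟨(mem_Des_embedCell neg f u).mpr hu, cellColor_embedCell u⟩
  · exact fun u _ v _ h => embedCell_injective h
  · intro u hu
    rw [Finset.mem_filter] at hu
    obtain ⟨v, rfl⟩ := exists_embedCell_eq hu.2
    exact ⟨v, (mem_Des_embedCell neg f v).mp hu.1, rfl⟩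
  · exact fun u _ => by rw [leg_embedCell]

theorem card_InvP_comp_embedCell : (InvP neg (f ∘ embedCell lam B)).card =
    ((InvP neg f).filter fun p => cellColor lam p.1 ∈ B ∧ cellColor lam p.2 ∈ B).card := by
  refine Finset.card_bij (fun p _ => (embedCell lam B p.1, embedCell lam B p.2)) ?_ ?_ ?_
  · exact fun p hp => Finset.mem_filter.mpr
      ⟨(mem_InvP_embedCell neg f p.1 p.2).mpr hp, cellColor_embedCell _, cellColor_embedCell _⟩
  · exact fun p _ p' _ h => Prod.ext (embedCell_injective (congrArg Prod.fst h))
      (embedCell_injective (congrArg Prod.snd h))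
  · rintro ⟨u, v⟩ hp
    rw [Finset.mem_filter] at hp
    obtain ⟨u', rfl⟩ := exists_embedCell_eq hp.2.1
    obtain ⟨v', rfl⟩ := exists_embedCell_eq hp.2.2
    exact ⟨(u', v'), (mem_InvP_embedCell neg f u' v').mp hp.1, rfl⟩

theorem sum_sum_eq_sum_diag_add (a : Fin r → Fin r → ℕ) :
    ∑ i ∈ B, ∑ j ∈ B, a i j =
      ∑ i ∈ B, a i i + ∑ i ∈ B, ∑ j ∈ B.filter (i < ·), (a i j + a j i) := by
  have h : ∀ i j, a i j = (if i = j then a i j else 0) + ((if i < j then a i j else 0) +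
      if j < i then a i j else 0) := by
    intro i j
    rcases lt_trichotomy i j with h | rfl | h
    · simp [h, h.ne, h.asymm]
    · simp
    · simp [h, h.ne', h.asymm]
  calc ∑ i ∈ B, ∑ j ∈ B, a i j
      = ∑ i ∈ B, ∑ j ∈ B, ((if i = j then a i j else 0) + ((if i < j then a i j else 0) +
          if j < i then a i j else 0)) :=
        Finset.sum_congr rfl fun i _ => Finset.sum_congr rfl fun j _ => h i j
    _ = _ := by
        simp only [Finset.sum_add_distrib, Finset.sum_filter]
        congr 1
        · exact Finset.sum_congr rfl fun i hi => by rw [Finset.sum_ite_eq, if_pos hi]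
        · congr 1
          rw [Finset.sum_comm]

/-- The inversion pairs with both colors in B are sorted by the ordered pair of their colors. Both
orders of two distinct colors contribute to the same edges, and equal colors give loops. -/
theorem card_InvP_eq_edges : (InvP neg (f ∘ embedCell lam B)).card =
    ∑ i ∈ B, (fillingGraph lam neg f).e i i + edgesWithin (fillingGraph lam neg f).e B := by
  set a : Fin r → Fin r → ℕ := fun i j =>
    ((InvP neg f).filter fun p => cellColor lam p.1 = i ∧ cellColor lam p.2 = j).card with ha
  have hdiag : ∀ i, (fillingGraph lam neg f).e i i = a i i := fun i => by
    simp only [fillingGraph, hasColor_iff, or_self, ha]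
  have hoff : ∀ i j, i < j → (fillingGraph lam neg f).e i j = a i j + a j i := by
    intro i j hij
    simp only [fillingGraph, hasColor_iff, ha]
    rw [Finset.filter_or, Finset.card_union_of_disjoint]
    refine Finset.disjoint_filter.mpr fun p _ h1 h2 => hij.ne (h1.1.symm.trans h2.1)
  have hall : ((InvP neg f).filter fun p => cellColor lam p.1 ∈ B ∧ cellColor lam p.2 ∈ B).card =
      ∑ i ∈ B, ∑ j ∈ B, a i j := by
    rw [← Finset.sum_product', Finset.card_eq_sum_card_fiberwise (t := B ×ˢ B)
      (f := fun p => (cellColor lam p.1, cellColor lam p.2))]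
    · refine Finset.sum_congr rfl fun x hx => congrArg Finset.card ?_
      rw [Finset.mem_product] at hx
      ext p
      simp only [Finset.mem_filter, Prod.ext_iff]
      constructor
      · rintro ⟨⟨h1, _⟩, h2⟩
        exact ⟨h1, h2⟩
      · rintro ⟨h1, h2⟩
        exact ⟨⟨h1, h2.1 ▸ hx.1, h2.2 ▸ hx.2⟩, h2⟩
    · intro p hp
      exact Finset.mem_coe.mpr (Finset.mem_product.mpr (Finset.mem_filter.mp hp).2)
  rw [card_InvP_comp_embedCell, hall, sum_sum_eq_sum_diag_add, edgesWithin]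
  congr 1
  · exact Finset.sum_congr rfl fun i _ => (hdiag i).symm
  · exact Finset.sum_congr rfl fun i _ => Finset.sum_congr rfl fun j hj =>
      (hoff i j (Finset.mem_filter.mp hj).2).symm

variable {B}

/-- The boxes of `λ^{[r]}`, grouped according to a set partition of the colors. -/
def groupedCellsEquiv (π : Finpartition (Finset.univ : Finset (Fin r))) :
    (Σ B : π.parts, (oplus lam B).cells) ≃ (total lam).cells :=
  Equiv.ofBijective (fun u => embedCell lam u.1 u.2) <| by
    constructor
    · rintro ⟨⟨B, hB⟩, u⟩ ⟨⟨C, hC⟩, v⟩ h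
      dsimp only at h
      obtain rfl : B = C := π.eq_of_mem_parts hB hC (cellColor_embedCell u)
        (h ▸ cellColor_embedCell v)
      rw [embedCell_injective h]
    · intro u
      obtain ⟨B, hB, hu⟩ := π.exists_mem (Finset.mem_univ (cellColor lam u))
      obtain ⟨v, hv⟩ := exists_embedCell_eq hu
      exact ⟨⟨⟨B, hB⟩, v⟩, hv⟩

/-- Each descent is counted once, in the block containing its color; legs are unaffected, since
whole columns are kept. -/
theorem sum_maj_eq_maj (π : Finpartition (Finset.univ : Finset (Fin r))) :
    ∑ B ∈ π.parts, maj neg (f ∘ embedCell lam B) = maj neg f := by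
  have h : ∀ B, maj neg (f ∘ embedCell lam B) =
      ∑ b ∈ B, ∑ u ∈ (Des neg f).filter (fun u => cellColor lam u = b), (leg u + 1) := by
    intro B
    rw [maj_comp_embedCell, ← Finset.sum_fiberwise_of_maps_to (t := B) (g := cellColor lam)
      fun u hu => (Finset.mem_filter.mp hu).2]
    refine Finset.sum_congr rfl fun b hb => Finset.sum_congr ?_ fun _ _ => rfl
    ext u
    simp only [Finset.mem_filter]
    exact ⟨fun h => ⟨h.1.1, h.2⟩, fun h => ⟨⟨h.1, h.2 ▸ hb⟩, h.2⟩⟩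
  have h2 := Finset.sum_biUnion (s := π.parts) (t := id) (f := fun b =>
    ∑ u ∈ (Des neg f).filter (fun u => cellColor lam u = b), (leg u + 1)) π.disjoint
  rw [π.biUnion_parts] at h2
  simp only [h]
  rw [maj, ← Finset.sum_fiberwise_of_maps_to (t := Finset.univ) (g := cellColor lam)
      fun u _ => Finset.mem_univ _]
  exact h2.symm

end Columns

/-! ### Macdonald cumulants as sums over fillings -/

section Cumulant

variable {r : ℕ} (lam : Fin r → YoungDiagram)

theorem q_sub_one_ne_zero : q - 1 ≠ 0 := by
  rw [sub_ne_zero, q, ← map_one (algebraMap (MvPolynomial (Fin 2) ℚ) Kqt)]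
  intro h
  have h1 := congrArg (MvPolynomial.eval fun _ => (0 : ℚ))
    (IsFractionRing.injective (MvPolynomial (Fin 2) ℚ) Kqt h)
  simp at h1

theorem prod_macdonaldH (π : Finpartition (Finset.univ : Finset (Fin r))) :
    ∏ B ∈ π.parts, macdonaldH (oplus lam B) = monomialSum fun f : Filling (total lam) ℕ+ =>
      (∏ B ∈ π.parts, q ^ (∑ i ∈ B, (fillingGraph lam noNeg f).e i i +
        edgesWithin (fillingGraph lam noNeg f).e B)) * t ^ maj noNeg f := by
  simp only [macdonaldH]
  rw [prod_monomialSum, monomialSum_equiv (groupedCellsEquiv π)]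
  congr 1
  funext f
  change ∏ B : π.parts, q ^ inv noNeg (f ∘ embedCell lam B) * t ^ maj noNeg (f ∘ embedCell lam B)
    = _
  rw [Finset.prod_coe_sort π.parts fun B =>
    q ^ inv noNeg (f ∘ embedCell lam B) * t ^ maj noNeg (f ∘ embedCell lam B),
    Finset.prod_mul_distrib, Finset.prod_pow_eq_pow_sum π.parts (fun B => maj noNeg _),
    sum_maj_eq_maj]
  congr 1
  exact Finset.prod_congr rfl fun B _ => by rw [inv_eq_card_InvP, card_InvP_eq_edges]

/-- Macdonald cumulants as sums over all fillings. -/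
theorem macdonaldCumulant_eq_monomialSum [NeZero r] :
    macdonaldCumulant lam = monomialSum (cumulantWeight lam noNeg) := by
  rw [macdonaldCumulant, inv_smul_eq_iff₀ (pow_ne_zero _ q_sub_one_ne_zero), ← monomialSum_smul,
    jointCumulant]
  have h : ∀ π : Finpartition (Finset.univ : Finset (Fin r)),
      (-1 : MvPowerSeries ℕ+ Kqt) ^ (π.parts.card - 1) * ((π.parts.card - 1).factorial :
        MvPowerSeries ℕ+ Kqt) * ∏ B ∈ π.parts, macdonaldH (oplus lam B) =
      monomialSum fun f : Filling (total lam) ℕ+ => (-1 : Kqt) ^ (π.parts.card - 1) *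
        ((π.parts.card - 1).factorial : Kqt) *
        ((∏ B ∈ π.parts, q ^ (∑ i ∈ B, (fillingGraph lam noNeg f).e i i +
        edgesWithin (fillingGraph lam noNeg f).e B)) * t ^ maj noNeg f) := by
    intro π
    rw [monomialSum_smul, ← prod_macdonaldH, Algebra.smul_def]
    simp only [map_mul, map_pow, map_neg, map_one, map_natCast]
  simp only [h]
  rw [← monomialSum_sum]
  congr 1
  funext f
  -- For a fixed filling, t^{maj} is common to all set partitions, and the rest is the joint
  -- cumulant of the powers of q attached to its multigraph.
  rw [cumulantWeight, ← mul_assoc, ← jointCumulant_pow_eq, jointCumulant, Finset.sum_mul]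
  exact Finset.sum_congr rfl fun π _ => by ring

end Cumulant

/-! ### Invariance of the weight under standardization -/

section StandardFillings

variable {A : Type} [LinearOrder A] {neg : A → Prop} {A' : Type} [LinearOrder A'] {neg' : A' → Prop}

/-- It rewrites the counterclockwise condition on u, v, w, which are read in this order, through
comparisons `leNeg` of a later letter with an earlier one; inversion pairs then depend only on the
inversions in reading order. -/
theorem lePos_iff_not_leNeg {x y : A} : lePos neg x y ↔ ¬ leNeg neg y x := by
  rcases lt_trichotomy x y with h | rfl | h
  · simp [lePos, leNeg, h, h.asymm, h.ne']
  · simp [lePos, leNeg]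
  · simp [lePos, leNeg, h, h.asymm, h.ne']

/-- Two fillings have the same inversions with respect to the reading order. -/
def SameInversions {μ : YoungDiagram} (neg : A → Prop) (neg' : A' → Prop) (f : Filling μ A)
    (g : Filling μ A') : Prop :=
  ∀ u v, Precedes u v → (leNeg neg (f v) (f u) ↔ leNeg neg' (g v) (g u))

theorem DirectlyAbove.precedes {μ : YoungDiagram} {u w : μ.cells} (h : DirectlyAbove u w) :
    Precedes u w := Or.inl (by rw [h.1]; exact Nat.lt_succ_self _)

theorem SameInversions.Des_eq {μ : YoungDiagram} {f : Filling μ A} {g : Filling μ A'}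
    (h : SameInversions neg neg' f g) : Des neg f = Des neg' g := by
  ext u
  rw [mem_Des, mem_Des]
  exact exists_congr fun w => and_congr_right fun hw => h u w hw.precedes

theorem SameInversions.InvP_eq {μ : YoungDiagram} {f : Filling μ A} {g : Filling μ A'}
    (h : SameInversions neg neg' f g) : InvP neg f = InvP neg' g := by
  ext ⟨u, v⟩
  simp only [InvP, Finset.mem_filter, Finset.mem_univ, true_and]
  refine and_congr_right fun hrow => and_congr_right fun hcol => or_congr ?_ ?_
  · exact and_congr_right fun _ => h u v (Or.inr ⟨hrow, hcol⟩)
  · refine exists_congr fun w => and_congr_right fun hw => ?_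
    have hvw : Precedes v w := Or.inl (by rw [← hrow, hw.1]; exact Nat.lt_succ_self _)
    simp only [Counterclockwise, lePos_iff_not_leNeg, h u w hw.precedes, h v w hvw,
      h u v (Or.inr ⟨hrow, hcol⟩)]

theorem SameInversions.cumulantWeight_eq {r : ℕ} [NeZero r] {lam : Fin r → YoungDiagram}
    {f : Filling (total lam) A} {g : Filling (total lam) A'} (h : SameInversions neg neg' f g) :
    cumulantWeight lam neg f = cumulantWeight lam neg' g := by
  have hG : fillingGraph lam neg f = fillingGraph lam neg' g := by
    simp only [fillingGraph, h.InvP_eq]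
  rw [cumulantWeight, cumulantWeight, hG, maj, maj, h.Des_eq]

theorem Standardizes.sameInversions {μ : YoungDiagram} {f : Fin μ.card → A}
    {τ : Equiv.Perm (Fin μ.card)} (h : Standardizes neg f τ) :
    SameInversions neg noNeg (f ∘ readingEquiv μ) (standardFilling μ τ) := by
  intro u v huv
  rw [leNeg_noNeg, standardFilling, standardFilling, Nat.succPNat_lt_succPNat]
  exact h _ _ (readingEquiv_lt_iff.mpr huv)

/-- Expansion of a sum over fillings in terms of permutations. -/
theorem monomialSum_cumulantWeight {r : ℕ} [NeZero r] (lam : Fin r → YoungDiagram)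
    (neg : A → Prop) : monomialSum (cumulantWeight lam neg) =
      ∑ τ : Equiv.Perm (Fin (total lam).card),
        cumulantWeight lam noNeg (standardFilling (total lam) τ) •
          genF neg (total lam).card (iDes τ) := by
  rw [monomialSum_equiv (readingEquiv (total lam))]
  exact monomialSum_eq_sum_genF neg _ _ fun f τ h => h.sameInversions.cumulantWeight_eq

end StandardFillings

/-- Polynomials in the power sums form a subalgebra, so κ inherits symmetry from the Macdonald
polynomials. -/
theorem exists_ofPowerSums_eq_macdonaldCumulant {r : ℕ} (lam : Fin r → YoungDiagram) :
    ∃ P, ofPowerSums P = macdonaldCumulant lam := by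
  change macdonaldCumulant lam ∈ ofPowerSums.range
  have hH : ∀ μ, macdonaldH μ ∈ ofPowerSums.range := exists_ofPowerSums_eq_macdonaldH
  exact Subalgebra.smul_mem _ (Subalgebra.sum_mem _ fun π _ => Subalgebra.mul_mem _
    (Subalgebra.mul_mem _ (Subalgebra.pow_mem _ (Subalgebra.neg_mem _ (Subalgebra.one_mem _)) _)
      (Subalgebra.natCast_mem _ _)) (Subalgebra.prod_mem _ fun B _ => hH _)) _

/-! ### Coefficients in the fundamental basis and superization -/

section Coefficients

variable {r : ℕ} [NeZero r] (lam : Fin r → YoungDiagram)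

/-- The coefficients of a Macdonald cumulant in the fundamental basis. -/
def fundamentalCoeff (D : Finset ℕ) : MvPolynomial (Fin 2) ℕ :=
  ∑ τ : Equiv.Perm (Fin (total lam).card) with iDes τ = D,
    Polynomial.aeval (MvPolynomial.X 0)
      (inversionPolynomial (fillingGraph lam noNeg (standardFilling (total lam) τ))) *
      MvPolynomial.X 1 ^ maj noNeg (standardFilling (total lam) τ)

theorem aeval_fundamentalCoeff (D : Finset ℕ) :
    (MvPolynomial.aeval ![q, t] (fundamentalCoeff lam D) : Kqt) =
      ∑ τ : Equiv.Perm (Fin (total lam).card) with iDes τ = D,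
        cumulantWeight lam noNeg (standardFilling (total lam) τ) := by
  rw [fundamentalCoeff, map_sum]
  refine Finset.sum_congr rfl fun τ _ => ?_
  rw [map_mul, map_pow, ← Polynomial.aeval_algHom_apply, MvPolynomial.aeval_X, MvPolynomial.aeval_X]
  rfl

theorem macdonaldCumulant_eq_sum_fundamentalF : macdonaldCumulant lam =
      ∑ τ : Equiv.Perm (Fin (total lam).card),
        cumulantWeight lam noNeg (standardFilling (total lam) τ) •
          fundamentalF (total lam).card (iDes τ) := by
  rw [macdonaldCumulant_eq_monomialSum, monomialSum_cumulantWeight]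
  simp only [fundamentalF_eq_genF]

theorem macdonaldCumulant_eq_sum_fundamentalCoeff : macdonaldCumulant lam =
      ∑ D ∈ (Finset.Icc 1 ((total lam).card - 1)).powerset,
        (MvPolynomial.aeval ![q, t] (fundamentalCoeff lam D) : Kqt) •
          fundamentalF (total lam).card D := by
  rw [macdonaldCumulant_eq_sum_fundamentalF, ← Finset.sum_fiberwise_of_maps_to (g := iDes)
    fun τ _ => Finset.mem_powerset.mpr (iDes_subset τ)]
  refine Finset.sum_congr rfl fun D _ => ?_
  rw [aeval_fundamentalCoeff, Finset.sum_smul]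
  exact Finset.sum_congr rfl fun τ hτ => by rw [(Finset.mem_filter.mp hτ).2]

theorem eq_of_sum_fundamentalF_eq {n : ℕ} {c c' : Finset ℕ → Kqt}
    (h : ∑ D ∈ (Finset.Icc 1 (n - 1)).powerset, c D • fundamentalF n D =
      ∑ D ∈ (Finset.Icc 1 (n - 1)).powerset, c' D • fundamentalF n D) {D : Finset ℕ}
    (hD : D ∈ (Finset.Icc 1 (n - 1)).powerset) : c D = c' D := by
  have hli : LinearIndependent Kqt fun D : (Finset.Icc 1 (n - 1)).powerset =>
      genF noNeg n (D : Finset ℕ) :=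
    linearIndependent_genF.comp
      (fun D : (Finset.Icc 1 (n - 1)).powerset => (⟨(n, D.1), Finset.mem_powerset.mp D.2⟩ : FIndex))
      fun D D' he => Subtype.ext (congrArg (fun x : FIndex => x.1.2) he)
  simp only [fundamentalF_eq_genF] at h
  rw [← sub_eq_zero, ← Finset.sum_sub_distrib] at h
  simp only [← sub_smul] at h
  rw [← Finset.sum_coe_sort] at h
  exact sub_eq_zero.mp (Fintype.linearIndependent_iff.mp hli (fun D => c D - c' D) h ⟨D, hD⟩)

theorem isSuperization_macdonaldCumulant [LinearOrder SuperLetter] :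
    IsSuperization (macdonaldCumulant lam) (∑ τ : Equiv.Perm (Fin (total lam).card),
      cumulantWeight lam noNeg (standardFilling (total lam) τ) •
        superF (total lam).card (iDes τ)) := by
  refine isSuperization_of_mem_superSpan (exists_ofPowerSums_eq_macdonaldCumulant lam) ?_
  rw [macdonaldCumulant_eq_sum_fundamentalF]
  simp only [fundamentalF_eq_genF, superF_eq_genF]
  exact sum_genF_pair_mem_superSpan _ _ _ fun τ _ => iDes_subset τ

end Coefficients

end MacdonaldCumulant

end

theorem mainTheorem4 (r : ℕ) [NeZero r] (lam : Fin r → YoungDiagram) :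
    -- the fundamental quasisymmetric expansion
    macdonaldCumulant lam =
      ∑ τ : Equiv.Perm (Fin (total lam).card),
        cumulantWeight lam noNeg (standardFilling (total lam) τ) •
          fundamentalF (total lam).card (iDes τ) ∧
    -- the coefficients in the fundamental basis are unique, and they are
    -- polynomials in `q, t` with nonnegative integer coefficients
    (∃ c : Finset ℕ → MvPolynomial (Fin 2) ℕ,
      macdonaldCumulant lam =
        ∑ D ∈ (Finset.Icc 1 ((total lam).card - 1)).powerset,
          (MvPolynomial.aeval ![q, t] (c D) : Kqt) • fundamentalF (total lam).card D ∧
      ∀ c' : Finset ℕ → Kqt,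
        macdonaldCumulant lam =
          ∑ D ∈ (Finset.Icc 1 ((total lam).card - 1)).powerset,
            c' D • fundamentalF (total lam).card D →
        ∀ D ∈ (Finset.Icc 1 ((total lam).card - 1)).powerset,
          c' D = MvPolynomial.aeval ![q, t] (c D)) ∧
    -- the two formulas for the superization, for every admissible order of the super alphabet
    ∀ [LinearOrder SuperLetter], StrictMono SuperLetter.pos →
      IsSuperization (macdonaldCumulant lam)
        (∑ τ : Equiv.Perm (Fin (total lam).card),
          cumulantWeight lam noNeg (standardFilling (total lam) τ) •
            superF (total lam).card (iDes τ)) ∧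
      IsSuperization (macdonaldCumulant lam)
        (monomialSum fun f : Filling (total lam) SuperLetter =>
          cumulantWeight lam SuperLetter.IsNeg f) := by
  refine ⟨macdonaldCumulant_eq_sum_fundamentalF lam, ⟨fundamentalCoeff lam,
    macdonaldCumulant_eq_sum_fundamentalCoeff lam, fun c' hc' D hD => ?_⟩,
    fun _ => ⟨isSuperization_macdonaldCumulant lam, ?_⟩⟩
  · exact eq_of_sum_fundamentalF_eq
      (hc'.symm.trans (macdonaldCumulant_eq_sum_fundamentalCoeff lam)) hD
  -- The sum over super fillings has the same expansion in the F̃_{n,D}, since standardization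
  -- applies to the signed alphabet with the same weights of permutations.
  · have h := isSuperization_macdonaldCumulant lam
    simp only [superF_eq_genF] at h
    rwa [← monomialSum_cumulantWeight] at h
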